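/- **Theorem.** Suppose the following conjecture is true. *Conjecture (quantum one-way communication in the small-advantage regime).* In a $q$-qubit one-way protocol for the index function on $\{-1,1\}^n\times[n]$, Alice, on input $x$, sends a (possibly mixed) state $\rho_x$, i.e. a $2^q\times 2^q$ complex density matrix; Bob, on input $i$, applies a two-outcome POVM to it and outputs the outcome $b(\rho_x,i)\in\{-1,1\}$. For every small enough $\delta>0$ there are constants $K,c>0$ such that for all $n\ge 1$ and $q$: if in some $q$-qubit protocol there are sets $S_x\subseteq[n]$ with $|S_x|\ge(1-\delta)n$ for every $x\in\{-1,1\}^n$ and $$\mathbb E_{x\sim\{-1,1\}^n}\ \min_{i\in S_x}\Pr\big(b(\rho_x,i)=x_i\big)\ \ge\ \tfrac12+\epsilon,\qquad \epsilon\ge K/\sqrt n,$$ then $q\ge\log_2(1/\epsilon^2)+c\,\epsilon^2 n$. Then the Matrix Spencer conjecture holds, and there is a polynomial-time algorithm based on semidefinite programming to find the signing that it promises. Precisely, there is a constant $C>0$ such that, with $\Delta(n,m)=C\sqrt{n\max\{1,\log(m/n)\}}$, the following hold for all $n,m$. 1. For all $A_1,\dots,A_n\in\mathbb R^{m\times m}$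 with spectral norms $\|A_i\|\le 1$ there is $x\in\{-1,1\}^n$ with $\big\|\sum_{i\le n}x_iA_i\big\|\le\Delta(n,m)$. 2. (Semidefinite programming.) There is a constant $c>0$ such that for all such $A_1,\dots,A_n$, for at least a $c/n$ fraction of all $g\in\{-1,1\}^n$, every optimal solution $x$ of the semidefinite program $$\max\ \langle x,g\rangle\quad\text{subject to}\quad \Big\|\sum_{i\le n}x_iA_i\Big\|\le\Delta(n,m),\quad x\in[-1,1]^n$$ is a partial coloring, i.e. has at least $cn$ coordinates with $|x_i|=1$. 3. (Algorithm.) There is a randomized algorithm which, given $A_1,\dots,A_n\in\mathbb Q^{m\times m}$ with $\|A_i\|\le 1$, always halts in (bit) time polynomial in $n$, $m$ and the total bit length of the entries, and which with probability at least $1-2^{-(n+m)}$ outputs $x\in\{-1,1\}^n$ with $\big\|\sum_{i\le n}x_iA_i\big\|\le\Delta(n,m)$. -/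

import Mathlib

open scoped Matrix.Norms.L2Operator ComplexOrder

noncomputable section

/-! ### Quantum one-way protocols for the index function -/

/-- A one-way protocol for `index (x, i) = x i` on `{-1, 1} ^ n × [n]` with a `q`-qubit message.
On input `x` Alice sends the (possibly mixed) state `msg x`, a density matrix on `ℂ ^ (2 ^ q)`; on
input `i` Bob measures it with the two-outcome POVM `meas i` and outputs the outcome in `{-1, 1}`.
(Bob's private randomness is absorbed in the POVM.) -/
structure IndexProtocol (q n : ℕ) where
  msg : (Fin n → ℤˣ) → Matrix (Fin (2 ^ q)) (Fin (2 ^ q)) ℂ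
  msg_posSemidef : ∀ x, (msg x).PosSemidef
  msg_trace : ∀ x, (msg x).trace = 1
  meas : Fin n → ℤˣ → Matrix (Fin (2 ^ q)) (Fin (2 ^ q)) ℂ
  meas_posSemidef : ∀ i b, (meas i b).PosSemidef
  meas_sum : ∀ i, ∑ b, meas i b = 1

/-- The probability that Bob's output on `(x, i)` equals `x i`. -/
def IndexProtocol.successProb {q n : ℕ} (P : IndexProtocol q n) (x : Fin n → ℤˣ) (i : Fin n) : ℝ :=
  (P.msg x * P.meas i (x i)).trace.re

/-- `E_x min_{i ∈ S x} Pr (b (ρ_x, i) = x i)` for uniformly random `x`. -/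
def IndexProtocol.avgMinSuccess {q n : ℕ} (P : IndexProtocol q n)
    (S : (Fin n → ℤˣ) → Finset (Fin n)) : ℝ :=
  (∑ x : Fin n → ℤˣ, ⨅ i : S x, P.successProb x i) / 2 ^ n

/-- The conjectured quantum one-way communication lower bound in the small-advantage regime: for
every small enough `δ > 0` there are constants `K, c > 0` such that, if Bob has advantage
`ε ≥ K / √n` on at least `(1 - δ) n` indices, then `q ≥ log₂ (1 / ε ^ 2) + c ε ^ 2 n`. -/
def QuantumOneWayConjecture : Prop :=
  ∃ δ₀ : ℝ, 0 < δ₀ ∧ ∀ δ : ℝ, 0 < δ → δ < δ₀ →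
    ∃ K : ℝ, 0 < K ∧ ∃ c : ℝ, 0 < c ∧
      ∀ (n q : ℕ) (P : IndexProtocol q n) (S : (Fin n → ℤˣ) → Finset (Fin n)) (ε : ℝ),
        0 < n → (∀ x, (1 - δ) * n ≤ ((S x).card : ℝ)) →
        1 / 2 + ε ≤ P.avgMinSuccess S → K / √(n : ℝ) ≤ ε →
        Real.logb 2 (1 / ε ^ 2) + c * ε ^ 2 * n ≤ q

/-! ### Discrepancy -/

/-- `√(n log (m / n))`, with the logarithm read as at least `1`. -/
def spencerBound (n m : ℕ) : ℝ := √(n * max 1 (Real.log ((m : ℝ) / n)))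

/-- The spectral norm of `∑ i, x i • A i` for a signing `x`. -/
def signedNorm {n m : ℕ} (A : Fin n → Matrix (Fin m) (Fin m) ℝ) (x : Fin n → ℤˣ) : ℝ :=
  ‖∑ i, (((x i : ℤˣ) : ℤ) : ℝ) • A i‖

/-- `x` is an optimal solution of the semidefinite program
`max ⟨y, g⟩` subject to `‖∑ i, y i • A i‖ ≤ Δ` and `y ∈ [-1, 1] ^ n`. -/
def IsSDPOptimum {n m : ℕ} (A : Fin n → Matrix (Fin m) (Fin m) ℝ) (Δ : ℝ) (g : Fin n → ℤˣ)
    (x : Fin n → ℝ) : Prop :=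
  let feasible : Set (Fin n → ℝ) := {y | (∀ i, |y i| ≤ 1) ∧ ‖∑ i, y i • A i‖ ≤ Δ}
  x ∈ feasible ∧ IsMaxOn (fun y => ∑ i, y i * (((g i : ℤˣ) : ℤ) : ℝ)) feasible x

/-! ### Randomized programs with logarithmic (bit) cost

A structured language on integer registers and integer arrays. Every operation is charged the bit
lengths of the integers and addresses involved, so time is polynomially related to Turing machine
time. Coin flips read a tape of random bits; flipping a coin on an exhausted tape is not possible,
i.e. the execution has no result. -/

/-- Bit length of an integer. -/
def bitLen (z : ℤ) : ℕ := z.natAbs.size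

structure Machine where
  reg : ℕ → ℤ
  arr : ℕ → ℕ → ℤ
  tape : List Bool

inductive Expr where
  | const (z : ℤ)
  | reg (r : ℕ)
  | get (a : ℕ) (idx : Expr)
  | add (e f : Expr)
  | sub (e f : Expr)
  | mul (e f : Expr)
  | div (e f : Expr)

def Expr.eval (s : Machine) : Expr → ℤ
  | .const z => z
  | .reg r => s.reg r
  | .get a idx => s.arr a (idx.eval s).toNat
  | .add e f => e.eval s + f.eval s
  | .sub e f => e.eval s - f.eval s
  | .mul e f => e.eval s * f.eval s
  | .div e f => e.eval s / f.eval s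

/-- Every node of the expression is charged `1` plus the bit length of its value. -/
def Expr.cost (s : Machine) : Expr → ℕ
  | .const z => 1 + bitLen z
  | .reg r => 1 + bitLen (s.reg r)
  | .get a idx => 1 + bitLen (s.arr a (idx.eval s).toNat) + idx.cost s
  | .add e f => 1 + bitLen (e.eval s + f.eval s) + e.cost s + f.cost s
  | .sub e f => 1 + bitLen (e.eval s - f.eval s) + e.cost s + f.cost s
  | .mul e f => 1 + bitLen (e.eval s * f.eval s) + e.cost s + f.cost s
  | .div e f => 1 + bitLen (e.eval s / f.eval s) + e.cost s + f.cost s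

inductive Program where
  | skip
  | assign (r : ℕ) (e : Expr)
  | store (a : ℕ) (idx e : Expr)
  | flip (r : ℕ)
  | comp (p p' : Program)
  | branch (e : Expr) (p p' : Program)
  | loop (e : Expr) (p : Program)

/-- `Exec p s k s'`: started in `s`, the program `p` halts in `s'` after time `k`.
`branch e p p'` runs `p` if `e > 0` and `p'` otherwise; `loop e p` runs `p` as long as `e > 0`. -/
inductive Exec : Program → Machine → ℕ → Machine → Prop
  | skip (s : Machine) : Exec .skip s 1 s
  | assign (s : Machine) (r : ℕ) (e : Expr) :
      Exec (.assign r e) s (1 + e.cost s) { s with reg := Function.update s.reg r (e.eval s) }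
  | store (s : Machine) (a : ℕ) (idx e : Expr) :
      Exec (.store a idx e) s (1 + idx.cost s + e.cost s)
        { s with arr :=
            Function.update s.arr a (Function.update (s.arr a) (idx.eval s).toNat (e.eval s)) }
  | flip (s : Machine) (r : ℕ) (b : Bool) (t : List Bool) (h : s.tape = b :: t) :
      Exec (.flip r) s 1
        { s with reg := Function.update s.reg r (if b then 1 else 0), tape := t }
  | comp (p p' : Program) (s₁ s₂ s₃ : Machine) (k l : ℕ) (h : Exec p s₁ k s₂)
      (h' : Exec p' s₂ l s₃) : Exec (.comp p p') s₁ (1 + k + l) s₃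
  | branch_pos (e : Expr) (p p' : Program) (s s' : Machine) (k : ℕ) (he : 0 < e.eval s)
      (h : Exec p s k s') : Exec (.branch e p p') s (1 + e.cost s + k) s'
  | branch_neg (e : Expr) (p p' : Program) (s s' : Machine) (k : ℕ) (he : e.eval s ≤ 0)
      (h : Exec p' s k s') : Exec (.branch e p p') s (1 + e.cost s + k) s'
  | loop_stop (e : Expr) (p : Program) (s : Machine) (he : e.eval s ≤ 0) :
      Exec (.loop e p) s (1 + e.cost s) s
  | loop_step (e : Expr) (p : Program) (s₁ s₂ s₃ : Machine) (k l : ℕ) (he : 0 < e.eval s₁)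
      (h : Exec p s₁ k s₂) (h' : Exec (.loop e p) s₂ l s₃) :
      Exec (.loop e p) s₁ (1 + e.cost s₁ + k + l) s₃

/-! ### The algorithmic problem: finding a signing of rational matrices -/

/-- The entry in place `p = (i * m + j) * m + k` (that is, `A i j k`) of the row-major listing. -/
def flatEntry {n m : ℕ} (A : Fin n → Matrix (Fin m) (Fin m) ℚ) (p : ℕ) (h : p < n * (m * m)) : ℚ :=
  have hm : 0 < m := Nat.pos_of_ne_zero fun h0 => by simp [h0] at h
  A ⟨p / (m * m), Nat.div_lt_of_lt_mul (by rwa [mul_comm])⟩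
    ⟨p / m % m, Nat.mod_lt _ hm⟩ ⟨p % m, Nat.mod_lt _ hm⟩

/-- Initial state: `n`, `m` in registers `0`, `1`; numerators and denominators of the entries of the
matrices in arrays `0` and `1`; random bits on the tape; `0` everywhere else. -/
def inputState {n m : ℕ} (A : Fin n → Matrix (Fin m) (Fin m) ℚ) (t : List Bool) : Machine where
  reg r := if r = 0 then n else if r = 1 then m else 0
  arr a p :=
    if h : p < n * (m * m) then
      if a = 0 then (flatEntry A p h).num else if a = 1 then (flatEntry A p h).den else 0
    else 0
  tape := t

/-- Input size: number of matrices, dimension, and the total bit length of all entries. -/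
def inputSize {n m : ℕ} (A : Fin n → Matrix (Fin m) (Fin m) ℚ) : ℕ :=
  n + m + ∑ i, ∑ j, ∑ k, (bitLen (A i j k).num + bitLen (A i j k).den)

/-- The real matrices given by rational ones. -/
def toReal {n m : ℕ} (A : Fin n → Matrix (Fin m) (Fin m) ℚ) : Fin n → Matrix (Fin m) (Fin m) ℝ :=
  fun i => (A i).map (fun a => (a : ℝ))

/-- Array `2` of the state `s` holds a signing of discrepancy at most `D`. -/
def OutputsSigning {n m : ℕ} (A : Fin n → Matrix (Fin m) (Fin m) ℚ) (D : ℝ) (s : Machine) : Prop :=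
  ∃ x : Fin n → ℤˣ, (∀ i : Fin n, s.arr 2 i = (x i : ℤ)) ∧ signedNorm (toReal A) x ≤ D

/-- In time polynomial in the input size, and using polynomially many random bits, `P` finds a
signing of discrepancy at most `C * spencerBound n m` of any `n` rational `m × m` matrices of
spectral norm at most `1`. It halts in time on all random bits, and succeeds with probability at
least `1 - 2 ^ (-(n + m))`. -/
def FindsSigningsInPolyTime (P : Program) (C : ℝ) : Prop :=
  ∃ time coins : Polynomial ℕ,
    ∀ (n m : ℕ) (A : Fin n → Matrix (Fin m) (Fin m) ℚ), (∀ i, ‖toReal A i‖ ≤ 1) →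
      (∀ t : Fin (coins.eval (inputSize A)) → Bool, ∃ (k : ℕ) (s : Machine),
        Exec P (inputState A (List.ofFn t)) k s ∧ k ≤ time.eval (inputSize A)) ∧
      (1 - 1 / 2 ^ (n + m)) * 2 ^ coins.eval (inputSize A) ≤
        (({t : Fin (coins.eval (inputSize A)) → Bool | ∃ (k : ℕ) (s : Machine),
          Exec P (inputState A (List.ofFn t)) k s ∧
            OutputsSigning A (C * spencerBound n m) s}.ncard : ℕ) : ℝ)

end

noncomputable section

/-! ### Quadratic forms and the spectral norm -/

/-! Call a sign vector g stuck if, after deleting a few indices, every convex combination of the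
matrices g_i A_i still has large norm (`IsStuck`). By duality between convex combinations and states
(`exists_weights_of_forall_exists_lt`, `norm_le_of_forall_density`), a stuck g comes with a single
density matrix in which all remaining g_i A_i, dilated to symmetric matrices, have large expectation
simultaneously. Such a state encodes g: measuring the dilation of A_i reveals g_i with an advantage
proportional to the norm bound ε. The state needs only log₂ m + O(1) qubits. If half of all g were
stuck at level κ√(L/n), with L = max(1, log(m/n)), the conjecture would give log n - log(κ² L) + c
κ² L ≤ log m + O(1) up to constants, which is false for large κ. It is the term log(1/ε²) that turns
log m into log(m/n). Hence at most half of all sign vectors are stuck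
(`QuantumOneWayConjecture.isStuck_rare`), and this is the only use of the conjecture.

If g is not stuck, an optimum x of the semidefinite program has many tight coordinates. Otherwise
some convex combination p off the tight set has small norm, the vector 2n·(p_i g_i) satisfies the
norm constraint, and a small step from x towards it stays in the cube and increases the objective
(`IsSDPOptimum.card_tight`).

The algorithm replaces the program by exact integer computation. The norm constraint becomes a
convex trace-power penalty, and a local search on the grid of width 1/N moves one coordinate at a
time. Convexity together with a bound on second differences shows that a grid local minimum has the
property used above: no small convex combination avoids the tight coordinates
(`lt_norm_of_local_min`). So a round that fixes less than a 1/d fraction of the a alive coordinates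
certifies that its signs are stuck (`isStuck_of_not_commit`), which happens with probability at most
1/2.

Rounds with enough progress are kept, the others are discarded. The discrepancy added with a alive
coordinates is at most a constant times (an)^(1/4)·√L, which decays geometrically over the kept
rounds, so the total is O(√(nL)) (`norm_combination_round_le`). The potential 2^alive - 1 shrinks on
average by 3/4 per round (`card_alive_pos_le`), so 5(n+m) rounds fix everything except with
probability 2^(-(n+m)). The running time is the product of a polynomial step count and a uniform
bound on bit lengths (`Runs`, `exec_spencerProgram`). Signings of real matrices follow from the
algorithm by rational approximation. -/

theorem mulVec_dotProduct_self_le {l k : Type*} [Fintype l] [Fintype k] [DecidableEq k]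
    (B : Matrix l k ℝ) (v : k → ℝ) :
    (B.mulVec v) ⬝ᵥ (B.mulVec v) ≤ ‖B‖ ^ 2 * (v ⬝ᵥ v) := by
  have h := Matrix.l2_opNorm_mulVec B (WithLp.toLp 2 v)
  have e : ∀ {κ : Type _} [Fintype κ] (w : κ → ℝ), w ⬝ᵥ w = ‖WithLp.toLp 2 w‖ ^ 2 := by
    intro κ _ w
    rw [EuclideanSpace.norm_sq_eq]
    simp [dotProduct, sq]
  have e2 : v ⬝ᵥ v = ‖WithLp.toLp 2 v‖ ^ 2 := by
    rw [EuclideanSpace.norm_sq_eq]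
    simp [dotProduct, sq]
  rw [e, e2, ← mul_pow]
  exact pow_le_pow_left₀ (norm_nonneg _) h 2

theorem l2_opNorm_le_of_dotProduct {l k : Type*} [Fintype l] [Fintype k] [DecidableEq k]
    (B : Matrix l k ℝ) {ε : ℝ} (hε : 0 ≤ ε)
    (h : ∀ v, (B.mulVec v) ⬝ᵥ (B.mulVec v) ≤ ε ^ 2 * (v ⬝ᵥ v)) : ‖B‖ ≤ ε := by
  rw [Matrix.l2_opNorm_def]
  refine ContinuousLinearMap.opNorm_le_bound _ hε fun x => ?_
  have e2 : (x.ofLp) ⬝ᵥ (x.ofLp) = ‖x‖ ^ 2 := by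
    rw [EuclideanSpace.norm_sq_eq]
    simp [dotProduct, sq]
  have e3 : (B.mulVec x.ofLp) ⬝ᵥ (B.mulVec x.ofLp) = ‖WithLp.toLp 2 (B.mulVec x.ofLp)‖ ^ 2 := by
    rw [EuclideanSpace.norm_sq_eq]
    simp [dotProduct, sq]
  have := h x.ofLp
  rw [e2, e3, ← mul_pow] at this
  exact (pow_le_pow_iff_left₀ (norm_nonneg _) (by positivity) (by norm_num)).1 this

/-! ### Separation -/

/-- A minimax statement by Hahn–Banach: the open set of vectors exceeding ε off T is disjoint from
the image of S under all f i. Coordinates in T are unconstrained, so the separating functional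
vanishes there; the others can be increased freely, which fixes the sign of their coefficients.
Normalizing gives the weights. -/
theorem exists_weights_of_forall_exists_lt {ι E : Type*} [Fintype ι] [DecidableEq ι]
    [AddCommGroup E] [Module ℝ E]
    {S : Set E} (hS : Convex ℝ S) (hne : S.Nonempty) (f : ι → E →ₗ[ℝ] ℝ) (T : Finset ι) (ε : ℝ)
    (h : ¬ ∃ ρ ∈ S, ∀ i ∉ T, ε < f i ρ) :
    ∃ p : ι → ℝ, (∀ i, 0 ≤ p i) ∧ (∀ i ∈ T, p i = 0) ∧ ∑ i, p i = 1 ∧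
      ∀ ρ ∈ S, ∑ i, p i * f i ρ ≤ ε := by
  have hO : IsOpen {v : ι → ℝ | ∀ i ∉ T, ε < v i} := by
    have : {v : ι → ℝ | ∀ i ∉ T, ε < v i} = ⋂ i ∈ (Tᶜ : Finset ι), {v : ι → ℝ | ε < v i} := by
      ext v; simp
    rw [this]
    exact isOpen_biInter_finset fun i _ => isOpen_lt continuous_const (continuous_apply i)
  have hOc : Convex ℝ {v : ι → ℝ | ∀ i ∉ T, ε < v i} := by
    intro v hv w hw a b ha hb hab i hi
    have h1 := hv i hi
    have h2 := hw i hi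
    simp only [Pi.add_apply, Pi.smul_apply, smul_eq_mul]
    rcases ha.eq_or_lt with rfl | ha'
    · have : b = 1 := by linarith
      subst this; linarith
    · have : ε = a * ε + b * ε := by rw [← add_mul, hab, one_mul]
      nlinarith
  have hSc : Convex ℝ ((LinearMap.pi f) '' S) := hS.linear_image _
  have hd : Disjoint {v : ι → ℝ | ∀ i ∉ T, ε < v i} ((LinearMap.pi f) '' S) := by
    rw [Set.disjoint_left]
    rintro _ hv ⟨ρ, hρ, rfl⟩
    exact h ⟨ρ, hρ, hv⟩
  obtain ⟨φ, u, h1, h2⟩ := geometric_hahn_banach_open hOc hO hSc hd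
  have hφ : ∀ v : ι → ℝ, φ v = ∑ i, φ (Pi.single i 1) * v i := by
    intro v
    conv_lhs => rw [pi_eq_sum_univ' v]
    rw [map_sum]
    refine Finset.sum_congr rfl fun i _ => ?_
    rw [map_smul, smul_eq_mul, mul_comm]
  set c : ι → ℝ := fun i => φ (Pi.single i 1) with hc
  -- moving inside the open orthant
  have hmove : ∀ i (t : ℝ), (i ∈ T ∨ 0 ≤ t) →
      (ε + 1) * ∑ j, c j + t * c i < u := by
    intro i t ht
    have := h1 ((fun _ => ε + 1) + t • Pi.single i 1) (by
      intro j hj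
      simp only [Pi.add_apply, Pi.smul_apply, smul_eq_mul, Pi.single_apply]
      split_ifs with hji
      · subst hji
        rcases ht with ht | ht
        · exact absurd ht hj
        · linarith
      · linarith)
    rw [map_add, map_smul, hφ (fun _ => ε + 1), smul_eq_mul] at this
    rw [← Finset.sum_mul] at this
    linarith [mul_comm (∑ j, c j) (ε + 1)]
  have hcn : ∀ i, c i ≤ 0 := by
    intro i
    by_contra! hci
    set X := u - (ε + 1) * ∑ j, c j
    have := hmove i (|X| / c i) (Or.inr (by positivity))
    rw [div_mul_cancel₀ _ hci.ne'] at this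
    linarith [le_abs_self X]
  have hcT : ∀ i ∈ T, c i = 0 := by
    intro i hi
    by_contra hci
    set X := u - (ε + 1) * ∑ j, c j
    have := hmove i (X / c i) (Or.inl hi)
    rw [div_mul_cancel₀ _ hci] at this
    linarith
  -- The functional is not zero: separation is strict on the open side, and S is nonempty.
  have hpos : 0 < ∑ i, -c i := by
    have hnn : ∀ i ∈ Finset.univ, 0 ≤ -c i := fun i _ => by linarith [hcn i]
    rcases (Finset.sum_nonneg hnn).eq_or_lt with h0 | h0
    · exfalso
      have hz := (Finset.sum_eq_zero_iff_of_nonneg hnn).1 h0.symm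
      have hz' : ∀ i, c i = 0 := fun i => by linarith [hz i (Finset.mem_univ i)]
      obtain ⟨ρ, hρ⟩ := hne
      have a1 := h1 (fun _ => ε + 1) (fun i _ => by simp)
      have a2 := h2 _ ⟨ρ, hρ, rfl⟩
      rw [hφ] at a1 a2
      have : ∀ i, φ (Pi.single i 1) = 0 := hz'
      simp only [this, zero_mul, Finset.sum_const_zero] at a1 a2
      linarith
    · exact h0
  refine ⟨fun i => -c i / ∑ j, -c j, fun i => div_nonneg (by linarith [hcn i]) hpos.le,
    fun i hi => by simp [hcT i hi], by rw [← Finset.sum_div, div_self hpos.ne'], ?_⟩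
  intro ρ hρ
  have a2 := h2 _ ⟨ρ, hρ, rfl⟩
  rw [hφ] at a2
  simp only [LinearMap.pi_apply] at a2
  -- The constant vector ε is only in the closure of the open set, so it is approached from above.
  have key : ∑ i, -c i * f i ρ ≤ ε * ∑ j, -c j := by
    refine le_of_forall_pos_le_add fun η hη => ?_
    have a1 := h1 (fun _ => ε + η / ∑ j, -c j) (fun i _ => by have := div_pos hη hpos; linarith)
    rw [hφ, ← Finset.sum_mul] at a1
    have e : (∑ i, c i) * (ε + η / ∑ j, -c j) = -(ε * ∑ j, -c j + η) := by
      have : ∑ i, c i = -∑ j, -c j := by simp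
      rw [this]
      field_simp
    have e' : ∑ i, -c i * f i ρ = -∑ i, c i * f i ρ := by simp
    rw [e']
    change (∑ i, c i) * (ε + η / ∑ j, -c j) < u at a1
    change u ≤ ∑ i, c i * f i ρ at a2
    rw [e] at a1
    linarith
  calc ∑ i, -c i / (∑ j, -c j) * f i ρ = (∑ i, -c i * f i ρ) / ∑ j, -c j := by
        rw [Finset.sum_div]; exact Finset.sum_congr rfl fun i _ => by ring
    _ ≤ ε := by rw [div_le_iff₀ hpos]; exact key

end
noncomputable section

/-! ### States and measurements from contractions -/

/-- The coordinate embedding along `e`. -/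
def embedMat {J I : Type*} [DecidableEq I] (e : J ↪ I) : Matrix I J ℝ :=
  Matrix.of fun r c => if r = e c then 1 else 0

theorem embedMat_transpose_mul {J I : Type*} [Fintype I] [DecidableEq I] [DecidableEq J]
    (e : J ↪ I) : (embedMat e).transpose * embedMat e = 1 := by
  ext i j
  simp [embedMat, Matrix.mul_apply, Matrix.one_apply, e.injective.eq_iff, eq_comm]

/-- The symmetric dilation of a square matrix, embedded in a larger space along `e`. -/
def dilation {m : ℕ} {I : Type*} [DecidableEq I] (e : Fin m ⊕ Fin m ↪ I)
    (B : Matrix (Fin m) (Fin m) ℝ) : Matrix I I ℝ :=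
  embedMat e * Matrix.fromBlocks 0 B B.transpose 0 * (embedMat e).transpose

theorem dilation_trace {m : ℕ} {I : Type*} [Fintype I] [DecidableEq I] (e : Fin m ⊕ Fin m ↪ I)
    (B : Matrix (Fin m) (Fin m) ℝ) : (dilation e B).trace = 0 := by
  rw [dilation, Matrix.trace_mul_comm, ← Matrix.mul_assoc, embedMat_transpose_mul, Matrix.one_mul]
  simp [Matrix.trace]

theorem dilation_add {m : ℕ} {I : Type*} [DecidableEq I] (e : Fin m ⊕ Fin m ↪ I)
    (B B' : Matrix (Fin m) (Fin m) ℝ) : dilation e (B + B') = dilation e B + dilation e B' := by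
  have : Matrix.fromBlocks (0 : Matrix (Fin m) (Fin m) ℝ) (B + B') (B + B').transpose 0 =
      Matrix.fromBlocks 0 B B.transpose 0 + Matrix.fromBlocks 0 B' B'.transpose 0 := by
    rw [Matrix.fromBlocks_add]; simp
  rw [dilation, this, Matrix.mul_add, Matrix.add_mul]; rfl

theorem dilation_smul {m : ℕ} {I : Type*} [DecidableEq I] (e : Fin m ⊕ Fin m ↪ I)
    (t : ℝ) (B : Matrix (Fin m) (Fin m) ℝ) : dilation e (t • B) = t • dilation e B := by
  have : Matrix.fromBlocks (0 : Matrix (Fin m) (Fin m) ℝ) (t • B) (t • B).transpose 0 =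
      t • Matrix.fromBlocks 0 B B.transpose 0 := by
    rw [Matrix.fromBlocks_smul]; simp
  rw [dilation, this, Matrix.mul_smul, Matrix.smul_mul, dilation]

theorem dilation_isSymm {m : ℕ} {I : Type*} [DecidableEq I] (e : Fin m ⊕ Fin m ↪ I)
    (B : Matrix (Fin m) (Fin m) ℝ) : (dilation e B).transpose = dilation e B := by
  simp [dilation, Matrix.transpose_mul, Matrix.fromBlocks_transpose, Matrix.mul_assoc]

/-- The quadratic form at (u, v) is |u + Bv|² + (|v|² - |Bv|²). -/
theorem fromBlocks_posSemidef_of_contraction {m : ℕ} (B : Matrix (Fin m) (Fin m) ℝ)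
    (hB : ‖B‖ ≤ 1) : (Matrix.fromBlocks 1 B B.transpose 1).PosSemidef := by
  refine Matrix.PosSemidef.of_dotProduct_mulVec_nonneg ?_ ?_
  · simp [Matrix.IsHermitian, Matrix.conjTranspose_eq_transpose_of_trivial,
      Matrix.fromBlocks_transpose]
  · intro w
    obtain ⟨u, v, rfl⟩ : ∃ u v, w = Sum.elim u v :=
      ⟨w ∘ Sum.inl, w ∘ Sum.inr, by ext (i | i) <;> rfl⟩
    have h1 := mulVec_dotProduct_self_le B v
    have h2 : 0 ≤ (u + B.mulVec v) ⬝ᵥ (u + B.mulVec v) := by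
      simp only [dotProduct]; exact Finset.sum_nonneg fun i _ => mul_self_nonneg _
    have h3 : 0 ≤ v ⬝ᵥ v := by
      simp only [dotProduct]; exact Finset.sum_nonneg fun i _ => mul_self_nonneg _
    have h4 : v ⬝ᵥ B.transpose.mulVec u = u ⬝ᵥ B.mulVec v := by
      rw [Matrix.mulVec_transpose, dotProduct_comm, Matrix.dotProduct_mulVec]
    have h5 : ‖B‖ ^ 2 * (v ⬝ᵥ v) ≤ v ⬝ᵥ v := by
      have : ‖B‖ ^ 2 ≤ 1 := pow_le_one₀ (norm_nonneg _) hB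
      nlinarith
    rw [Matrix.fromBlocks_mulVec, Sum.elim_comp_inl, Sum.elim_comp_inr]
    simp only [star_trivial, sumElim_dotProduct_sumElim,
      Matrix.one_mulVec, dotProduct_add, add_dotProduct] at h2 ⊢
    rw [h4]
    rw [dotProduct_comm (B.mulVec v) u] at h2
    linarith

/-- Write V for the embedding, so that VᵀV = 1. The matrix is the sum of the projection 1 - VVᵀ and
a conjugate by V of the block matrix of `fromBlocks_posSemidef_of_contraction`. Halved, these are
Bob's measurement operators. -/
theorem one_add_dilation_posSemidef {m : ℕ} {I : Type*} [Fintype I] [DecidableEq I]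
    (e : Fin m ⊕ Fin m ↪ I) (B : Matrix (Fin m) (Fin m) ℝ) (hB : ‖B‖ ≤ 1) :
    (1 + dilation e B).PosSemidef := by
  set V := embedMat e with hV
  have hVV : V.transpose * V = 1 := embedMat_transpose_mul e
  have h1 : (V * Matrix.fromBlocks 1 B B.transpose 1 * V.conjTranspose).PosSemidef :=
    (fromBlocks_posSemidef_of_contraction B hB).mul_mul_conjTranspose_same V
  have h2 : ((1 - V * V.transpose).conjTranspose * (1 - V * V.transpose)).PosSemidef :=
    Matrix.posSemidef_conjTranspose_mul_self _
  have h3 : (1 - V * V.transpose).conjTranspose * (1 - V * V.transpose) = 1 - V * V.transpose := by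
    rw [Matrix.conjTranspose_eq_transpose_of_trivial]
    simp only [Matrix.transpose_sub, Matrix.transpose_one, Matrix.transpose_mul,
      Matrix.transpose_transpose, Matrix.sub_mul, Matrix.mul_sub, Matrix.one_mul, Matrix.mul_one]
    rw [show V * V.transpose * (V * V.transpose) = V * (V.transpose * V) * V.transpose by
      simp only [Matrix.mul_assoc], hVV]
    simp
  have h4 : Matrix.fromBlocks 1 B B.transpose 1 = 1 + Matrix.fromBlocks 0 B B.transpose 0 := by
    rw [← Matrix.fromBlocks_one, Matrix.fromBlocks_add]; simp
  rw [h3] at h2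
  rw [h4, Matrix.conjTranspose_eq_transpose_of_trivial, Matrix.mul_add, Matrix.add_mul] at h1
  have := h2.add h1
  simp only [Matrix.mul_one] at this
  rw [← add_assoc, sub_add_cancel] at this
  exact this

/-- Real density matrices. -/
def densityMatrices (I : Type*) [Fintype I] : Set (Matrix I I ℝ) :=
  {ρ | ρ.PosSemidef ∧ ρ.trace = 1}

theorem convex_densityMatrices (I : Type*) [Fintype I] : Convex ℝ (densityMatrices I) := by
  intro x hx y hy a b ha hb hab
  refine ⟨(hx.1.smul ha).add (hy.1.smul hb), ?_⟩
  rw [Matrix.trace_add, Matrix.trace_smul, Matrix.trace_smul, hx.2, hy.2]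
  simpa using hab

theorem maximallyMixed_mem (q : ℕ) :
    ((1 / 2 ^ q : ℝ) • (1 : Matrix (Fin (2 ^ q)) (Fin (2 ^ q)) ℝ)) ∈
      densityMatrices (Fin (2 ^ q)) := by
  refine ⟨Matrix.PosSemidef.one.smul (by positivity), ?_⟩
  rw [Matrix.trace_smul, Matrix.trace_one]
  simp

/-- The dual description of the norm: it is controlled by the expectations of the dilation. Only
pure states supported on the embedded subspace are needed. -/
theorem norm_le_of_forall_density {m : ℕ} {I : Type*} [Fintype I] [DecidableEq I]
    (e : Fin m ⊕ Fin m ↪ I) (B : Matrix (Fin m) (Fin m) ℝ) {ε : ℝ} (hε : 0 < ε)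
    (h : ∀ ρ ∈ densityMatrices I, (ρ * dilation e B).trace ≤ ε) : ‖B‖ ≤ ε := by
  refine l2_opNorm_le_of_dotProduct B hε.le fun v => ?_
  have key : ∀ w : Fin m ⊕ Fin m → ℝ,
      w ⬝ᵥ (Matrix.fromBlocks 0 B B.transpose 0).mulVec w ≤ ε * (w ⬝ᵥ w) := by
    intro w
    have hw0 : 0 ≤ w ⬝ᵥ w := by
      simp only [dotProduct]; exact Finset.sum_nonneg fun i _ => mul_self_nonneg _
    rcases hw0.eq_or_lt with h0 | hw
    · have : w = 0 := dotProduct_self_eq_zero.1 h0.symm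
      simp [this]
    set V := embedMat e with hV
    have hVV : V.transpose * V = 1 := embedMat_transpose_mul e
    have hp : ((w ⬝ᵥ w)⁻¹ • (V * Matrix.vecMulVec w w * V.transpose)) ∈ densityMatrices I := by
      constructor
      · refine Matrix.PosSemidef.smul ?_ (by positivity)
        rw [← Matrix.conjTranspose_eq_transpose_of_trivial]
        refine Matrix.PosSemidef.mul_mul_conjTranspose_same ?_ V
        simpa using Matrix.posSemidef_vecMulVec_self_star w
      · rw [Matrix.trace_smul, Matrix.trace_mul_comm, ← Matrix.mul_assoc, hVV, Matrix.one_mul,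
          Matrix.trace_vecMulVec, smul_eq_mul, inv_mul_cancel₀ hw.ne']
    have := h _ hp
    rw [dilation, Matrix.smul_mul, Matrix.trace_smul, ← hV, smul_eq_mul,
      show V * Matrix.vecMulVec w w * V.transpose *
        (V * Matrix.fromBlocks 0 B B.transpose 0 * V.transpose) =
        V * (Matrix.vecMulVec w w * ((V.transpose * V) * Matrix.fromBlocks 0 B B.transpose 0)) *
          V.transpose by simp only [Matrix.mul_assoc],
      hVV, Matrix.one_mul, Matrix.trace_mul_comm, ← Matrix.mul_assoc, hVV, Matrix.one_mul,
      Matrix.vecMulVec_mul, Matrix.trace_vecMulVec, inv_mul_le_iff₀ hw] at this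
    rw [Matrix.dotProduct_mulVec, dotProduct_comm]
    linarith
  -- The weight ε⁻¹ balances the two halves: the form equals 2ε⁻¹|Bv|², the bound is ε⁻¹|Bv|² +
  -- ε|v|², and what remains is |Bv|² ≤ ε²|v|².
  have h1 := key (Sum.elim (ε⁻¹ • B.mulVec v) v)
  have h4 : v ⬝ᵥ B.transpose.mulVec (B.mulVec v) = B.mulVec v ⬝ᵥ B.mulVec v := by
    rw [Matrix.mulVec_transpose, dotProduct_comm, Matrix.dotProduct_mulVec]
  rw [Matrix.fromBlocks_mulVec] at h1
  simp only [sumElim_dotProduct_sumElim, Sum.elim_comp_inl, Sum.elim_comp_inr,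
    Matrix.zero_mulVec, zero_add, add_zero, Matrix.mulVec_smul, smul_dotProduct, dotProduct_smul,
    smul_eq_mul, smul_zero, h4] at h1
  set β := B.mulVec v ⬝ᵥ B.mulVec v
  set ν := v ⬝ᵥ v
  have : ε * (ε⁻¹ * (ε⁻¹ * β) + ν) = ε⁻¹ * β + ε * ν := by field_simp
  rw [this] at h1
  have h2 : ε⁻¹ * β ≤ ε * ν := by linarith
  rw [inv_mul_le_iff₀ hε] at h2
  linarith [h2, sq ε, mul_assoc ε ε ν]

/-- A decomposition into real rank-one terms is also one over ℂ. All constructions are real, only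
the protocol is complex. -/
theorem posSemidef_map_ofReal {I : Type*} [Fintype I] {M : Matrix I I ℝ} (hM : M.PosSemidef) :
    (M.map Complex.ofReal).PosSemidef := by
  obtain ⟨k, v, rfl⟩ := Matrix.posSemidef_iff_eq_sum_vecMulVec.1 hM
  refine Matrix.posSemidef_iff_eq_sum_vecMulVec.2 ⟨k, fun i j => v i j, ?_⟩
  ext i j
  simp [Matrix.sum_apply, Matrix.vecMulVec_apply]

/-- The protocol in which Alice sends the real state `ρ x` and Bob measures the observables given
by dilations of contractions. -/
def contractionProtocol {n m q : ℕ} (e : Fin m ⊕ Fin m ↪ Fin (2 ^ q))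
    (A : Fin n → Matrix (Fin m) (Fin m) ℝ) (hA : ∀ i, ‖A i‖ ≤ 1)
    (ρ : (Fin n → ℤˣ) → Matrix (Fin (2 ^ q)) (Fin (2 ^ q)) ℝ)
    (hρ : ∀ x, ρ x ∈ densityMatrices (Fin (2 ^ q))) : IndexProtocol q n where
  msg x := (ρ x).map Complex.ofReal
  msg_posSemidef x := posSemidef_map_ofReal (hρ x).1
  msg_trace x := by
    have := congrArg Complex.ofReal (hρ x).2
    simpa [Matrix.trace] using this
  meas i b := ((1 / 2 : ℝ) • (1 + dilation e ((((b : ℤˣ) : ℤ) : ℝ) • A i))).map Complex.ofReal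
  meas_posSemidef i b := by
    refine posSemidef_map_ofReal ((one_add_dilation_posSemidef e _ ?_).smul (by norm_num))
    rw [norm_smul]
    rcases Int.units_eq_one_or b with rfl | rfl <;> simpa using hA i
  meas_sum i := by
    have : (Finset.univ : Finset ℤˣ) = {1, -1} := rfl
    rw [this, Finset.sum_pair (by decide)]
    have hneg : dilation e (-A i) = -dilation e (A i) := by
      simpa using dilation_smul e (-1) (A i)
    ext r s
    simp only [hneg, Units.val_one, Int.cast_one, one_smul, Units.val_neg, Int.cast_neg,
      neg_smul, Matrix.add_apply, Matrix.map_apply, Matrix.smul_apply, smul_eq_mul,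
      Matrix.neg_apply, Matrix.one_apply]
    split_ifs <;> push_cast <;> ring

theorem contractionProtocol_successProb {n m q : ℕ} (e : Fin m ⊕ Fin m ↪ Fin (2 ^ q))
    (A : Fin n → Matrix (Fin m) (Fin m) ℝ) (hA : ∀ i, ‖A i‖ ≤ 1)
    (ρ : (Fin n → ℤˣ) → Matrix (Fin (2 ^ q)) (Fin (2 ^ q)) ℝ)
    (hρ : ∀ x, ρ x ∈ densityMatrices (Fin (2 ^ q))) (x : Fin n → ℤˣ) (i : Fin n) :
    (contractionProtocol e A hA ρ hρ).successProb x i =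
      1 / 2 + (((x i : ℤˣ) : ℤ) : ℝ) * (ρ x * dilation e (A i)).trace / 2 := by
  have h1 : (contractionProtocol e A hA ρ hρ).successProb x i =
      (ρ x * ((1 / 2 : ℝ) • (1 + dilation e ((((x i : ℤˣ) : ℤ) : ℝ) • A i)))).trace := by
    have : (ρ x).map Complex.ofReal *
      ((1 / 2 : ℝ) • (1 + dilation e ((((x i : ℤˣ) : ℤ) : ℝ) • A i))).map Complex.ofReal =
      (ρ x * ((1 / 2 : ℝ) • (1 + dilation e ((((x i : ℤˣ) : ℤ) : ℝ) • A i)))).map Complex.ofReal :=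
      (Matrix.map_mul (f := Complex.ofRealHom)).symm
    simp only [IndexProtocol.successProb, contractionProtocol]
    rw [this]
    simp [Matrix.trace]
  rw [h1, dilation_smul, Matrix.mul_smul, Matrix.mul_add, Matrix.trace_smul, Matrix.trace_add,
    mul_one, (hρ x).2, Matrix.mul_smul, Matrix.trace_smul]
  simp only [smul_eq_mul]
  ring

end
noncomputable section

/-! ### Random signs without a balanced direction are rare -/

/-- `log (m / n)`, read as at least `1`. -/
def logFactor (n m : ℕ) : ℝ := max 1 (Real.log ((m : ℝ) / n))

theorem one_le_logFactor (n m : ℕ) : 1 ≤ logFactor n m := le_max_left _ _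

theorem spencerBound_eq (n m : ℕ) : spencerBound n m = √(n * logFactor n m) := rfl

/-- For the signs `g` there is a set `T` of at most `t` indices such that every convex combination
of the signed matrices outside of `T` has norm at least `ε`. -/
def IsStuck {ι : Type*} [Fintype ι] {m : ℕ} (A : ι → Matrix (Fin m) (Fin m) ℝ) (g : ι → ℤˣ)
    (t ε : ℝ) : Prop :=
  ∃ T : Finset ι, (T.card : ℝ) ≤ t ∧ ∀ p : ι → ℝ, (∀ i, 0 ≤ p i) → (∀ i ∈ T, p i = 0) →
    ∑ i, p i = 1 → ε ≤ ‖∑ i, (p i * (((g i : ℤˣ) : ℤ) : ℝ)) • A i‖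

/-- Without such a state, separation would give weights off T whose signed combination has
expectation at most ε / 2 in every state, hence norm at most ε / 2, against stuckness. The lost
factor 2 only affects constants. -/
theorem IsStuck.exists_density {n m : ℕ} {I : Type*} [Fintype I] [DecidableEq I]
    (hne : (densityMatrices I).Nonempty)
    (e : Fin m ⊕ Fin m ↪ I) {A : Fin n → Matrix (Fin m) (Fin m) ℝ} {g : Fin n → ℤˣ} {t ε : ℝ}
    (hε : 0 < ε) (h : IsStuck A g t ε) :
    ∃ T : Finset (Fin n), (T.card : ℝ) ≤ t ∧ ∃ ρ ∈ densityMatrices I, ∀ i ∉ T,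
      ε / 2 < (((g i : ℤˣ) : ℤ) : ℝ) * (ρ * dilation e (A i)).trace := by
  obtain ⟨T, hT, hp⟩ := h
  refine ⟨T, hT, ?_⟩
  by_contra hcon
  obtain ⟨p, p0, pT, p1, hps⟩ := exists_weights_of_forall_exists_lt (convex_densityMatrices I) hne
    (fun i => (((g i : ℤˣ) : ℤ) : ℝ) •
      ((Matrix.traceLinearMap I ℝ ℝ).comp (LinearMap.mulRight ℝ (dilation e (A i))))) T (ε / 2)
    (by simpa using hcon)
  have h1 := hp p p0 pT p1
  have h2 : ‖∑ i, (p i * (((g i : ℤˣ) : ℤ) : ℝ)) • A i‖ ≤ ε / 2 := by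
    refine norm_le_of_forall_density e _ (by linarith) fun ρ hρ => ?_
    have hsum : ∀ s : Finset (Fin n), dilation e (∑ i ∈ s, (p i * (((g i : ℤˣ) : ℤ) : ℝ)) • A i) =
        ∑ i ∈ s, (p i * (((g i : ℤˣ) : ℤ) : ℝ)) • dilation e (A i) := by
      intro s
      induction s using Finset.induction_on with
      | empty => have := dilation_smul e 0 (0 : Matrix (Fin m) (Fin m) ℝ); simpa using this
      | insert i s hi ih => rw [Finset.sum_insert hi, dilation_add, ih, dilation_smul,
          Finset.sum_insert hi]
    refine le_trans (le_of_eq ?_) (hps ρ hρ)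
    rw [hsum, Matrix.mul_sum, Matrix.trace_sum]
    refine Finset.sum_congr rfl fun i _ => ?_
    rw [Matrix.mul_smul, Matrix.trace_smul]
    simp [mul_assoc]
  linarith

/-- On stuck inputs Alice sends the state of `IsStuck.exists_density`; on all others she sends the
maximally mixed state, for which the traceless observables give success probability exactly 1/2. The
advantage is ε / 4 on at least half of the inputs, so ε / 8 on average. -/
theorem avgMinSuccess_ge {n m q : ℕ} (e : Fin m ⊕ Fin m ↪ Fin (2 ^ q))
    (A : Fin n → Matrix (Fin m) (Fin m) ℝ) (hA : ∀ i, ‖A i‖ ≤ 1) {t ε : ℝ} (hε : 0 < ε)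
    (ht0 : 0 ≤ t) (ht : t < n)
    (hmany : (2 : ℝ) ^ n ≤ 2 * ({g | IsStuck A g t ε} : Set (Fin n → ℤˣ)).ncard) :
    ∃ (P : IndexProtocol q n) (S : (Fin n → ℤˣ) → Finset (Fin n)),
      (∀ x, (n : ℝ) - t ≤ (S x).card) ∧ 1 / 2 + ε / 8 ≤ P.avgMinSuccess S := by
  classical
  have hchoice : ∀ g : Fin n → ℤˣ, ∃ (T : Finset (Fin n)) (ρ : Matrix (Fin (2 ^ q)) (Fin (2 ^ q)) ℝ),
      (T.card : ℝ) ≤ t ∧ ρ ∈ densityMatrices (Fin (2 ^ q)) ∧ ∀ i ∉ T,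
        (if IsStuck A g t ε then ε / 2 else 0) ≤
          (((g i : ℤˣ) : ℤ) : ℝ) * (ρ * dilation e (A i)).trace := by
    intro g
    by_cases hg : IsStuck A g t ε
    · obtain ⟨T, hT, ρ, hρ, h⟩ := hg.exists_density ⟨_, maximallyMixed_mem q⟩ e hε
      exact ⟨T, ρ, hT, hρ, fun i hi => by rw [if_pos hg]; exact (h i hi).le⟩
    · refine ⟨∅, _, by simpa using ht0, maximallyMixed_mem q, fun i _ => ?_⟩
      rw [if_neg hg, Matrix.smul_mul, Matrix.one_mul, Matrix.trace_smul, dilation_trace]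
      simp
  choose T ρ hT hρ hval using hchoice
  refine ⟨contractionProtocol e A hA ρ hρ, fun x => (T x)ᶜ, fun x => ?_, ?_⟩
  · rw [Finset.card_compl, Fintype.card_fin, Nat.cast_sub (by simpa using (T x).card_le_univ)]
    linarith [hT x]
  · rw [IndexProtocol.avgMinSuccess, le_div_iff₀ (by positivity)]
    have hlow : ∀ x : Fin n → ℤˣ, 1 / 2 + (if IsStuck A x t ε then ε / 4 else 0) ≤
        ⨅ i : ↥((T x)ᶜ), (contractionProtocol e A hA ρ hρ).successProb x i := by
      intro x
      -- The infimum of an empty family of reals is 0, which would ruin the bound; `t < n` excludes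
      -- this case.
      have hne : Nonempty ↥((T x)ᶜ) := by
        rw [Finset.nonempty_coe_sort, ← Finset.card_pos, Finset.card_compl, Fintype.card_fin]
        have : ((T x).card : ℝ) < n := (hT x).trans_lt ht
        have : (T x).card < n := by exact_mod_cast this
        omega
      refine le_ciInf fun i => ?_
      rw [contractionProtocol_successProb]
      have := hval x i (Finset.mem_compl.1 i.2)
      split_ifs at this ⊢ <;> linarith
    refine le_trans ?_ (Finset.sum_le_sum fun x _ => hlow x)
    rw [Finset.sum_add_distrib, ← Finset.sum_filter, Finset.sum_const, Finset.sum_const,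
      Finset.card_univ, Fintype.card_fun, Fintype.card_fin, Fintype.card_units_int]
    have : ({g | IsStuck A g t ε} : Set (Fin n → ℤˣ)).ncard =
        (Finset.univ.filter fun g : Fin n → ℤˣ => IsStuck A g t ε).card := by
      rw [← Set.ncard_coe_finset]; congr; ext; simp
    rw [this] at hmany
    simp only [nsmul_eq_mul]
    push_cast
    nlinarith

theorem two_pow_clog_le {m : ℕ} (hm : 0 < m) : 2 ^ Nat.clog 2 m ≤ 2 * m := by
  rcases Nat.lt_or_ge 1 m with h1 | h1
  · have := Nat.pow_pred_clog_lt_self (b := 2) (by norm_num) h1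
    have hp : 0 < Nat.clog 2 m := Nat.clog_pos (by norm_num) h1
    have : 2 ^ Nat.clog 2 m = 2 * 2 ^ (Nat.clog 2 m).pred := by
      rw [← pow_succ']
      congr 1
      have := Nat.succ_pred_eq_of_pos hp
      omega
    omega
  · have : m = 1 := by omega
    subst this; simp

/-- The consequence of the conjecture for random signs. -/
theorem QuantumOneWayConjecture.isStuck_rare (hconj : QuantumOneWayConjecture) :
    ∃ δ : ℝ, 0 < δ ∧ δ < 1 ∧ ∃ κ : ℝ, 0 < κ ∧
      ∀ (n m : ℕ) (A : Fin n → Matrix (Fin m) (Fin m) ℝ), 0 < n → (∀ i, ‖A i‖ ≤ 1) →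
        2 * ({g | IsStuck A g (δ * n) (κ * √(logFactor n m / n))} : Set (Fin n → ℤˣ)).ncard
          ≤ 2 ^ n := by
  obtain ⟨δ₀, hδ₀, h⟩ := hconj
  set δ := min (δ₀ / 2) (1 / 2) with hδ
  have hδpos : 0 < δ := by positivity
  have hδlt : δ < δ₀ := (min_le_left _ _).trans_lt (by linarith)
  have hδ1 : δ < 1 := (min_le_right _ _).trans_lt (by norm_num)
  obtain ⟨K, hK, c, hc, h⟩ := h δ hδpos hδlt
  -- K meets the lower bound on ε required by the conjecture. With 13 / c the term c κ² L log 2 is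
  -- at least 6.5 κ L, while the other terms at the end amount to at most 6 κ L.
  set κ := max K (max 1 (13 / c)) with hκ
  have hκ1 : 1 ≤ κ := (le_max_left _ _).trans (le_max_right _ _)
  have hκK : K ≤ κ := le_max_left _ _
  have hκc : 13 ≤ c * κ := by
    have : 13 / c ≤ κ := (le_max_right _ _).trans (le_max_right _ _)
    rw [div_le_iff₀ hc] at this
    linarith
  refine ⟨δ, hδpos, hδ1, 8 * κ, by positivity, ?_⟩
  intro n m A hn hA
  by_contra! hcon
  set L := logFactor n m with hL
  have hL1 : 1 ≤ L := one_le_logFactor n m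
  have hnR : (0 : ℝ) < n := by exact_mod_cast hn
  have hn1 : (1 : ℝ) ≤ n := by exact_mod_cast hn
  -- The extra qubit makes room for the dilation, which doubles the dimension.
  set q := Nat.clog 2 m + 1 with hq
  have hm2 : m ≤ 2 ^ Nat.clog 2 m := Nat.le_pow_clog (by norm_num) m
  have hcard : Fintype.card (Fin m ⊕ Fin m) ≤ Fintype.card (Fin (2 ^ q)) := by
    simp only [Fintype.card_sum, Fintype.card_fin, hq, pow_succ]; omega
  obtain ⟨e⟩ := Function.Embedding.nonempty_of_card_le hcard
  set ε₀ := 8 * κ * √(L / n) with hε₀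
  have hε₀pos : 0 < ε₀ := by positivity
  obtain ⟨P, S, hS, hP⟩ := avgMinSuccess_ge e A hA (t := δ * n) hε₀pos (by positivity)
    (by nlinarith) (by exact_mod_cast hcon.le)
  have h1 := h n q P S (ε₀ / 8) hn (fun x => by have := hS x; linarith) hP (by
    have : ε₀ / 8 = κ * √L / √n := by
      rw [hε₀, Real.sqrt_div (by linarith)]; ring
    rw [this]
    refine div_le_div_of_nonneg_right ?_ (Real.sqrt_nonneg _)
    have : 1 ≤ √L := Real.one_le_sqrt.2 hL1
    nlinarith)
  have hε2 : (ε₀ / 8) ^ 2 = κ ^ 2 * L / n := by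
    have : ε₀ / 8 = κ * √(L / n) := by rw [hε₀]; ring
    rw [this, mul_pow, Real.sq_sqrt (by positivity)]; ring
  rw [hε2] at h1
  have e1 : c * (κ ^ 2 * L / n) * n = c * κ ^ 2 * L := by field_simp
  have e2 : (1 : ℝ) / (κ ^ 2 * L / n) = n / (κ ^ 2 * L) := by field_simp
  rw [e1, e2] at h1
  have hlog2 : 1 / 2 < Real.log 2 := by linarith [Real.log_two_gt_d9]
  have hlog2' : Real.log 2 < 1 := by linarith [Real.log_two_lt_d9]
  rw [Real.logb, Real.log_div (by positivity) (by positivity),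
    Real.log_mul (by positivity) (by positivity), Real.log_pow] at h1
  have h2 : Real.log n - (2 * Real.log κ + Real.log L) + c * κ ^ 2 * L * Real.log 2 ≤
      q * Real.log 2 := by
    have := mul_le_mul_of_nonneg_right h1 (by linarith : 0 ≤ Real.log 2)
    rw [add_mul, div_mul_cancel₀ _ (by linarith)] at this
    exact_mod_cast this
  -- Since log(m / n) ≤ L, log m is at most L + log n, and log n cancels against the log n
  -- contributed by log(1/ε²).
  have h3 : q * Real.log 2 ≤ 2 * Real.log 2 + (L + Real.log n) := by
    rcases Nat.eq_zero_or_pos m with rfl | hm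
    · simp only [hq, Nat.clog_zero_right]
      have := Real.log_nonneg hn1
      push_cast
      linarith
    · have hlt := two_pow_clog_le hm
      have hmR : (0 : ℝ) < m := by exact_mod_cast hm
      have a1 : Real.log ((2 : ℝ) ^ q) ≤ Real.log (4 * m) := by
        refine Real.log_le_log (by positivity) ?_
        rw [hq, pow_succ]
        have : ((2 : ℝ) ^ Nat.clog 2 m) ≤ 2 * m := by exact_mod_cast hlt
        linarith
      rw [Real.log_pow, Real.log_mul (by norm_num) hmR.ne',
        show (4 : ℝ) = 2 ^ 2 by norm_num, Real.log_pow] at a1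
      have a2 : Real.log ((m : ℝ) / n) ≤ L := le_max_right _ _
      rw [Real.log_div hmR.ne' hnR.ne'] at a2
      push_cast at a1 ⊢
      linarith
  have h4 : Real.log κ ≤ κ := (Real.log_le_sub_one_of_pos (by linarith)).trans (by linarith)
  have h5 : Real.log L ≤ L := (Real.log_le_sub_one_of_pos (by linarith)).trans (by linarith)
  have h6 : 13 * κ * L ≤ c * κ ^ 2 * L := by
    have : 13 * κ ≤ c * κ * κ := by nlinarith
    nlinarith
  have h7 : c * κ ^ 2 * L / 2 ≤ c * κ ^ 2 * L * Real.log 2 := by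
    have : 0 ≤ c * κ ^ 2 * L := by positivity
    nlinarith
  have h8 : κ ≤ κ * L := le_mul_of_one_le_right (by linarith) hL1
  have h9 : L ≤ κ * L := le_mul_of_one_le_left (by linarith) hκ1
  rw [mul_assoc] at h6
  linarith

end
noncomputable section

/-! ### Optimal solutions of the semidefinite program -/

theorem sq_int_unit (u : ℤˣ) : ((u : ℤ) : ℝ) * ((u : ℤ) : ℝ) = 1 := by
  rcases Int.units_eq_one_or u with rfl | rfl <;> simp

theorem abs_int_unit (u : ℤˣ) : |((u : ℤ) : ℝ)| = 1 := by
  rcases Int.units_eq_one_or u with rfl | rfl <;> simp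

/-- With few tight coordinates, non-stuckness provides weights p off the tight set with small signed
combination. The point 2n·(p_i g_i) meets the norm constraint because 2κ ≤ C, and its objective 2n
exceeds the value at x, which is at most n. It may leave the cube, but a short step towards it does
not: tight coordinates have weight 0 and shrink, the others have slack. -/
theorem IsSDPOptimum.card_tight {n m : ℕ} {A : Fin n → Matrix (Fin m) (Fin m) ℝ} {g : Fin n → ℤˣ}
    {x : Fin n → ℝ} {t κ C : ℝ} (hn : 0 < n) (hC : 2 * κ ≤ C)
    (hg : ¬ IsStuck A g t (κ * √(logFactor n m / n)))
    (hx : IsSDPOptimum A (C * spencerBound n m) g x) :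
    t < (({i | |x i| = 1} : Set (Fin n)).ncard : ℝ) := by
  classical
  by_contra! hlt
  obtain ⟨⟨hx1, hxM⟩, hmax⟩ := hx
  apply hg
  refine ⟨Finset.univ.filter fun i => |x i| = 1, ?_, fun p p0 pT p1 => ?_⟩
  · rw [← Set.ncard_coe_finset]
    simpa using hlt
  by_contra! hV
  have hnR : (0 : ℝ) < n := by exact_mod_cast hn
  have hL1 := one_le_logFactor n m
  set G : Fin n → ℝ := fun i => ((g i : ℤ) : ℝ) with hG
  set Δ := C * spencerBound n m with hΔ
  have hVΔ : ‖∑ i, (2 * n * (p i * G i)) • A i‖ ≤ Δ := by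
    have e1 : ∑ i, (2 * n * (p i * G i)) • A i = (2 * n : ℝ) • ∑ i, (p i * G i) • A i := by
      rw [Finset.smul_sum]; simp only [smul_smul]
    have e2 : κ * √(logFactor n m / n) * n = κ * spencerBound n m := by
      rw [spencerBound_eq, mul_assoc]
      congr 1
      rw [← Real.sqrt_sq hnR.le, ← Real.sqrt_mul (by positivity), Real.sqrt_sq hnR.le]
      congr 1
      field_simp
    have hs : 0 ≤ spencerBound n m := Real.sqrt_nonneg _
    rw [e1, norm_smul, Real.norm_of_nonneg (by positivity)]
    nlinarith
  -- a small enough step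
  have hstep : ∃ s : ℝ, 0 < s ∧ s ≤ 1 ∧ ∀ i, |(1 - s) * x i + s * (2 * n * (p i * G i))| ≤ 1 := by
    have h1 : ∀ i, ∀ᶠ s : ℝ in nhdsWithin 0 (Set.Ioi 0),
        |(1 - s) * x i + s * (2 * n * (p i * G i))| ≤ 1 := by
      intro i
      by_cases hi : |x i| = 1
      · have hp : p i = 0 := pT i (by simpa using hi)
        filter_upwards [Ioc_mem_nhdsGT (show (0 : ℝ) < 1 by norm_num)] with s hs
        rw [hp]
        simp only [zero_mul, mul_zero, add_zero, abs_mul, hi, mul_one]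
        rw [abs_of_nonneg (by linarith [hs.2])]
        linarith [hs.1]
      · have hi' : |x i| < 1 := lt_of_le_of_ne (hx1 i) hi
        have hc : Filter.Tendsto (fun s : ℝ => |(1 - s) * x i + s * (2 * n * (p i * G i))|)
            (nhdsWithin 0 (Set.Ioi 0)) (nhds |x i|) := by
          have : Continuous fun s : ℝ => |(1 - s) * x i + s * (2 * n * (p i * G i))| := by
            fun_prop
          have := this.tendsto 0
          simp only [sub_zero, one_mul, zero_mul, add_zero] at this
          exact this.mono_left nhdsWithin_le_nhds
        filter_upwards [hc.eventually_lt_const hi'] with s hs using hs.le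
    have h2 := (Filter.eventually_all.2 h1).and (Ioc_mem_nhdsGT (show (0 : ℝ) < 1 by norm_num))
    obtain ⟨s, hs, hs'⟩ := h2.exists
    exact ⟨s, hs'.1, hs'.2, hs⟩
  obtain ⟨s, hs0, hs1, hs⟩ := hstep
  have hmem : (fun i => (1 - s) * x i + s * (2 * n * (p i * G i))) ∈
      {y : Fin n → ℝ | (∀ i, |y i| ≤ 1) ∧ ‖∑ i, y i • A i‖ ≤ Δ} := by
    refine ⟨hs, ?_⟩
    have e1 : ∑ i, ((1 - s) * x i + s * (2 * n * (p i * G i))) • A i =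
        (1 - s) • ∑ i, x i • A i + s • ∑ i, (2 * n * (p i * G i)) • A i := by
      rw [Finset.smul_sum, Finset.smul_sum, ← Finset.sum_add_distrib]
      simp only [smul_smul, add_smul]
    rw [e1]
    refine (norm_add_le _ _).trans ?_
    rw [norm_smul, norm_smul, Real.norm_of_nonneg (by linarith), Real.norm_of_nonneg hs0.le]
    nlinarith
  have hle := hmax hmem
  simp only [Set.mem_ofPred_eq] at hle
  have e3 : ∑ i, ((1 - s) * x i + s * (2 * n * (p i * G i))) * G i =
      (1 - s) * ∑ i, x i * G i + s * (2 * n) := by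
    have : ∀ i, ((1 - s) * x i + s * (2 * n * (p i * G i))) * G i =
        (1 - s) * (x i * G i) + s * (2 * n) * p i := by
      intro i
      have := sq_int_unit (g i)
      linear_combination (s * 2 * n * p i) * this
    rw [Finset.sum_congr rfl fun i _ => this i, Finset.sum_add_distrib, ← Finset.mul_sum,
      ← Finset.mul_sum, p1, mul_one]
  have e4 : ∑ i, x i * G i ≤ n := by
    calc ∑ i, x i * G i ≤ ∑ i : Fin n, (1 : ℝ) := Finset.sum_le_sum fun i _ => by
          refine (le_abs_self _).trans ?_
          rw [abs_mul, hG, abs_int_unit, mul_one]; exact hx1 i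
      _ = n := by simp
  rw [e3] at hle
  nlinarith

/-- At least half of the sign vectors are not stuck, which is much more than the required fraction.
The case n = 0 is trivial because division by 0 gives 0. -/
theorem sdp_partial_coloring {δ κ C : ℝ} (hδ : 0 < δ) (hC : 2 * κ ≤ C)
    (hrare : ∀ (n m : ℕ) (A : Fin n → Matrix (Fin m) (Fin m) ℝ), 0 < n → (∀ i, ‖A i‖ ≤ 1) →
        2 * ({g | IsStuck A g (δ * n) (κ * √(logFactor n m / n))} : Set (Fin n → ℤˣ)).ncard
          ≤ 2 ^ n) :
    ∃ c : ℝ, 0 < c ∧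
      ∀ (n m : ℕ) (A : Fin n → Matrix (Fin m) (Fin m) ℝ), (∀ i, ‖A i‖ ≤ 1) →
        c / n * 2 ^ n ≤
          (({g : Fin n → ℤˣ | ∀ x : Fin n → ℝ, IsSDPOptimum A (C * spencerBound n m) g x →
            c * n ≤ (({i | |x i| = 1} : Set (Fin n)).ncard : ℝ)}.ncard : ℕ) : ℝ) := by
  refine ⟨min δ (1 / 2), by positivity, fun n m A hA => ?_⟩
  rcases Nat.eq_zero_or_pos n with rfl | hn
  · simp
  have hnR : (1 : ℝ) ≤ n := by exact_mod_cast hn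
  set S : Set (Fin n → ℤˣ) := {g | IsStuck A g (δ * n) (κ * √(logFactor n m / n))} with hS
  have h1 := hrare n m A hn hA
  have h2 : Sᶜ.ncard + S.ncard = 2 ^ n := by
    rw [add_comm, Set.ncard_add_ncard_compl]
    simp
  have h3 : Sᶜ ⊆ {g : Fin n → ℤˣ | ∀ x : Fin n → ℝ, IsSDPOptimum A (C * spencerBound n m) g x →
      min δ (1 / 2) * n ≤ (({i | |x i| = 1} : Set (Fin n)).ncard : ℝ)} := by
    intro g hg x hx
    have := hx.card_tight hn hC hg
    have : min δ (1 / 2) * n ≤ δ * n := mul_le_mul_of_nonneg_right (min_le_left _ _) (by linarith)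
    linarith
  have h4 := Set.ncard_le_ncard h3 (Set.toFinite _)
  have h5 : 2 ^ n ≤ 2 * Sᶜ.ncard := by rw [← hS] at h1; omega
  have h5' : (2 : ℝ) ^ n ≤ 2 * Sᶜ.ncard := by exact_mod_cast h5
  have h4' : (Sᶜ.ncard : ℝ) ≤ _ := Nat.cast_le.2 h4
  refine le_trans ?_ h4'
  have h6 : min δ (1 / 2) / n ≤ 1 / 2 := by
    rw [div_le_iff₀ (by linarith)]
    have := min_le_right δ (1 / 2)
    nlinarith
  have : (0 : ℝ) < 2 ^ n := by positivity
  nlinarith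

end
noncomputable section

/-! ### Trace powers -/

/-- For a log-convex sequence the ratios of successive terms increase. The division-free form covers
vanishing terms. -/
theorem mul_moment_le {a : ℕ → ℝ} (h0 : ∀ j, 0 ≤ a j) (h : ∀ j, a (j + 1) ^ 2 ≤ a j * a (j + 2))
    (j : ℕ) : a 1 * a j ≤ a 0 * a (j + 1) := by
  induction j with
  | zero => rw [mul_comm]
  | succ j ih =>
    rcases (h0 (j + 1)).eq_or_lt with h1 | h1
    · rw [← h1, mul_zero]; exact mul_nonneg (h0 0) (h0 _)
    · have hj : 0 < a j := by
        rcases (h0 j).eq_or_lt with h2 | h2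
        · have := h j; rw [← h2, zero_mul] at this; nlinarith
        · exact h2
      have h3 : a 1 * a (j + 1) * a j ≤ a 0 * a (j + 2) * a j := by
        have e1 := mul_le_mul_of_nonneg_right ih h1.le
        have e2 := mul_le_mul_of_nonneg_left (h j) (h0 0)
        nlinarith
      exact le_of_mul_le_mul_right h3 hj

theorem moment_pow_le {a : ℕ → ℝ} (h0 : ∀ j, 0 ≤ a j) (h : ∀ j, a (j + 1) ^ 2 ≤ a j * a (j + 2))
    (p : ℕ) : a 1 ^ (p + 1) ≤ a 0 ^ p * a (p + 1) := by
  induction p with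
  | zero => simp
  | succ p ih =>
    calc a 1 ^ (p + 1 + 1) = a 1 ^ (p + 1) * a 1 := pow_succ _ _
      _ ≤ a 0 ^ p * a (p + 1) * a 1 := mul_le_mul_of_nonneg_right ih (h0 1)
      _ = a 0 ^ p * (a 1 * a (p + 1)) := by ring
      _ ≤ a 0 ^ p * (a 0 * a (p + 1 + 1)) :=
        mul_le_mul_of_nonneg_left (mul_moment_le h0 h _) (pow_nonneg (h0 0) _)
      _ = _ := by ring

/-- Jensen's inequality for the spectral measure of W at v. The moments v ⬝ᵥ W^j v are log-convex
because the form of W^j is nonnegative at v + tWv for every t, so its discriminant in t is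
nonpositive. -/
theorem Matrix.PosSemidef.moment_pow_le {ι : Type*} [Fintype ι] [DecidableEq ι]
    {W : Matrix ι ι ℝ} (hW : W.PosSemidef) (v : ι → ℝ) (p : ℕ) :
    (v ⬝ᵥ W.mulVec v) ^ (p + 1) ≤ (v ⬝ᵥ v) ^ p * (v ⬝ᵥ (W ^ (p + 1)).mulVec v) := by
  have hnn : ∀ j (w : ι → ℝ), 0 ≤ w ⬝ᵥ (W ^ j).mulVec w := fun j w => by
    simpa using (hW.pow j).dotProduct_mulVec_nonneg w
  have hWs : W.transpose = W := by
    have := hW.1; rwa [Matrix.IsHermitian, Matrix.conjTranspose_eq_transpose_of_trivial] at this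
  have hsym : ∀ x y : ι → ℝ, x ⬝ᵥ W.mulVec y = W.mulVec x ⬝ᵥ y := by
    intro x y
    rw [Matrix.dotProduct_mulVec, ← Matrix.mulVec_transpose, hWs]
  have := _root_.moment_pow_le (a := fun j => v ⬝ᵥ (W ^ j).mulVec v) (fun j => hnn j v) ?_ p
  · simpa using this
  · intro j
    have hq : ∀ t : ℝ, 0 ≤ v ⬝ᵥ (W ^ (j + 2)).mulVec v * (t * t) +
        2 * (v ⬝ᵥ (W ^ (j + 1)).mulVec v) * t + v ⬝ᵥ (W ^ j).mulVec v := by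
      intro t
      have h := hnn j (v + t • W.mulVec v)
      have e1 : W.mulVec v ⬝ᵥ (W ^ j).mulVec v = v ⬝ᵥ (W ^ (j + 1)).mulVec v := by
        rw [← hsym, Matrix.mulVec_mulVec, ← pow_succ']
      have e2 : v ⬝ᵥ (W ^ j).mulVec (W.mulVec v) = v ⬝ᵥ (W ^ (j + 1)).mulVec v := by
        rw [Matrix.mulVec_mulVec, ← pow_succ]
      have e3 : W.mulVec v ⬝ᵥ (W ^ j).mulVec (W.mulVec v) = v ⬝ᵥ (W ^ (j + 2)).mulVec v := by
        rw [← hsym, Matrix.mulVec_mulVec, Matrix.mulVec_mulVec, ← pow_succ', ← pow_succ]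
      simp only [Matrix.mulVec_add, Matrix.mulVec_smul, add_dotProduct, dotProduct_add,
        smul_dotProduct, dotProduct_smul, smul_eq_mul, e1, e2, e3] at h
      linarith
    have := discrim_le_zero hq
    rw [discrim] at this
    linarith

/-- Cauchy–Schwarz for each term of a rank-one decomposition. -/
theorem Matrix.PosSemidef.dotProduct_mulVec_le_trace {ι : Type*} [Fintype ι]
    {W : Matrix ι ι ℝ} (hW : W.PosSemidef) (v : ι → ℝ) :
    v ⬝ᵥ W.mulVec v ≤ W.trace * (v ⬝ᵥ v) := by
  obtain ⟨k, w, rfl⟩ := Matrix.posSemidef_iff_eq_sum_vecMulVec.1 hW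
  rw [Matrix.trace_sum, Finset.sum_mul, Matrix.sum_mulVec, dotProduct_sum]
  refine Finset.sum_le_sum fun i _ => ?_
  have : v ⬝ᵥ (Matrix.vecMulVec (w i) (star (w i))).mulVec v = (∑ j, w i j * v j) ^ 2 := by
    rw [Matrix.vecMulVec_mulVec]
    simp [dotProduct, sq, Finset.mul_sum, mul_comm, mul_left_comm]
  rw [this, Matrix.trace_vecMulVec]
  refine (Finset.sum_mul_sq_le_sq_mul_sq _ _ _).trans (le_of_eq ?_)
  simp [dotProduct, sq]

theorem posSemidef_transpose_mul_self {ι : Type*} [Fintype ι] (M : Matrix ι ι ℝ) : (M.transpose * M).PosSemidef := by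
  simpa [Matrix.conjTranspose_eq_transpose_of_trivial] using
    Matrix.posSemidef_conjTranspose_mul_self M

theorem dotProduct_transpose_mul_self {ι : Type*} [Fintype ι] (M : Matrix ι ι ℝ) (v : ι → ℝ) :
    v ⬝ᵥ (M.transpose * M).mulVec v = M.mulVec v ⬝ᵥ M.mulVec v := by
  rw [← Matrix.mulVec_mulVec, Matrix.mulVec_transpose, dotProduct_comm, Matrix.dotProduct_mulVec]

theorem dotProduct_self_nonneg' {ι : Type*} [Fintype ι] (v : ι → ℝ) : 0 ≤ v ⬝ᵥ v := by
  simp only [dotProduct]; exact Finset.sum_nonneg fun i _ => mul_self_nonneg _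

/-- The `2 p`-th power of the Schatten `2 p`-norm. -/
def schatten {ι : Type*} [Fintype ι] [DecidableEq ι] (p : ℕ) (M : Matrix ι ι ℝ) : ℝ :=
  ((M.transpose * M) ^ p).trace

section
variable {ι : Type*} [Fintype ι] [DecidableEq ι]

theorem schatten_nonneg (p : ℕ) (M : Matrix ι ι ℝ) : 0 ≤ schatten p M :=
  ((posSemidef_transpose_mul_self M).pow p).trace_nonneg

/-- Jensen bounds |Mv|^(2(p+1)) by the form of (MᵀM)^(p+1), and that form is bounded by the trace.
-/
theorem norm_le_of_schatten_le {p : ℕ} {M : Matrix ι ι ℝ} {Δ : ℝ} (hΔ : 0 ≤ Δ)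
    (h : schatten (p + 1) M ≤ Δ ^ (2 * (p + 1))) : ‖M‖ ≤ Δ := by
  refine l2_opNorm_le_of_dotProduct M hΔ fun v => ?_
  have h1 := (posSemidef_transpose_mul_self M).moment_pow_le v p
  have h2 := ((posSemidef_transpose_mul_self M).pow (p + 1)).dotProduct_mulVec_le_trace v
  rw [dotProduct_transpose_mul_self] at h1
  have h3 := dotProduct_self_nonneg' v
  have h4 : (M.mulVec v ⬝ᵥ M.mulVec v) ^ (p + 1) ≤ (Δ ^ 2 * (v ⬝ᵥ v)) ^ (p + 1) := by
    calc _ ≤ _ := h1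
      _ ≤ (v ⬝ᵥ v) ^ p * (Δ ^ (2 * (p + 1)) * (v ⬝ᵥ v)) :=
        mul_le_mul_of_nonneg_left (h2.trans (mul_le_mul_of_nonneg_right h h3)) (pow_nonneg h3 _)
      _ = _ := by rw [mul_pow, ← pow_mul]; ring
  exact (pow_le_pow_iff_left₀ (dotProduct_self_nonneg' _) (by positivity) (by omega)).1 h4

theorem trace_le_card_mul_norm (B : Matrix ι ι ℝ) : B.trace ≤ Fintype.card ι * ‖B‖ := by
  have : ∀ i, B i i ≤ ‖B‖ := by
    intro i
    have h := mulVec_dotProduct_self_le B (Pi.single i 1)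
    rw [Matrix.mulVec_single_one] at h
    have h1 : (B i i) ^ 2 ≤ B.col i ⬝ᵥ B.col i := by
      rw [sq]
      exact Finset.single_le_sum (f := fun j => B.col i j * B.col i j)
        (fun j _ => mul_self_nonneg _) (Finset.mem_univ i)
    have h2 : (Pi.single i 1 : ι → ℝ) ⬝ᵥ Pi.single i 1 = 1 := by simp
    rw [h2, mul_one] at h
    exact (abs_le_of_sq_le_sq' (h1.trans h) (norm_nonneg _)).2
  calc B.trace = ∑ i, B i i := rfl
    _ ≤ ∑ i : ι, ‖B‖ := Finset.sum_le_sum fun i _ => this i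
    _ = _ := by simp

theorem norm_transpose' (M : Matrix ι ι ℝ) : ‖M.transpose‖ = ‖M‖ := by
  rw [← Matrix.conjTranspose_eq_transpose_of_trivial, Matrix.l2_opNorm_conjTranspose]

theorem schatten_le_card_mul {p : ℕ} {M : Matrix ι ι ℝ} {b : ℝ} (hb : ‖M‖ ≤ b) :
    schatten (p + 1) M ≤ Fintype.card ι * b ^ (2 * (p + 1)) := by
  refine (trace_le_card_mul_norm _).trans (mul_le_mul_of_nonneg_left ?_ (Nat.cast_nonneg _))
  refine (norm_pow_le' _ (Nat.succ_pos p)).trans ?_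
  rw [pow_mul]
  refine pow_le_pow_left₀ (norm_nonneg _) ((norm_mul_le _ _).trans ?_) _
  rw [norm_transpose', sq]
  exact mul_le_mul hb hb (norm_nonneg _) ((norm_nonneg _).trans hb)

theorem trace_eq_sum_orthonormal (u : OrthonormalBasis ι ℝ (EuclideanSpace ℝ ι))
    (B : Matrix ι ι ℝ) : B.trace = ∑ j, (u j).ofLp ⬝ᵥ B.mulVec (u j).ofLp := by
  have h := LinearMap.trace_eq_sum_inner (Matrix.toEuclideanLin B) u
  rw [Matrix.toEuclideanLin_eq_toLin_orthonormal, Matrix.trace_toLin_eq] at h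
  rw [h]
  refine Finset.sum_congr rfl fun j _ => ?_
  rw [← Matrix.toEuclideanLin_eq_toLin_orthonormal, EuclideanSpace.inner_eq_star_dotProduct]
  simp [dotProduct_comm]

/-- In an eigenbasis u of ZᵀZ, for the combination Z, the trace power is exactly ∑ |Z u_j|^(2(p+1)).
Each summand is convex, and at X and Y Jensen bounds |X u_j|^(2(p+1)) by the diagonal entry of the
matrix power, whatever the basis. -/
theorem convexOn_schatten (p : ℕ) :
    ConvexOn ℝ Set.univ (schatten (p + 1) : Matrix ι ι ℝ → ℝ) := by
  refine ⟨convex_univ, fun X _ Y _ a b ha hb hab => ?_⟩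
  set Z := a • X + b • Y with hZ
  have hH := (posSemidef_transpose_mul_self Z).1
  set u := hH.eigenvectorBasis with hu
  have hunit : ∀ j, (u j).ofLp ⬝ᵥ (u j).ofLp = 1 := by
    intro j
    have := u.orthonormal.1 j
    have e : (u j).ofLp ⬝ᵥ (u j).ofLp = ‖u j‖ ^ 2 := by
      rw [EuclideanSpace.norm_sq_eq]; simp [dotProduct, sq]
    rw [e, this, one_pow]
  have hpow : ∀ j k, ((Z.transpose * Z) ^ k).mulVec (u j).ofLp =
      hH.eigenvalues j ^ k • (u j).ofLp := by
    intro j k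
    induction k with
    | zero => simp
    | succ k ih =>
      rw [pow_succ, ← Matrix.mulVec_mulVec, hH.mulVec_eigenvectorBasis, Matrix.mulVec_smul, ih,
        smul_smul, pow_succ, mul_comm]
  have hZj : ∀ j, (u j).ofLp ⬝ᵥ ((Z.transpose * Z) ^ (p + 1)).mulVec (u j).ofLp =
      (Z.mulVec (u j).ofLp ⬝ᵥ Z.mulVec (u j).ofLp) ^ (p + 1) := by
    intro j
    have h1 := hpow j 1
    rw [pow_one, pow_one] at h1
    rw [hpow, ← dotProduct_transpose_mul_self, h1, dotProduct_smul, dotProduct_smul, hunit]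
    simp
  have hle : ∀ (M : Matrix ι ι ℝ) j, (M.mulVec (u j).ofLp ⬝ᵥ M.mulVec (u j).ofLp) ^ (p + 1) ≤
      (u j).ofLp ⬝ᵥ ((M.transpose * M) ^ (p + 1)).mulVec (u j).ofLp := by
    intro M j
    have := (posSemidef_transpose_mul_self M).moment_pow_le (u j).ofLp p
    rwa [hunit, one_pow, one_mul, dotProduct_transpose_mul_self] at this
  have hnorm : ∀ w : ι → ℝ, w ⬝ᵥ w = ‖WithLp.toLp 2 w‖ ^ 2 := by
    intro w; rw [EuclideanSpace.norm_sq_eq]; simp [dotProduct, sq]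
  have hcv : ∀ j, (Z.mulVec (u j).ofLp ⬝ᵥ Z.mulVec (u j).ofLp) ^ (p + 1) ≤
      a * (X.mulVec (u j).ofLp ⬝ᵥ X.mulVec (u j).ofLp) ^ (p + 1) +
      b * (Y.mulVec (u j).ofLp ⬝ᵥ Y.mulVec (u j).ofLp) ^ (p + 1) := by
    intro j
    simp only [hnorm, ← pow_mul]
    have h1 : ‖WithLp.toLp 2 (Z.mulVec (u j).ofLp)‖ ≤
        a * ‖WithLp.toLp 2 (X.mulVec (u j).ofLp)‖ + b * ‖WithLp.toLp 2 (Y.mulVec (u j).ofLp)‖ := by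
      have : WithLp.toLp 2 (Z.mulVec (u j).ofLp) =
          a • WithLp.toLp 2 (X.mulVec (u j).ofLp) + b • WithLp.toLp 2 (Y.mulVec (u j).ofLp) := by
        rw [hZ, Matrix.add_mulVec, Matrix.smul_mulVec, Matrix.smul_mulVec]; rfl
      rw [this]
      refine (norm_add_le _ _).trans ?_
      rw [norm_smul, norm_smul, Real.norm_of_nonneg ha, Real.norm_of_nonneg hb]
    refine (pow_le_pow_left₀ (norm_nonneg _) h1 _).trans ?_
    exact (convexOn_pow (2 * (p + 1))).2 (norm_nonneg _) (norm_nonneg _) ha hb hab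
  calc schatten (p + 1) Z
      = ∑ j, (u j).ofLp ⬝ᵥ ((Z.transpose * Z) ^ (p + 1)).mulVec (u j).ofLp :=
        trace_eq_sum_orthonormal u _
    _ ≤ ∑ j, (a * ((u j).ofLp ⬝ᵥ ((X.transpose * X) ^ (p + 1)).mulVec (u j).ofLp) +
        b * ((u j).ofLp ⬝ᵥ ((Y.transpose * Y) ^ (p + 1)).mulVec (u j).ofLp)) := by
        refine Finset.sum_le_sum fun j _ => ?_
        rw [hZj]
        exact (hcv j).trans (add_le_add (mul_le_mul_of_nonneg_left (hle X j) ha)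
          (mul_le_mul_of_nonneg_left (hle Y j) hb))
    _ = _ := by
        rw [Finset.sum_add_distrib, ← Finset.mul_sum, ← Finset.mul_sum,
          ← trace_eq_sum_orthonormal, ← trace_eq_sum_orthonormal]
        rfl

end

/-! ### Second differences of trace powers -/

/-- E' and O' collect the terms of even and odd degree in O. Adding the powers with O and -O leaves
only E', in which first-order terms cancel. It differs from W ^ p by replacing E with W somewhere or
by containing two factors O, hence the error p²(η + κ²). -/
theorem exists_even_odd_pow {R : Type*} [NormedRing R] [NormOneClass R] {E O W : R} {β κ η : ℝ}
    (hβ : 1 ≤ β) (hEO : ‖E‖ + ‖O‖ ≤ β) (hW : ‖W‖ ≤ β) (hO : ‖O‖ ≤ κ) (hEW : ‖E - W‖ ≤ η) (p : ℕ) :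
    ∃ E' O' : R, (E + O) ^ p = E' + O' ∧ (E - O) ^ p = E' - O' ∧
      ‖E'‖ + ‖O'‖ ≤ β ^ p ∧ ‖O'‖ ≤ p * κ * β ^ p ∧
      ‖E' - W ^ p‖ ≤ p ^ 2 * (η + κ ^ 2) * β ^ p := by
  have hκ : 0 ≤ κ := (norm_nonneg _).trans hO
  have hη : 0 ≤ η := (norm_nonneg _).trans hEW
  induction p with
  | zero => exact ⟨1, 0, by simp, by simp, by simp, by simp, by simp⟩
  | succ p ih =>
    obtain ⟨E', O', h1, h2, h3, h4, h5⟩ := ih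
    have hb : 1 ≤ β ^ p := one_le_pow₀ hβ
    have hE' : ‖E'‖ ≤ β ^ p := by linarith [norm_nonneg O']
    have hE : ‖E‖ ≤ β := by linarith [norm_nonneg O]
    have hOnn := norm_nonneg O
    have hO'nn := norm_nonneg O'
    have hEnn := norm_nonneg E
    have hE'nn := norm_nonneg E'
    refine ⟨E' * E + O' * O, E' * O + O' * E, ?_, ?_, ?_, ?_, ?_⟩
    · rw [pow_succ, h1]; noncomm_ring
    · rw [pow_succ, h2]; noncomm_ring
    · have e1 : ‖E' * E + O' * O‖ ≤ ‖E'‖ * ‖E‖ + ‖O'‖ * ‖O‖ :=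
        (norm_add_le _ _).trans (add_le_add (norm_mul_le _ _) (norm_mul_le _ _))
      have e2 : ‖E' * O + O' * E‖ ≤ ‖E'‖ * ‖O‖ + ‖O'‖ * ‖E‖ :=
        (norm_add_le _ _).trans (add_le_add (norm_mul_le _ _) (norm_mul_le _ _))
      calc _ ≤ (‖E'‖ + ‖O'‖) * (‖E‖ + ‖O‖) := by linarith
        _ ≤ β ^ p * β := mul_le_mul h3 hEO (by positivity) (by positivity)
        _ = _ := (pow_succ _ _).symm
    · have e2 : ‖E' * O + O' * E‖ ≤ ‖E'‖ * ‖O‖ + ‖O'‖ * ‖E‖ :=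
        (norm_add_le _ _).trans (add_le_add (norm_mul_le _ _) (norm_mul_le _ _))
      have e3 : ‖E'‖ * ‖O‖ ≤ β ^ p * κ := mul_le_mul hE' hO hOnn (by positivity)
      have e4 : ‖O'‖ * ‖E‖ ≤ p * κ * β ^ p * β := mul_le_mul h4 hE hEnn (by positivity)
      have e5 : β ^ p * κ ≤ β ^ p * κ * β := le_mul_of_one_le_right (by positivity) hβ
      rw [pow_succ]; push_cast; linarith
    · have e0 : E' * E + O' * O - W ^ (p + 1) = (E' - W ^ p) * W + E' * (E - W) + O' * O := by
        rw [pow_succ]; noncomm_ring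
      rw [e0]
      have e1 : ‖(E' - W ^ p) * W + E' * (E - W) + O' * O‖ ≤
          ‖E' - W ^ p‖ * ‖W‖ + ‖E'‖ * ‖E - W‖ + ‖O'‖ * ‖O‖ :=
        (norm_add_le _ _).trans (add_le_add ((norm_add_le _ _).trans
          (add_le_add (norm_mul_le _ _) (norm_mul_le _ _))) (norm_mul_le _ _))
      have e2 : ‖E' - W ^ p‖ * ‖W‖ ≤ p ^ 2 * (η + κ ^ 2) * β ^ p * β :=
        mul_le_mul h5 hW (norm_nonneg _) (by positivity)
      have e3 : ‖E'‖ * ‖E - W‖ ≤ β ^ p * η := mul_le_mul hE' hEW (norm_nonneg _) (by positivity)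
      have e4 : ‖O'‖ * ‖O‖ ≤ p * κ * β ^ p * κ := mul_le_mul h4 hO hOnn (by positivity)
      have e5 : β ^ p * (η + p * κ ^ 2) ≤ β ^ p * (η + p * κ ^ 2) * β :=
        le_mul_of_one_le_right (by positivity) hβ
      have e6 : 0 ≤ β ^ p * β * ((2 * p) * η + (p + 1) * κ ^ 2) := by positivity
      rw [pow_succ β p]; push_cast
      linarith

/-- The Gram matrices of X ± hA are E ± O with O of size 2h and E within h² of XᵀX, so
`exists_even_odd_pow` applies. -/
theorem schatten_second_difference {ι : Type*} [Fintype ι] [DecidableEq ι] {X A : Matrix ι ι ℝ}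
    (hX : ‖X‖ ≤ 1) (hA : ‖A‖ ≤ 1) {h : ℝ} (h0 : 0 ≤ h) {p : ℕ} (hp : 2 * p * h ≤ 1) :
    schatten p (X + h • A) + schatten p (X - h • A) - 2 * schatten p X ≤
      30 * Fintype.card ι * p ^ 2 * h ^ 2 := by
  rcases isEmpty_or_nonempty ι with he | hne
  · simp [schatten, Matrix.trace]
  rcases Nat.eq_zero_or_pos p with rfl | hpos
  · simp [schatten]; linarith
  have hp1 : (1 : ℝ) ≤ p := by exact_mod_cast hpos
  have h1 : h ≤ 1 / 2 := by nlinarith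
  set W := X.transpose * X
  set O := h • (X.transpose * A + A.transpose * X)
  set E := W + h ^ 2 • (A.transpose * A)
  have hplus : (X + h • A).transpose * (X + h • A) = E + O := by
    simp only [E, W, O, Matrix.transpose_add, Matrix.transpose_smul, Matrix.add_mul, Matrix.mul_add,
      Matrix.smul_mul, Matrix.mul_smul]
    module
  have hminus : (X - h • A).transpose * (X - h • A) = E - O := by
    simp only [E, W, O, Matrix.transpose_sub, Matrix.transpose_smul, Matrix.sub_mul, Matrix.mul_sub,
      Matrix.smul_mul, Matrix.mul_smul]
    module
  have hprod : ∀ B C : Matrix ι ι ℝ, ‖B‖ ≤ 1 → ‖C‖ ≤ 1 → ‖B.transpose * C‖ ≤ 1 := by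
    intro B C hB hC
    refine (norm_mul_le _ _).trans ?_
    rw [norm_transpose']
    exact mul_le_one₀ hB (norm_nonneg _) hC
  have hW : ‖W‖ ≤ 1 := hprod X X hX hX
  have hO : ‖O‖ ≤ 2 * h := by
    rw [norm_smul, Real.norm_of_nonneg h0]
    have := (norm_add_le (X.transpose * A) (A.transpose * X)).trans
      (add_le_add (hprod X A hX hA) (hprod A X hA hX))
    nlinarith
  have hEW : ‖E - W‖ ≤ h ^ 2 := by
    rw [show E - W = h ^ 2 • (A.transpose * A) by simp [E], norm_smul,
      Real.norm_of_nonneg (by positivity)]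
    exact mul_le_of_le_one_right (by positivity) (hprod A A hA hA)
  have hE : ‖E‖ ≤ 1 + h ^ 2 := by
    have : ‖E‖ ≤ ‖W‖ + ‖E - W‖ := by
      simpa using norm_add_le W (E - W)
    linarith
  have hβ : (1 : ℝ) ≤ (1 + h) ^ 2 := one_le_pow₀ (by linarith)
  obtain ⟨E', O', e1, e2, -, -, e3⟩ := exists_even_odd_pow hβ (by nlinarith) (hW.trans hβ) hO hEW p
  -- The condition 2ph ≤ 1 keeps this growth factor below e. The final constant is 30 = 2 · (1 + 4)
  -- · 3.
  have h3 : ((1 + h) ^ 2) ^ p ≤ 3 := by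
    calc ((1 + h) ^ 2) ^ p = (1 + h) ^ (2 * p) := (pow_mul _ _ _).symm
      _ ≤ (Real.exp h) ^ (2 * p) := by
        refine pow_le_pow_left₀ (by linarith) ?_ _
        linarith [Real.add_one_le_exp h]
      _ = Real.exp (2 * p * h) := by rw [← Real.exp_nat_mul]; push_cast; rfl
      _ ≤ Real.exp 1 := Real.exp_le_exp.2 hp
      _ ≤ 3 := by linarith [Real.exp_one_lt_d9]
  have e4 : schatten p (X + h • A) + schatten p (X - h • A) - 2 * schatten p X =
      2 * (E' - W ^ p).trace := by
    rw [schatten, schatten, schatten, hplus, hminus, e1, e2, Matrix.trace_add, Matrix.trace_sub,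
      Matrix.trace_sub]
    ring
  rw [e4]
  have e5 := trace_le_card_mul_norm (E' - W ^ p)
  have e6 : ‖E' - W ^ p‖ ≤ 15 * p ^ 2 * h ^ 2 := by
    refine e3.trans ?_
    have : (p : ℝ) ^ 2 * (h ^ 2 + (2 * h) ^ 2) * ((1 + h) ^ 2) ^ p ≤
      (p : ℝ) ^ 2 * (h ^ 2 + (2 * h) ^ 2) * 3 := mul_le_mul_of_nonneg_left h3 (by positivity)
    linarith
  have e7 : (Fintype.card ι : ℝ) * ‖E' - W ^ p‖ ≤ Fintype.card ι * (15 * p ^ 2 * h ^ 2) :=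
    mul_le_mul_of_nonneg_left e6 (Nat.cast_nonneg _)
  linarith

end
noncomputable section

/-! ### Local minima of the penalized objective -/

/-- Linear objective with a trace power penalty for the norm constraint `‖∑ i, z i • A i‖ ≤ Δ`. -/
def penalty {ι : Type*} [Fintype ι] {m : ℕ} (A : ι → Matrix (Fin m) (Fin m) ℝ) (g : ι → ℝ)
    (Δ : ℝ) (p : ℕ) (z : ι → ℝ) : ℝ :=
  2 * Fintype.card ι * schatten p (Δ⁻¹ • ∑ i, z i • A i) - ∑ i, g i * z i

section
variable {ι : Type*} [Fintype ι] {m : ℕ} (A : ι → Matrix (Fin m) (Fin m) ℝ) (g : ι → ℝ)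
    (Δ : ℝ) (p : ℕ)

theorem convexOn_penalty : ConvexOn ℝ Set.univ (penalty A g Δ (p + 1)) := by
  refine ⟨convex_univ, fun x _ y _ a b ha hb hab => ?_⟩
  have h := (convexOn_schatten (ι := Fin m) p).2 (Set.mem_univ (Δ⁻¹ • ∑ i, x i • A i))
    (Set.mem_univ (Δ⁻¹ • ∑ i, y i • A i)) ha hb hab
  have e : Δ⁻¹ • ∑ i, (a • x + b • y) i • A i =
      a • (Δ⁻¹ • ∑ i, x i • A i) + b • (Δ⁻¹ • ∑ i, y i • A i) := by
    simp only [Pi.add_apply, Pi.smul_apply, smul_eq_mul, add_smul, Finset.sum_add_distrib,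
      mul_smul, ← Finset.smul_sum]
    module
  have e2 : ∑ i, g i * (a • x + b • y) i = a * ∑ i, g i * x i + b * ∑ i, g i * y i := by
    simp only [Pi.add_apply, Pi.smul_apply, smul_eq_mul, mul_add, Finset.sum_add_distrib,
      Finset.mul_sum]
    congr 1 <;> exact Finset.sum_congr rfl fun i _ => by ring
  rw [penalty, e, e2, penalty, penalty]
  simp only [smul_eq_mul] at h ⊢
  have hc : (0 : ℝ) ≤ 2 * Fintype.card ι := by positivity
  nlinarith [mul_le_mul_of_nonneg_left h hc]

theorem neg_sum_le_penalty (z : ι → ℝ) : -∑ i, g i * z i ≤ penalty A g Δ p z := by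
  have : 0 ≤ 2 * Fintype.card ι * schatten p (Δ⁻¹ • ∑ i, z i • A i) :=
    mul_nonneg (by positivity) (schatten_nonneg _ _)
  rw [penalty]; linarith

variable {A g Δ p}

theorem sum_mul_le_of_abs_le (hg : ∀ i, |g i| = 1) {z : ι → ℝ} (hz : ∀ i, |z i| ≤ 2) :
    ∑ i, g i * z i ≤ 2 * Fintype.card ι := by
  calc ∑ i, g i * z i ≤ ∑ i : ι, (2 : ℝ) := Finset.sum_le_sum fun i _ => by
        refine (le_abs_self _).trans ?_
        rw [abs_mul, hg, one_mul]; exact hz i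
    _ = _ := by simp; ring

/-- The factor 2·card in `penalty` is chosen for this: the linear term is at most 2·card for |z i| ≤
2, the range of differences of points in the cube, so a nonpositive penalty forces the trace power
to be at most 1. The search starts at value 0 and only decreases, hence never violates the norm
constraint. -/
theorem norm_le_of_penalty_nonpos [Nonempty ι] (hg : ∀ i, |g i| = 1) (hΔ : 0 < Δ) {z : ι → ℝ}
    (hz : ∀ i, |z i| ≤ 2) (h : penalty A g Δ (p + 1) z ≤ 0) : ‖∑ i, z i • A i‖ ≤ Δ := by
  have h1 := sum_mul_le_of_abs_le hg hz
  have hc : (0 : ℝ) < Fintype.card ι := by exact_mod_cast Fintype.card_pos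
  have h2 : schatten (p + 1) (Δ⁻¹ • ∑ i, z i • A i) ≤ 1 ^ (2 * (p + 1)) := by
    rw [penalty] at h
    rw [one_pow]
    nlinarith
  have h3 := norm_le_of_schatten_le zero_le_one h2
  rw [norm_smul, norm_inv, Real.norm_of_nonneg hΔ.le, inv_mul_le_iff₀ hΔ] at h3
  linarith

/-- The linear part cancels. Nonpositivity of the penalty supplies the norm bound that the estimate
for trace powers needs. -/
theorem penalty_second_difference [Nonempty ι] [DecidableEq ι] (hg : ∀ i, |g i| = 1) (hΔ : 1 ≤ Δ)
    (hA : ∀ i, ‖A i‖ ≤ 1) {z : ι → ℝ}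
    (hz : ∀ i, |z i| ≤ 2) (hF : penalty A g Δ (p + 1) z ≤ 0) {h : ℝ} (h0 : 0 ≤ h)
    (hp : 2 * ((p + 1 : ℕ) : ℝ) * h ≤ 1) (i : ι) :
    penalty A g Δ (p + 1) (z + Pi.single i h) + penalty A g Δ (p + 1) (z - Pi.single i h) -
      2 * penalty A g Δ (p + 1) z ≤ 60 * Fintype.card ι * m * ((p + 1 : ℕ) : ℝ) ^ 2 * h ^ 2 := by
  have hΔ0 : 0 < Δ := by linarith
  have hX : ‖Δ⁻¹ • ∑ j, z j • A j‖ ≤ 1 := by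
    have := norm_le_of_penalty_nonpos hg hΔ0 hz hF
    rwa [norm_smul, norm_inv, Real.norm_of_nonneg hΔ0.le, inv_mul_le_iff₀ hΔ0, mul_one]
  have hAi : ‖Δ⁻¹ • A i‖ ≤ 1 := by
    rw [norm_smul, norm_inv, Real.norm_of_nonneg hΔ0.le, inv_mul_le_iff₀ hΔ0]
    linarith [hA i]
  have key := schatten_second_difference hX hAi h0 hp
  rw [Fintype.card_fin] at key
  have s1 : ∑ j, (Pi.single i h : ι → ℝ) j • A j = h • A i := by
    rw [Finset.sum_eq_single i (fun j _ hj => by simp [Pi.single_eq_of_ne hj]) (by simp)]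
    simp
  have e1 : Δ⁻¹ • ∑ j, (z + Pi.single i h : ι → ℝ) j • A j =
      Δ⁻¹ • ∑ j, z j • A j + h • (Δ⁻¹ • A i) := by
    simp only [Pi.add_apply, add_smul, Finset.sum_add_distrib, s1]
    module
  have e2 : Δ⁻¹ • ∑ j, (z - Pi.single i h : ι → ℝ) j • A j =
      Δ⁻¹ • ∑ j, z j • A j - h • (Δ⁻¹ • A i) := by
    simp only [Pi.sub_apply, sub_smul, Finset.sum_sub_distrib, s1]
    module
  have e3 : ∑ j, g j * (z + Pi.single i h : ι → ℝ) j + ∑ j, g j * (z - Pi.single i h : ι → ℝ) j =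
      2 * ∑ j, g j * z j := by
    rw [← Finset.sum_add_distrib, Finset.mul_sum]
    exact Finset.sum_congr rfl fun j _ => by simp only [Pi.add_apply, Pi.sub_apply]; ring
  simp only [penalty, e1, e2]
  have hc : (0 : ℝ) ≤ 2 * Fintype.card ι := by positivity
  have := mul_le_mul_of_nonneg_left key hc
  linarith

/-- A convex function cannot decrease much along a short move if no coordinate move decreases it. -/
theorem ConvexOn.sub_le_of_coordinate_moves [Nonempty ι] [DecidableEq ι] {F : (ι → ℝ) → ℝ}
    (hF : ConvexOn ℝ Set.univ F) {z d : ι → ℝ} {h η : ℝ} (hh : 0 < h) (hη : 0 ≤ η)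
    (hd : ∑ i, |d i| ≤ h)
    (hmove : ∀ i, d i ≠ 0 → F (z - Pi.single i (SignType.sign (d i) * h)) ≤ F z + η) :
    F z - η ≤ F (z + d) := by
  -- The point z - d is a convex combination of z and the points at distance h against the signs of
  -- d. Midpoint convexity then turns this upper bound at z - d into the lower bound at z + d.
  have h1 : F (z - d) ≤ F z + η := by
    set w : Option ι → ℝ := fun o => o.elim (1 - ∑ i, |d i| / h) (fun i => |d i| / h) with hw
    set P : Option ι → (ι → ℝ) := fun o =>
      o.elim z (fun i => z - Pi.single i (SignType.sign (d i) * h)) with hP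
    have hw0 : ∀ o ∈ Finset.univ, 0 ≤ w o := by
      rintro (_ | i) -
      · simp only [hw, Option.elim]
        rw [← Finset.sum_div, sub_nonneg, div_le_one hh]
        exact hd
      · simp only [hw, Option.elim]; positivity
    have hw1 : ∑ o, w o = 1 := by
      rw [Fintype.sum_option]; simp [hw]
    have hj := hF.map_sum_le hw0 hw1 (p := P) (fun _ _ => Set.mem_univ _)
    have hs : ∑ o, w o • P o = z - d := by
      rw [Fintype.sum_option]
      simp only [hw, hP, Option.elim]
      ext j
      simp only [Pi.add_apply, Pi.smul_apply, Finset.sum_apply, Pi.sub_apply, smul_eq_mul, mul_sub,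
        Finset.sum_sub_distrib, ← Finset.sum_mul]
      have hsum : ∑ i, |d i| / h * (Pi.single i (SignType.sign (d i) * h) : ι → ℝ) j = d j := by
        rw [Finset.sum_eq_single j (fun i _ hij => by rw [Pi.single_eq_of_ne hij.symm, mul_zero])
          (by simp), Pi.single_eq_same]
        calc |d j| / h * (SignType.sign (d j) * h) = |d j| * SignType.sign (d j) := by field_simp
          _ = d j := abs_mul_sign _
      rw [hsum]; ring
    rw [hs] at hj
    refine hj.trans ?_
    calc ∑ o, w o • F (P o) ≤ ∑ o, w o * (F z + η) := by
          refine Finset.sum_le_sum fun o ho => ?_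
          rw [smul_eq_mul]
          rcases o with _ | i
          · exact mul_le_mul_of_nonneg_left (by simp [hP, hη]) (hw0 _ ho)
          · by_cases hi : d i = 0
            · simp [hw, hi]
            · exact mul_le_mul_of_nonneg_left (hmove i hi) (hw0 _ ho)
      _ = F z + η := by rw [← Finset.sum_mul, hw1, one_mul]
  have h2 := hF.2 (Set.mem_univ (z - d)) (Set.mem_univ (z + d)) (by norm_num : (0 : ℝ) ≤ 1 / 2)
    (by norm_num : (0 : ℝ) ≤ 1 / 2) (by norm_num)
  have e : (1 / 2 : ℝ) • (z - d) + (1 / 2 : ℝ) • (z + d) = z := by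
    module
  rw [e, smul_eq_mul, smul_eq_mul] at h2
  linarith

/-- At a local minimum (on a grid) of the penalized objective, the weights of no small convex
combination of the signed matrices can avoid the tight coordinates. -/
theorem lt_norm_of_local_min [Nonempty ι] {N : ℕ} (hN : 4000 * Fintype.card ι * (m + 1) ^ 3 ≤ N)
    (hA : ∀ i, ‖A i‖ ≤ 1) (hg : ∀ i, |g i| = 1) (hΔ : 1 ≤ Δ)
    {y z : ι → ℝ} (hy : ∀ i, |y i| < 1) (hyz : ∀ i, |y i + z i| ≤ 1)
    (hgrid : ∀ i, |y i + z i| = 1 ∨ |y i + z i| ≤ 1 - 1 / N)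
    (hF : penalty A g Δ (m + 1) z ≤ 0)
    (hmin : ∀ i (σ : ℝ), (σ = 1 ∨ σ = -1) → |y i + z i + σ / N| ≤ 1 → ∀ z' : ι → ℝ,
      z' i = z i + σ / N → (∀ j, j ≠ i → z' j = z j) →
      penalty A g Δ (m + 1) z - 1 / (8 * N) < penalty A g Δ (m + 1) z')
    {q : ι → ℝ} (hq0 : ∀ i, 0 ≤ q i) (hqT : ∀ i, |y i + z i| = 1 → q i = 0) (hq1 : ∑ i, q i = 1) :
    Δ / (10 * Fintype.card ι) < ‖∑ i, (q i * g i) • A i‖ := by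
  classical
  by_contra! hV
  set a : ℝ := ((Fintype.card ι : ℕ) : ℝ) with ha
  have ha1 : 1 ≤ a := by
    have : 1 ≤ Fintype.card ι := Fintype.card_pos
    rw [ha]; exact_mod_cast this
  have hNR : 4000 * a * (m + 1) ^ 3 ≤ (N : ℝ) := by rw [ha]; exact_mod_cast hN
  have hm1 : (1 : ℝ) ≤ m + 1 := by linarith [(Nat.cast_nonneg m : (0 : ℝ) ≤ m)]
  have hm2 : (1 : ℝ) ≤ (m + 1) ^ 2 := one_le_pow₀ hm1
  have hm3 : ((m : ℝ) + 1) ≤ (m + 1) ^ 3 := by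
    calc ((m : ℝ) + 1) = (m + 1) * 1 := by ring
      _ ≤ (m + 1) * (m + 1) ^ 2 := mul_le_mul_of_nonneg_left hm2 (by linarith)
      _ = _ := by ring
  have ham : a * (m + 1) ≤ a * (m + 1) ^ 3 := mul_le_mul_of_nonneg_left hm3 (by linarith)
  have ham' : (m : ℝ) + 1 ≤ a * (m + 1) := le_mul_of_one_le_left (by linarith) ha1
  have hNpos : (0 : ℝ) < N := by nlinarith
  set h : ℝ := 1 / N with hh
  have hpos : 0 < h := by positivity
  have hNh : N * h = 1 := by rw [hh]; field_simp
  have hz : ∀ i, |z i| ≤ 2 := by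
    intro i
    have h1 := abs_le.1 (hyz i)
    have h2 := abs_lt.1 (hy i)
    exact abs_le.2 ⟨by linarith, by linarith⟩
  set F := penalty A g Δ (m + 1) with hFdef
  have hconv : ConvexOn ℝ Set.univ F := convexOn_penalty A g Δ m
  -- The displacement s·(5a·q g - z) has ℓ¹ norm at most s·(5a + 2a) = h, one grid step.
  set s := h / (7 * a) with hs
  have hspos : 0 < s := by positivity
  have hs7 : s * (7 * a) = h := by rw [hs]; field_simp
  set d : ι → ℝ := fun i => s * (5 * a * (q i * g i) - z i) with hd
  -- the target point has small objective
  have hFq : F (fun i => 5 * a * (q i * g i)) ≤ -(3 * a) := by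
    have e1 : ∑ i, g i * (5 * a * (q i * g i)) = 5 * a := by
      have : ∀ i, g i * (5 * a * (q i * g i)) = 5 * a * q i := by
        intro i
        have : g i * g i = 1 := by rw [← abs_mul_abs_self, hg]; norm_num
        linear_combination (5 * a * q i) * this
      rw [Finset.sum_congr rfl fun i _ => this i, ← Finset.mul_sum, hq1, mul_one]
    have e2 : ‖Δ⁻¹ • ∑ i, (5 * a * (q i * g i)) • A i‖ ≤ 1 / 2 := by
      have : ∑ i, (5 * a * (q i * g i)) • A i = (5 * a) • ∑ i, (q i * g i) • A i := by
        rw [Finset.smul_sum]; simp only [smul_smul]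
      rw [this, norm_smul, norm_smul, norm_inv, Real.norm_of_nonneg (by linarith),
        Real.norm_of_nonneg (by linarith), inv_mul_le_iff₀ (by linarith)]
      calc 5 * a * ‖∑ i, (q i * g i) • A i‖ ≤ 5 * a * (Δ / (10 * a)) :=
            mul_le_mul_of_nonneg_left hV (by linarith)
        _ = Δ * (1 / 2) := by field_simp; norm_num
    have e3 := schatten_le_card_mul (p := m) e2
    have e4 : (Fintype.card (Fin m) : ℝ) * (1 / 2) ^ (2 * (m + 1)) ≤ 1 := by
      rw [Fintype.card_fin]
      have : (m : ℝ) ≤ 2 ^ (2 * (m + 1)) := by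
        have : m < 2 ^ m := Nat.lt_two_pow_self
        have : 2 ^ m ≤ 2 ^ (2 * (m + 1)) := Nat.pow_le_pow_right (by norm_num) (by omega)
        have : m ≤ 2 ^ (2 * (m + 1)) := by omega
        exact_mod_cast this
      rw [one_div, inv_pow, ← div_eq_mul_inv, div_le_one (by positivity)]
      exact this
    have e5 := e3.trans e4
    rw [hFdef, penalty, e1, ← ha]
    nlinarith
  have hFz : -(2 * a) ≤ F z := by
    have := neg_sum_le_penalty A g Δ (m + 1) z
    have := sum_mul_le_of_abs_le hg hz
    linarith
  -- Along the segment to the target the convex objective falls from at least -2a to at most -3a, so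
  -- its initial fraction s gains at least s·a = h / 7.
  have hup : F (z + d) ≤ F z - h / 7 := by
    have hs1 : s ≤ 1 := by
      have : h ≤ 1 := by
        rw [hh, div_le_one hNpos]; linarith
      have : s ≤ s * (7 * a) := le_mul_of_one_le_right hspos.le (by linarith)
      linarith
    have := hconv.2 (Set.mem_univ z) (Set.mem_univ fun i => 5 * a * (q i * g i))
      (by linarith : 0 ≤ 1 - s) hspos.le (by ring)
    have e : (1 - s) • z + s • (fun i => 5 * a * (q i * g i)) = z + d := by
      ext i; simp only [hd, Pi.add_apply, Pi.smul_apply, smul_eq_mul]; ring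
    rw [e, smul_eq_mul, smul_eq_mul] at this
    nlinarith
  have hdsum : ∑ i, |d i| ≤ h := by
    calc ∑ i, |d i| ≤ ∑ i, s * (5 * a * q i + 2) := by
          refine Finset.sum_le_sum fun i _ => ?_
          rw [hd, abs_mul, abs_of_pos hspos]
          refine mul_le_mul_of_nonneg_left ?_ hspos.le
          refine (abs_sub _ _).trans (add_le_add (le_of_eq ?_) (hz i))
          rw [abs_mul, abs_mul (q i), hg, abs_of_nonneg (hq0 i), abs_of_nonneg (by linarith),
            mul_one]
      _ = s * (7 * a) := by
          rw [← Finset.mul_sum, Finset.sum_add_distrib, ← Finset.mul_sum, hq1]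
          simp only [Finset.sum_const, Finset.card_univ, nsmul_eq_mul, ← ha]
          ring
      _ = h := hs7
  -- This is where the size of N is needed: the curvature must be negligible compared with one grid
  -- step.
  have hsmall : 60 * a * m * ((m + 1 : ℕ) : ℝ) ^ 2 * h ^ 2 ≤ 60 / 4000 * h := by
    have e1 : 60 * a * m * ((m + 1 : ℕ) : ℝ) ^ 2 ≤ 60 / 4000 * N := by
      push_cast
      have : a * m * ((m : ℝ) + 1) ^ 2 ≤ a * (m + 1) ^ 3 := by
        have : a * (m + 1) ^ 3 = a * m * ((m : ℝ) + 1) ^ 2 + a * (m + 1) ^ 2 := by ring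
        have : 0 ≤ a * ((m : ℝ) + 1) ^ 2 := by positivity
        linarith
      linarith
    calc _ ≤ 60 / 4000 * N * h ^ 2 := mul_le_mul_of_nonneg_right e1 (sq_nonneg h)
      _ = 60 / 4000 * h * (N * h) := by ring
      _ = _ := by rw [hNh, mul_one]
  -- Local minimality bounds the move along d from below, so the second difference bounds the
  -- opposite move from above; the opposite move itself need not be feasible. The total loss (1/8 +
  -- 60/4000)h = 0.14h is less than the gain h / 7 of `hup`.
  have hlow := hconv.sub_le_of_coordinate_moves (z := z) (d := d) (η := h / 8 + 60 / 4000 * h) hpos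
    (by positivity) hdsum (by
      intro i hi
      -- The move in the direction of d stays in the cube. A tight coordinate has q i = 0, so d i is
      -- a negative multiple of z i and points inward because |y i| < 1; any other coordinate has
      -- room for a full grid step.
      obtain ⟨σ, hσ, hσd, hin⟩ : ∃ σ : ℝ, (σ = 1 ∨ σ = -1) ∧ (SignType.sign (d i) : ℝ) = σ ∧
          |y i + z i + σ / N| ≤ 1 := by
        have hh1 : h ≤ 1 := by rw [hh, div_le_one hNpos]; linarith
        rcases hgrid i with ht | ht
        · have hdi : d i = -(s * z i) := by simp only [hd, hqT i ht]; ring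
          have hyi := abs_lt.1 (hy i)
          rcases (abs_eq zero_le_one).1 ht with h1 | h1
          · refine ⟨-1, Or.inr rfl, ?_, ?_⟩
            · have : d i < 0 := by rw [hdi]; nlinarith
              rw [sign_neg this]; simp
            · rw [h1, abs_le, neg_div, ← hh]; constructor <;> linarith
          · refine ⟨1, Or.inl rfl, ?_, ?_⟩
            · have : 0 < d i := by rw [hdi]; nlinarith
              rw [sign_pos this]; simp
            · rw [h1, abs_le, ← hh]; constructor <;> linarith
        · have ht' := abs_le.1 ht
          rcases lt_or_gt_of_ne hi with h1 | h1
          · refine ⟨-1, Or.inr rfl, by rw [sign_neg h1]; simp, ?_⟩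
            rw [abs_le, neg_div, ← hh]; constructor <;> linarith
          · refine ⟨1, Or.inl rfl, by rw [sign_pos h1]; simp, ?_⟩
            rw [abs_le, ← hh]; constructor <;> linarith
      have h1 := hmin i σ hσ hin (z + Pi.single i (σ / N)) (by simp) (fun j hj => by simp [hj])
      have h2 := penalty_second_difference hg hΔ hA hz hF hpos.le (by
        push_cast
        have : 2 * ((m : ℝ) + 1) ≤ N := by linarith
        calc 2 * ((m : ℝ) + 1) * h ≤ N * h := mul_le_mul_of_nonneg_right this hpos.le
          _ = 1 := hNh) i
      have h3 : 1 / (8 * (N : ℝ)) = h / 8 := by rw [hh]; field_simp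
      rw [h3] at h1
      rw [hσd]
      rcases hσ with rfl | rfl
      · rw [one_mul]
        rw [← hh] at h1
        linarith
      · rw [show (-1 : ℝ) / N = -h by rw [hh]; ring, Pi.single_neg, ← sub_eq_add_neg] at h1
        rw [neg_one_mul, Pi.single_neg, sub_neg_eq_add]
        linarith)
  linarith

end
end
noncomputable section

/-! ### Running time of programs on states with entries of bounded bit length -/

theorem bitLen_le_iff {z : ℤ} {B : ℕ} : bitLen z ≤ B ↔ |z| < 2 ^ B := by
  rw [bitLen, Nat.size_le, Int.abs_eq_natAbs]
  exact_mod_cast Iff.rfl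

theorem bitLen_add_le (a b : ℤ) : bitLen (a + b) ≤ max (bitLen a) (bitLen b) + 1 := by
  rw [bitLen_le_iff, pow_succ]
  have ha := bitLen_le_iff.1 (le_max_left (bitLen a) (bitLen b))
  have hb := bitLen_le_iff.1 (le_max_right (bitLen a) (bitLen b))
  have := abs_add_le a b
  linarith

theorem bitLen_neg (a : ℤ) : bitLen (-a) = bitLen a := by simp [bitLen]

theorem bitLen_sub_le (a b : ℤ) : bitLen (a - b) ≤ max (bitLen a) (bitLen b) + 1 := by
  rw [sub_eq_add_neg, ← bitLen_neg b]; exact bitLen_add_le _ _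

theorem bitLen_mul_le (a b : ℤ) : bitLen (a * b) ≤ bitLen a + bitLen b := by
  rw [bitLen_le_iff, abs_mul, pow_add]
  exact mul_lt_mul'' (bitLen_le_iff.1 le_rfl) (bitLen_le_iff.1 le_rfl) (abs_nonneg _) (abs_nonneg _)

theorem bitLen_div_le (a b : ℤ) : bitLen (a / b) ≤ bitLen a := by
  rw [bitLen, bitLen]
  apply Nat.size_le_size
  exact Int.natAbs_ediv_le_natAbs a b

/-- All registers and array entries have bit length at most `B`. -/
def Machine.Bounded (B : ℕ) (s : Machine) : Prop :=
  (∀ r, bitLen (s.reg r) ≤ B) ∧ ∀ a p, bitLen (s.arr a p) ≤ B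

/-- Bounds the bit length of the value, in units of a bound on the state. -/
def Expr.width : Expr → ℕ
  | .const z => bitLen z + 1
  | .reg _ => 1
  | .get _ _ => 1
  | .add e f => e.width + f.width
  | .sub e f => e.width + f.width
  | .mul e f => e.width + f.width
  | .div e f => e.width + f.width

/-- Bounds the cost of evaluation, in units of a bound on the state. -/
def Expr.weight : Expr → ℕ
  | .const z => bitLen z + 1
  | .reg _ => 1
  | .get _ e => 1 + e.weight
  | .add e f => e.width + f.width + e.weight + f.weight
  | .sub e f => e.width + f.width + e.weight + f.weight
  | .mul e f => e.width + f.width + e.weight + f.weight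
  | .div e f => e.width + f.width + e.weight + f.weight

/-- The added 1 makes the induction close: widths add up at every operation, and a sum or difference
may need one more bit than the larger operand. -/
theorem Expr.bitLen_eval_lt {B : ℕ} {s : Machine} (hs : s.Bounded B) (e : Expr) :
    bitLen (e.eval s) + 1 ≤ e.width * (B + 1) := by
  induction e with
  | const z => simp only [eval, width]; nlinarith
  | reg r => simpa [eval, width] using hs.1 r
  | get a e _ => simpa [eval, width] using hs.2 a _
  | add e f he hf =>
    have := bitLen_add_le (e.eval s) (f.eval s)
    simp only [eval, width, add_mul]; omega
  | sub e f he hf =>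
    have := bitLen_sub_le (e.eval s) (f.eval s)
    simp only [eval, width, add_mul]; omega
  | mul e f he hf =>
    have := bitLen_mul_le (e.eval s) (f.eval s)
    simp only [eval, width, add_mul]; omega
  | div e f he hf =>
    have := bitLen_div_le (e.eval s) (f.eval s)
    simp only [eval, width, add_mul]; omega

theorem Expr.cost_le {B : ℕ} {s : Machine} (hs : s.Bounded B) (e : Expr) :
    e.cost s ≤ e.weight * (B + 1) := by
  induction e with
  | const z => simp only [cost, weight]; nlinarith
  | reg r => have := hs.1 r; simp only [cost, weight]; omega
  | get a e he => have := hs.2 a (e.eval s).toNat; simp only [cost, weight, add_mul]; omega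
  | add e f he hf =>
    have := (Expr.add e f).bitLen_eval_lt hs
    simp only [eval, width] at this
    simp only [cost, weight, add_mul] at *; omega
  | sub e f he hf =>
    have := (Expr.sub e f).bitLen_eval_lt hs
    simp only [eval, width] at this
    simp only [cost, weight, add_mul] at *; omega
  | mul e f he hf =>
    have := (Expr.mul e f).bitLen_eval_lt hs
    simp only [eval, width] at this
    simp only [cost, weight, add_mul] at *; omega
  | div e f he hf =>
    have := (Expr.div e f).bitLen_eval_lt hs
    simp only [eval, width] at this
    simp only [cost, weight, add_mul] at *; omega

def Machine.setReg (s : Machine) (r : ℕ) (v : ℤ) : Machine :=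
  { s with reg := Function.update s.reg r v }

def Machine.setArr (s : Machine) (a : ℕ) (f : ℕ → ℤ) : Machine :=
  { s with arr := Function.update s.arr a f }

namespace Machine

@[ext] theorem ext' {s t : Machine} (h1 : s.reg = t.reg) (h2 : s.arr = t.arr)
    (h3 : s.tape = t.tape) : s = t := by
  cases s; cases t; simp_all

@[simp] theorem setReg_reg (s : Machine) (r r' : ℕ) (v : ℤ) :
    (s.setReg r v).reg r' = if r' = r then v else s.reg r' := by
  simp [setReg, Function.update_apply]

@[simp] theorem setReg_arr (s : Machine) (r : ℕ) (v : ℤ) : (s.setReg r v).arr = s.arr := rfl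

@[simp] theorem setReg_tape (s : Machine) (r : ℕ) (v : ℤ) : (s.setReg r v).tape = s.tape := rfl

@[simp] theorem setArr_reg (s : Machine) (a : ℕ) (f : ℕ → ℤ) : (s.setArr a f).reg = s.reg := rfl

@[simp] theorem setArr_arr (s : Machine) (a a' : ℕ) (f : ℕ → ℤ) :
    (s.setArr a f).arr a' = if a' = a then f else s.arr a' := by
  simp [setArr, Function.update_apply]

@[simp] theorem setArr_tape (s : Machine) (a : ℕ) (f : ℕ → ℤ) : (s.setArr a f).tape = s.tape := rfl

theorem setReg_setReg (s : Machine) (r : ℕ) (v w : ℤ) :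
    (s.setReg r v).setReg r w = s.setReg r w := by
  simp [setReg]

theorem setReg_comm (s : Machine) {r r' : ℕ} (h : r ≠ r') (v w : ℤ) :
    (s.setReg r v).setReg r' w = (s.setReg r' w).setReg r v := by
  simp [setReg, Function.update_comm h]

theorem setArr_setArr (s : Machine) (a : ℕ) (f g : ℕ → ℤ) :
    (s.setArr a f).setArr a g = s.setArr a g := by
  simp [setArr]

theorem setArr_self (s : Machine) (a : ℕ) : s.setArr a (s.arr a) = s := by
  simp [setArr]

theorem Bounded.setReg {B : ℕ} {s : Machine} (hs : s.Bounded B) {r : ℕ} {v : ℤ}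
    (hv : bitLen v ≤ B) : (s.setReg r v).Bounded B := by
  refine ⟨fun r' => ?_, hs.2⟩
  rw [setReg_reg]; split_ifs
  exacts [hv, hs.1 r']

theorem Bounded.store {B : ℕ} {s : Machine} (hs : s.Bounded B) {a p : ℕ} {v : ℤ}
    (hv : bitLen v ≤ B) : (s.setArr a (Function.update (s.arr a) p v)).Bounded B := by
  refine ⟨hs.1, fun a' p' => ?_⟩
  rw [setArr_arr]; split_ifs
  · rw [Function.update_apply]; split_ifs
    exacts [hv, hs.2 _ _]
  · exact hs.2 _ _

end Machine

/-- On states with entries of bit length at most `B`, the program `p` leads from `s` to `s'` in time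
at most `k * (B + 1)`, and the entries remain bounded. -/
def Runs (B k : ℕ) (p : Program) (s s' : Machine) : Prop :=
  s.Bounded B → s'.Bounded B ∧ ∃ c, Exec p s c s' ∧ c ≤ k * (B + 1)

namespace Runs

variable {B k l : ℕ} {p p' : Program} {s s' s'' : Machine}

theorem mono (h : Runs B k p s s') (hkl : k ≤ l) : Runs B l p s s' := fun hs =>
  let ⟨h1, c, h2, h3⟩ := h hs
  ⟨h1, c, h2, h3.trans (Nat.mul_le_mul_right _ hkl)⟩

theorem skip : Runs B 1 .skip s s := fun hs => ⟨hs, 1, .skip s, by omega⟩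

theorem assign {r : ℕ} {e : Expr} {v : ℤ} (he : e.eval s = v) (hv : bitLen v ≤ B) :
    Runs B (1 + e.weight) (.assign r e) s (s.setReg r v) := fun hs => by
  subst he
  refine ⟨hs.setReg hv, _, .assign s r e, ?_⟩
  have := e.cost_le hs
  rw [add_mul]; omega

theorem store {a j : ℕ} {idx e : Expr} {v : ℤ} (hi : idx.eval s = j) (he : e.eval s = v)
    (hv : bitLen v ≤ B) :
    Runs B (1 + idx.weight + e.weight) (.store a idx e) s
      (s.setArr a (Function.update (s.arr a) j v)) := fun hs => by
  subst he
  have hj : j = (idx.eval s).toNat := by rw [hi]; simp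
  subst hj
  refine ⟨hs.store hv, _, .store s a idx e, ?_⟩
  have := e.cost_le hs
  have := idx.cost_le hs
  rw [add_mul, add_mul]; omega

theorem flip {r : ℕ} {b : Bool} {t : List Bool} (h : s.tape = b :: t) (hB : 1 ≤ B) :
    Runs B 1 (.flip r) s { s.setReg r (if b then 1 else 0) with tape := t } := fun hs => by
  refine ⟨?_, 1, .flip s r b t h, by omega⟩
  have h1 : bitLen (if b then 1 else 0) ≤ B := by
    rw [bitLen_le_iff]
    have : (2 : ℤ) ^ 1 ≤ 2 ^ B := pow_le_pow_right₀ (by norm_num) hB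
    split_ifs <;> norm_num
    linarith
  exact hs.setReg (r := r) h1

theorem comp (h : Runs B k p s s') (h' : Runs B l p' s' s'') :
    Runs B (1 + k + l) (.comp p p') s s'' := fun hs => by
  obtain ⟨h1, c, h2, h3⟩ := h hs
  obtain ⟨h1', c', h2', h3'⟩ := h' h1
  refine ⟨h1', _, .comp _ _ _ _ _ _ _ h2 h2', ?_⟩
  rw [add_mul, add_mul]; omega

theorem branch_pos {e : Expr} (he : 0 < e.eval s) (h : Runs B k p s s') :
    Runs B (1 + e.weight + k) (.branch e p p') s s' := fun hs => by
  obtain ⟨h1, c, h2, h3⟩ := h hs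
  refine ⟨h1, _, .branch_pos _ _ _ _ _ _ he h2, ?_⟩
  have := e.cost_le hs
  rw [add_mul, add_mul]; omega

theorem branch_neg {e : Expr} (he : e.eval s ≤ 0) (h : Runs B k p' s s') :
    Runs B (1 + e.weight + k) (.branch e p p') s s' := fun hs => by
  obtain ⟨h1, c, h2, h3⟩ := h hs
  refine ⟨h1, _, .branch_neg _ _ _ _ _ _ he h2, ?_⟩
  have := e.cost_le hs
  rw [add_mul, add_mul]; omega

end Runs

/-- `for r = 0, 1, …, bnd - 1 do p`. -/
def forLoop (r : ℕ) (bnd : Expr) (p : Program) : Program :=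
  .comp (.assign r (.const 0))
    (.loop (.sub bnd (.reg r)) (.comp p (.assign r (.add (.reg r) (.const 1)))))

/-- Step count of a loop with `N` iterations of weight `k`. -/
def forWeight (bnd : Expr) (N k : ℕ) : ℕ :=
  N * (k + bnd.weight + bnd.width + 15) + (bnd.weight + bnd.width + 15)

theorem bitLen_zero : bitLen 0 = 0 := by simp [bitLen]

theorem bitLen_one : bitLen 1 = 1 := by simp [bitLen]

theorem bitLen_mono {j k : ℕ} (h : j ≤ k) : bitLen j ≤ bitLen k := by
  simp only [bitLen, Int.natAbs_natCast]; exact Nat.size_le_size h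

/-- The invariant I t describes the state at the loop head when the counter is t. The bound is
evaluated anew in every iteration, so it must be constant on all states that satisfy the invariant.
-/
theorem Runs.forLoop {B k N r : ℕ} {bnd : Expr} {p : Program} {s : Machine}
    (I : ℕ → Machine → Prop) (h0 : I 0 (s.setReg r 0))
    (hreg : ∀ t s', I t s' → s'.reg r = t)
    (hbnd : ∀ t s', t ≤ N → I t s' → bnd.eval s' = N)
    (hstep : ∀ t s', t < N → I t s' → ∃ s'', Runs B k p s' s'' ∧ s''.reg r = t ∧
      I (t + 1) (s''.setReg r ((t : ℤ) + 1)))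
    (hN : bitLen N ≤ B) :
    ∃ s', Runs B (forWeight bnd N k) (_root_.forLoop r bnd p) s s' ∧ I N s' := by
  have key : ∀ j t s', t + j = N → I t s' → ∃ s'',
      Runs B (j * (k + bnd.weight + bnd.width + 15) + (bnd.weight + bnd.width + 3))
        (.loop (.sub bnd (.reg r)) (.comp p (.assign r (.add (.reg r) (.const 1))))) s' s'' ∧
        I N s'' := by
    intro j
    induction j with
    | zero =>
      intro t s' ht hI
      obtain rfl : t = N := by omega
      refine ⟨s', fun hs => ⟨hs, _, Exec.loop_stop _ _ _ ?_, ?_⟩, hI⟩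
      · simp [Expr.eval, hbnd t s' le_rfl hI, hreg t s' hI]
      · have := (Expr.sub bnd (.reg r)).cost_le hs
        simp only [Expr.weight, Expr.width, add_mul] at this ⊢
        omega
    | succ j ih =>
      intro t s' ht hI
      obtain ⟨s1, hr1, hs1, hI1⟩ := hstep t s' (by omega) hI
      obtain ⟨s2, hr2, hI2⟩ := ih (t + 1) _ (by omega) hI1
      refine ⟨s2, fun hs => ?_, hI2⟩
      have hinc : Runs B 7 (.assign r (.add (.reg r) (.const 1))) s1
          (s1.setReg r ((t : ℤ) + 1)) := by
        refine (Runs.assign (by simp [Expr.eval, hs1]) ?_).mono ?_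
        · have := bitLen_mono (show t + 1 ≤ N by omega)
          push_cast at this; omega
        · simp [Expr.weight, Expr.width, bitLen_one]
      obtain ⟨b1, c1, e1, l1⟩ := hr1.comp hinc hs
      obtain ⟨b2, c2, e2, l2⟩ := hr2 b1
      refine ⟨b2, _, .loop_step _ _ _ _ _ _ _ ?_ e1 e2, ?_⟩
      · simp only [Expr.eval, hbnd t s' (by omega) hI, hreg t s' hI]; omega
      · have := (Expr.sub bnd (.reg r)).cost_le hs
        simp only [Expr.weight, Expr.width] at this
        have e : ((j + 1) * (k + bnd.weight + bnd.width + 15) + (bnd.weight + bnd.width + 3)) *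
            (B + 1) = (j * (k + bnd.weight + bnd.width + 15) + (bnd.weight + bnd.width + 3)) *
            (B + 1) + (1 + k + 7) * (B + 1) + (bnd.width + 1 + bnd.weight + 1) * (B + 1) +
            5 * (B + 1) := by ring
        rw [e]
        omega
  obtain ⟨s', h1, h2⟩ := key N 0 _ (by omega) h0
  refine ⟨s', ?_, h2⟩
  have ha : Runs B 2 (.assign r (.const 0)) s (s.setReg r 0) :=
    (Runs.assign (v := 0) rfl (by simp [bitLen_zero])).mono (by simp [Expr.weight, bitLen_zero])
  exact (ha.comp h1).mono (by rw [forWeight]; omega)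

/-- `acc = ∑ k < bnd, e`. -/
def sumLoop (k acc : ℕ) (bnd e : Expr) : Program :=
  .comp (.assign acc (.const 0)) (forLoop k bnd (.assign acc (.add (.reg acc) e)))

def sumWeight (bnd e : Expr) (N : ℕ) : ℕ := forWeight bnd N (2 * e.weight + e.width + 5) + 3

theorem Expr.width_le_weight (e : Expr) : e.width ≤ e.weight := by
  cases e <;> (simp [width, weight]; try omega)

/-- The summand must not depend on the accumulator, and every partial sum has to respect the bit
bound, not only the final value. -/
theorem Runs.sumLoop {B N k acc : ℕ} {bnd e : Expr} {s : Machine} (hne : k ≠ acc) (f : ℕ → ℤ)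
    (he : ∀ t < N, ∀ v, e.eval ((s.setReg acc v).setReg k t) = f t)
    (hbnd : ∀ t v : ℤ, bnd.eval ((s.setReg acc v).setReg k t) = N)
    (hN : bitLen N ≤ B) (hf : ∀ t ≤ N, bitLen (∑ i ∈ Finset.range t, f i) ≤ B) :
    Runs B (sumWeight bnd e N) (_root_.sumLoop k acc bnd e) s
      ((s.setReg acc (∑ i ∈ Finset.range N, f i)).setReg k N) := by
  obtain ⟨s', h1, h2⟩ := Runs.forLoop (B := B) (k := 2 * e.weight + e.width + 5) (N := N) (r := k)
    (bnd := bnd) (p := .assign acc (.add (.reg acc) e)) (s := s.setReg acc 0)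
    (fun t s' => s' = (s.setReg acc (∑ i ∈ Finset.range t, f i)).setReg k t)
    (by simp) (by rintro t s' rfl; simp) (by rintro t s' - rfl; exact hbnd _ _) (by
      rintro t s' ht rfl
      refine ⟨_, (Runs.assign (v := ∑ i ∈ Finset.range (t + 1), f i) ?_ (hf _ ht)).mono ?_, ?_, ?_⟩
      · simp [Expr.eval, hne.symm, he t ht, Finset.sum_range_succ]
      · simp only [Expr.weight, Expr.width]; omega
      · simp [hne]
      · rw [Machine.setReg_comm _ hne, Machine.setReg_setReg, Machine.setReg_setReg]
        push_cast; rfl) hN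
  subst h2
  have ha : Runs B 2 (.assign acc (.const 0)) s (s.setReg acc 0) :=
    (Runs.assign (v := 0) rfl (by simp [bitLen_zero])).mono (by simp [Expr.weight, bitLen_zero])
  exact (ha.comp h1).mono (by rw [sumWeight]; omega)

/-- The array that agrees with `val` below `k` and with `f` from there on. -/
def fillTo (val : ℕ → ℤ) (k : ℕ) (f : ℕ → ℤ) : ℕ → ℤ := fun u => if u < k then val u else f u

theorem fillTo_succ (val : ℕ → ℤ) (k : ℕ) (f : ℕ → ℤ) :
    fillTo val (k + 1) f = Function.update (fillTo val k f) k (val k) := by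
  ext u
  simp only [fillTo, Function.update_apply]
  rcases lt_trichotomy u k with h | h | h
  · rw [if_pos (by omega), if_neg (by omega), if_pos h]
  · subst h; simp
  · rw [if_neg (by omega), if_neg (by omega), if_neg (by omega)]

@[simp] theorem fillTo_zero (val f : ℕ → ℤ) : fillTo val 0 f = f := by
  ext u; simp [fillTo]

/-- `for t < bnd: arr a idx = ∑ k < bnd', e`, with `t`, `k` in registers `10`, `11`. -/
def fillLoop (bnd bnd' e : Expr) (a : ℕ) (idx : Expr) : Program :=
  forLoop 10 bnd (.comp (sumLoop 11 12 bnd' e) (.store a idx (.reg 12)))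

def fillWeight (bnd bnd' e idx : Expr) (N M : ℕ) : ℕ :=
  forWeight bnd N (sumWeight bnd' e M + idx.weight + 3)

/-- The entry at place o + t is computed in the array already filled below that place, so entries
may depend on earlier ones; the matrix powers use this. The final contents of the scratch registers
11 and 12 are irrelevant. -/
theorem Runs.fillLoop {B N M a o : ℕ} {bnd bnd' e idx : Expr} {s : Machine} (f : ℕ → ℕ → ℤ)
    (val f₀ : ℕ → ℤ) (ha : s.arr a = fillTo val o f₀)
    (hval : ∀ t < N, val (o + t) = ∑ k ∈ Finset.range M, f t k)
    (he : ∀ t < N, ∀ k < M, ∀ v, e.eval ((((s.setArr a (fillTo val (o + t) f₀)).setReg 10 t).setReg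
      12 v).setReg 11 k) = f t k)
    (hbnd' : ∀ t < N, ∀ k v : ℤ, bnd'.eval ((((s.setArr a (fillTo val (o + t) f₀)).setReg 10
      t).setReg 12 v).setReg 11 k) = M)
    (hidx : ∀ t < N, ∀ k v : ℤ, idx.eval ((((s.setArr a (fillTo val (o + t) f₀)).setReg 10
      t).setReg 12 v).setReg 11 k) = (o + t : ℕ))
    (hbnd : ∀ t ≤ N, ∀ k v : ℤ, bnd.eval ((((s.setArr a (fillTo val (o + t) f₀)).setReg 10
      t).setReg 12 v).setReg 11 k) = N)
    (hN : bitLen N ≤ B) (hM : bitLen M ≤ B)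
    (hf : ∀ t < N, ∀ k ≤ M, bitLen (∑ i ∈ Finset.range k, f t i) ≤ B) :
    ∃ k v : ℤ, Runs B (fillWeight bnd bnd' e idx N M) (_root_.fillLoop bnd bnd' e a idx) s
      ((((s.setArr a (fillTo val (o + N) f₀)).setReg 10 N).setReg 12 v).setReg 11 k) := by
  obtain ⟨s', h1, k, v, rfl⟩ := Runs.forLoop (B := B) (k := sumWeight bnd' e M + idx.weight + 3)
    (N := N) (r := 10)
    (bnd := bnd) (p := .comp (_root_.sumLoop 11 12 bnd' e) (.store a idx (.reg 12))) (s := s)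
    (fun t s' => ∃ k v : ℤ, s' = ((((s.setArr a (fillTo val (o + t) f₀)).setReg 10
      t).setReg 12 v).setReg 11 k))
    ⟨s.reg 11, s.reg 12, by
      rw [add_zero, ← ha, Machine.setArr_self]
      ext r
      · simp only [Machine.setReg_reg]; split_ifs <;> simp_all
      · simp
      · simp⟩
    (by rintro t s' ⟨k, v, rfl⟩; simp)
    (by rintro t s' ht ⟨k, v, rfl⟩; exact hbnd t ht k v) (by
      rintro t s' ht ⟨k, v, rfl⟩
      have hcl : ∀ k' v' : ℤ, ((((((s.setArr a (fillTo val (o + t) f₀)).setReg 10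
          t).setReg 12 v).setReg 11 k).setReg 12 v').setReg 11 k') =
          ((((s.setArr a (fillTo val (o + t) f₀)).setReg 10 t).setReg 12 v').setReg 11 k') := by
        intro k' v'
        rw [Machine.setReg_comm _ (by norm_num : (11 : ℕ) ≠ 12), Machine.setReg_setReg,
          Machine.setReg_setReg]
      have hsum := Runs.sumLoop (B := B) (N := M) (k := 11) (acc := 12) (bnd := bnd') (e := e)
        (s := (((s.setArr a (fillTo val (o + t) f₀)).setReg 10 t).setReg 12 v).setReg 11 k)
        (by norm_num) (f t) (fun i hi w => by rw [hcl]; exact he t ht i hi w)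
        (fun i w => by rw [hcl]; exact hbnd' t ht i w) hM (hf t ht)
      rw [hcl, ← hval t ht] at hsum
      refine ⟨_, (hsum.comp (Runs.store (hidx t ht _ _) (v := val (o + t)) (by simp [Expr.eval])
        (by rw [hval t ht]; exact hf t ht M le_rfl))).mono ?_, ?_, ?_⟩
      · simp only [Expr.weight]; omega
      · simp
      · refine ⟨M, val (o + t), ?_⟩
        rw [← add_assoc, fillTo_succ]
        ext r x
        · simp only [Machine.setReg_reg, Machine.setArr_reg]
          split_ifs <;> simp_all
        · simp only [Machine.setReg_arr, Machine.setArr_arr, if_true]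
          split_ifs <;> rfl
        · simp) hN
  exact ⟨k, v, h1⟩

end
noncomputable section

/-! ### The objective in integer arithmetic -/

/-- Data of the discrepancy algorithm: the entries of the matrices and the parameters `N` (inverse
step width), `c` (factor of the discrepancy bound) and `d` (progress is a `1 / d` fraction). -/
structure Inst where
  n : ℕ
  m : ℕ
  N : ℕ
  c : ℕ
  d : ℕ
  num : ℕ → ℤ
  den : ℕ → ℤ

namespace Inst
variable (I : Inst)

/-- A common denominator. -/
def D : ℤ := ∏ u ∈ Finset.range (I.n * (I.m * I.m)), I.den u

/-- The numerators over the common denominator of the combination of the matrices given by `ζ`. -/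
def mat (ζ : ℕ → ℤ) (t : ℕ) : ℤ :=
  ∑ i ∈ Finset.range I.n, ζ i * (I.num (i * (I.m * I.m) + t) * (I.D / I.den (i * (I.m * I.m) + t)))

def gram (ζ : ℕ → ℤ) (r c : ℕ) : ℤ :=
  ∑ k ∈ Finset.range I.m, I.mat ζ (k * I.m + r) * I.mat ζ (k * I.m + c)

/-- Index j stands for the power j + 1 of the Gram matrix, so index m gives the power m + 1 used in
the penalty. -/
def gramPow (ζ : ℕ → ℤ) : ℕ → ℕ → ℕ → ℤ
  | 0, r, c => I.gram ζ r c
  | j + 1, r, c => ∑ k ∈ Finset.range I.m, gramPow ζ j r k * I.gram ζ k c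

/-- The integer multiple of the penalized objective. -/
def objective (a : ℕ) (Q : ℤ) (g ζ : ℕ → ℤ) : ℤ :=
  16 * a * I.N * ∑ t ∈ Finset.range I.m, I.gramPow ζ I.m t t -
    8 * Q * ∑ i ∈ Finset.range I.n, g i * ζ i

/-- All data is at most `2 ^ b` in absolute value. -/
structure Small (b : ℕ) : Prop where
  b4 : 4 ≤ b
  n_le : (I.n : ℤ) ≤ 2 ^ b
  m_le : (I.m : ℤ) ≤ 2 ^ b
  N_le : (I.N : ℤ) ≤ 2 ^ b
  c_le : (I.c : ℤ) ≤ 2 ^ b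
  prod_le : ∀ k ≤ I.n * (I.m * I.m), |∏ u ∈ Finset.range k, I.den u| ≤ 2 ^ b
  entry_le : ∀ u, |I.num u * (I.D / I.den u)| ≤ 2 ^ b

/-- Bit length bound for all intermediate results. -/
def bits (b : ℕ) : ℕ := b * (10 * I.m + 20)

end Inst

theorem bitLen_le_of_abs_le_pow {x : ℤ} {b j J : ℕ} (hb : 1 ≤ b) (h : |x| ≤ (2 ^ b) ^ j)
    (hj : j < J) : bitLen x ≤ b * J := by
  rw [bitLen_le_iff]
  refine h.trans_lt ?_
  rw [← pow_mul]
  exact pow_lt_pow_right₀ (by norm_num) (Nat.mul_lt_mul_of_pos_left hj (by omega))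

theorem abs_sum_range_le {f : ℕ → ℤ} {N k : ℕ} {c : ℤ} (hc : 0 ≤ c) (hk : k ≤ N)
    (h : ∀ i < N, |f i| ≤ c) : |∑ i ∈ Finset.range k, f i| ≤ N * c := by
  calc |∑ i ∈ Finset.range k, f i| ≤ ∑ i ∈ Finset.range k, |f i| := Finset.abs_sum_le_sum_abs _ _
    _ ≤ ∑ i ∈ Finset.range k, c := Finset.sum_le_sum fun i hi =>
        h i (by have := Finset.mem_range.1 hi; omega)
    _ = k * c := by simp
    _ ≤ N * c := mul_le_mul_of_nonneg_right (by exact_mod_cast hk) hc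

theorem abs_sum_range_le_pow {f : ℕ → ℤ} {N k b j : ℕ} (hN : (N : ℤ) ≤ 2 ^ b) (hk : k ≤ N)
    (h : ∀ i < N, |f i| ≤ (2 ^ b) ^ j) : |∑ i ∈ Finset.range k, f i| ≤ (2 ^ b) ^ (j + 1) := by
  refine (abs_sum_range_le (by positivity) hk h).trans ?_
  rw [pow_succ, mul_comm]
  exact mul_le_mul_of_nonneg_left hN (by positivity)

theorem abs_mul_le_pow {x y : ℤ} {T : ℤ} {j k : ℕ} (hx : |x| ≤ T ^ j) (hy : |y| ≤ T ^ k) :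
    |x * y| ≤ T ^ (j + k) := by
  rw [abs_mul, pow_add]
  exact mul_le_mul hx hy (abs_nonneg _) ((abs_nonneg _).trans hx)

namespace Inst
variable {I : Inst} {b : ℕ}

namespace Small

theorem D_le (h : I.Small b) : |I.D| ≤ 2 ^ b := h.prod_le _ le_rfl

theorem T_ge (h : I.Small b) : (16 : ℤ) ≤ 2 ^ b := by
  calc (16 : ℤ) = 2 ^ 4 := by norm_num
    _ ≤ 2 ^ b := pow_le_pow_right₀ (by norm_num) h.b4

theorem one_le_T (h : I.Small b) : (1 : ℤ) ≤ 2 ^ b := by linarith [h.T_ge]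

variable {ζ : ℕ → ℤ}

theorem abs_zeta_le (h : I.Small b) (hζ : ∀ i, |ζ i| ≤ 2 * I.N) (i : ℕ) :
    |ζ i| ≤ (2 ^ b) ^ 2 := by
  have := h.N_le
  have := h.T_ge
  have := hζ i
  nlinarith

theorem abs_mat_term_le (h : I.Small b) (hζ : ∀ i, |ζ i| ≤ 2 * I.N) (i u : ℕ) :
    |ζ i * (I.num u * (I.D / I.den u))| ≤ (2 ^ b) ^ 3 :=
  abs_mul_le_pow (k := 1) (h.abs_zeta_le hζ i) (by rw [pow_one]; exact h.entry_le u)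

theorem abs_mat_le (h : I.Small b) (hζ : ∀ i, |ζ i| ≤ 2 * I.N) (t : ℕ) :
    |I.mat ζ t| ≤ (2 ^ b) ^ 4 :=
  abs_sum_range_le_pow h.n_le le_rfl fun i _ => h.abs_mat_term_le hζ i _

theorem abs_gram_le (h : I.Small b) (hζ : ∀ i, |ζ i| ≤ 2 * I.N) (r c : ℕ) :
    |I.gram ζ r c| ≤ (2 ^ b) ^ 9 :=
  abs_sum_range_le_pow h.m_le le_rfl fun _ _ =>
    abs_mul_le_pow (j := 4) (k := 4) (h.abs_mat_le hζ _) (h.abs_mat_le hζ _)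

/-- Magnitudes are tracked as exponents of 2 ^ b. One more factor costs 9 for a Gram entry and 1 for
the summation. -/
theorem abs_gramPow_le (h : I.Small b) (hζ : ∀ i, |ζ i| ≤ 2 * I.N) (j r c : ℕ) :
    |I.gramPow ζ j r c| ≤ (2 ^ b) ^ (10 * j + 9) := by
  induction j generalizing r c with
  | zero => exact h.abs_gram_le hζ r c
  | succ j ih =>
    have := abs_sum_range_le_pow (f := fun k => I.gramPow ζ j r k * I.gram ζ k c) h.m_le le_rfl
      fun k _ => abs_mul_le_pow (ih r k) (h.abs_gram_le hζ k c)
    rwa [show 10 * j + 9 + 9 + 1 = 10 * (j + 1) + 9 by ring] at this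

theorem bitLen_le {x : ℤ} {j : ℕ} (h : I.Small b) (hx : |x| ≤ (2 ^ b) ^ j)
    (hj : j < 10 * I.m + 20) : bitLen x ≤ I.bits b :=
  bitLen_le_of_abs_le_pow (by have := h.b4; omega) hx hj

theorem bitLen_n (h : I.Small b) : bitLen I.n ≤ I.bits b :=
  h.bitLen_le (j := 1) (by rw [pow_one, Nat.abs_cast]; exact h.n_le) (by omega)

theorem bitLen_m (h : I.Small b) : bitLen I.m ≤ I.bits b :=
  h.bitLen_le (j := 1) (by rw [pow_one, Nat.abs_cast]; exact h.m_le) (by omega)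

theorem abs_mm_le (h : I.Small b) : |((I.m * I.m : ℕ) : ℤ)| ≤ (2 ^ b) ^ 2 := by
  push_cast
  exact abs_mul_le_pow (j := 1) (k := 1) (by rw [pow_one, Nat.abs_cast]; exact h.m_le)
    (by rw [pow_one, Nat.abs_cast]; exact h.m_le)

end Small
end Inst

/-! ### Evaluating the objective -/

def modExpr (e f : Expr) : Expr := .sub e (.mul (.div e f) f)

theorem modExpr_eval (e f : Expr) (s : Machine) :
    (modExpr e f).eval s = e.eval s % f.eval s := by
  simp only [modExpr, Expr.eval, Int.emod_def]; ring

theorem Expr.eval_get {s : Machine} {a j : ℕ} {idx : Expr} (h : idx.eval s = j) :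
    (Expr.get a idx).eval s = s.arr a j := by
  simp [Expr.eval, h]

theorem Expr.eval_mul (s : Machine) (e f : Expr) :
    (Expr.mul e f).eval s = e.eval s * f.eval s := rfl

theorem Expr.eval_sub (s : Machine) (e f : Expr) :
    (Expr.sub e f).eval s = e.eval s - f.eval s := rfl

theorem Expr.eval_div (s : Machine) (e f : Expr) :
    (Expr.div e f).eval s = e.eval s / f.eval s := rfl

/-- The square of register `1`. -/
def exprMM : Expr := .mul (.reg 1) (.reg 1)

def exprMatIdx : Expr := .add (.mul (.reg 11) exprMM) (.reg 10)

def exprMat : Expr :=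
  .mul (.sub (.get 4 (.reg 11)) (.get 3 (.reg 11)))
    (.mul (.get 0 exprMatIdx) (.div (.reg 3) (.get 1 exprMatIdx)))

def exprGram : Expr :=
  .mul (.get 6 (.add (.mul (.reg 11) (.reg 1)) (.div (.reg 10) (.reg 1))))
    (.get 6 (.add (.mul (.reg 11) (.reg 1)) (modExpr (.reg 10) (.reg 1))))

def exprPow : Expr :=
  .mul (.get 7 (.add (.mul (.div (.reg 10) (.reg 1)) (.reg 1)) (.reg 11)))
    (.get 7 (.add (.mul (.reg 11) (.reg 1)) (modExpr (.reg 10) (.reg 1))))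

def exprDiag : Expr :=
  .get 7 (.add (.mul (.reg 1) exprMM) (.add (.mul (.reg 11) (.reg 1)) (.reg 11)))

def exprLin : Expr := .mul (.get 5 (.reg 11)) (.sub (.get 4 (.reg 11)) (.get 3 (.reg 11)))

def matLoop : Program := fillLoop exprMM (.reg 0) exprMat 6 (.reg 10)

def gramLoop : Program := fillLoop exprMM (.reg 1) exprGram 7 (.reg 10)

/-- Array 7 holds the powers in consecutive blocks of m² entries. Place m² + t is computed from its
row in the preceding block, which is the row containing place t, and from a column of block 0. -/
def powLoop : Program :=
  fillLoop (.mul (.reg 1) exprMM) (.reg 1) exprPow 7 (.add exprMM (.reg 10))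

/-- Register `9` receives the objective at the difference of arrays `4` and `3`. -/
def evalProgram : Program :=
  .comp matLoop <| .comp gramLoop <| .comp powLoop <| .comp (sumLoop 11 12 (.reg 1) exprDiag) <|
  .comp (.assign 9 (.mul (.mul (.mul (.const 16) (.reg 5)) (.reg 2)) (.reg 12))) <|
  .comp (sumLoop 11 12 (.reg 0) exprLin) <|
  .assign 9 (.sub (.reg 9) (.mul (.mul (.const 8) (.reg 6)) (.reg 12)))

def evalWeight (n m : ℕ) : ℕ :=
  fillWeight exprMM (.reg 0) exprMat (.reg 10) (m * m) n +
  fillWeight exprMM (.reg 1) exprGram (.reg 10) (m * m) m +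
  fillWeight (.mul (.reg 1) exprMM) (.reg 1) exprPow (.add exprMM (.reg 10)) (m * (m * m)) m +
  sumWeight (.reg 1) exprDiag m + sumWeight (.reg 0) exprLin n + 200

/-- The permanent registers and arrays during a round. -/
structure RoundState (I : Inst) (a : ℕ) (Q : ℤ) (y w g : ℕ → ℤ) (s : Machine) : Prop where
  reg0 : s.reg 0 = I.n
  reg1 : s.reg 1 = I.m
  reg2 : s.reg 2 = I.N
  reg3 : s.reg 3 = I.D
  reg5 : s.reg 5 = a
  reg6 : s.reg 6 = Q
  arr0 : s.arr 0 = I.num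
  arr1 : s.arr 1 = I.den
  arr3 : s.arr 3 = y
  arr4 : s.arr 4 = w
  arr5 : s.arr 5 = g

/-- `s'` agrees with `s` on the registers below `r`, the arrays below `a` and the tape. -/
structure Machine.Agree (r a : ℕ) (s s' : Machine) : Prop where
  reg : ∀ i < r, s'.reg i = s.reg i
  arr : ∀ i < a, s'.arr i = s.arr i
  tape : s'.tape = s.tape

theorem Machine.Agree.trans {r a : ℕ} {s s' s'' : Machine} (h : s.Agree r a s')
    (h' : s'.Agree r a s'') : s.Agree r a s'' :=
  ⟨fun i hi => (h'.reg i hi).trans (h.reg i hi), fun i hi => (h'.arr i hi).trans (h.arr i hi),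
    h'.tape.trans h.tape⟩

theorem RoundState.of_agree {I : Inst} {a : ℕ} {Q : ℤ} {y w g : ℕ → ℤ} {s s' : Machine}
    (h : RoundState I a Q y w g s) (hs : s.Agree 7 6 s') : RoundState I a Q y w g s' where
  reg0 := (hs.reg 0 (by norm_num)).trans h.reg0
  reg1 := (hs.reg 1 (by norm_num)).trans h.reg1
  reg2 := (hs.reg 2 (by norm_num)).trans h.reg2
  reg3 := (hs.reg 3 (by norm_num)).trans h.reg3
  reg5 := (hs.reg 5 (by norm_num)).trans h.reg5
  reg6 := (hs.reg 6 (by norm_num)).trans h.reg6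
  arr0 := (hs.arr 0 (by norm_num)).trans h.arr0
  arr1 := (hs.arr 1 (by norm_num)).trans h.arr1
  arr3 := (hs.arr 3 (by norm_num)).trans h.arr3
  arr4 := (hs.arr 4 (by norm_num)).trans h.arr4
  arr5 := (hs.arr 5 (by norm_num)).trans h.arr5

theorem Machine.Agree.mono {r a r' a' : ℕ} {s s' : Machine} (h : s.Agree r a s') (hr : r' ≤ r)
    (ha : a' ≤ a) : s.Agree r' a' s' :=
  ⟨fun i hi => h.reg i (by omega), fun i hi => h.arr i (by omega), h.tape⟩

section
variable {I : Inst} {b a : ℕ} {Q : ℤ} {y w g : ℕ → ℤ} {s : Machine}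

theorem runs_matLoop (hI : I.Small b) (hζ : ∀ i, |w i - y i| ≤ 2 * I.N)
    (hs : RoundState I a Q y w g s) :
    ∃ s', Runs (I.bits b) (fillWeight exprMM (.reg 0) exprMat (.reg 10) (I.m * I.m) I.n) matLoop
      s s' ∧ s.Agree 9 6 s' ∧ ∀ t < I.m * I.m, s'.arr 6 t = I.mat (fun i => w i - y i) t := by
  obtain ⟨k, v, h⟩ := Runs.fillLoop (B := I.bits b) (N := I.m * I.m) (M := I.n) (a := 6) (o := 0)
    (bnd := exprMM) (bnd' := .reg 0) (e := exprMat) (idx := .reg 10) (s := s)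
    (fun t i => (w i - y i) * (I.num (i * (I.m * I.m) + t) * (I.D / I.den (i * (I.m * I.m) + t))))
    (I.mat fun i => w i - y i) (s.arr 6) (by simp) (by intro t _; rw [zero_add]; rfl)
    (by
      intro t _ k _ v
      rw [exprMat, Expr.eval_mul, Expr.eval_sub, Expr.eval_mul, Expr.eval_div,
        Expr.eval_get (j := k),
        Expr.eval_get (j := k), Expr.eval_get (j := k * (I.m * I.m) + t),
        Expr.eval_get (j := k * (I.m * I.m) + t)]
      · simp [Expr.eval, hs.reg3, hs.arr0, hs.arr1, hs.arr3, hs.arr4]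
      all_goals simp [Expr.eval, exprMatIdx, exprMM, hs.reg1])
    (by intros; simp [Expr.eval, hs.reg0])
    (by intros; simp [Expr.eval])
    (by intros; simp [Expr.eval, exprMM, hs.reg1])
    (hI.bitLen_le hI.abs_mm_le (by omega)) hI.bitLen_n
    (by
      intro t _ k hk
      exact hI.bitLen_le (abs_sum_range_le_pow hI.n_le hk fun i _ => hI.abs_mat_term_le hζ i _)
        (by omega))
  refine ⟨_, h, ⟨fun i hi => ?_, fun i hi => ?_, by simp⟩, fun t ht => ?_⟩
  · simp only [Machine.setReg_reg, Machine.setArr_reg]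
    rw [if_neg (by omega), if_neg (by omega), if_neg (by omega)]
  · simp only [Machine.setReg_arr, Machine.setArr_arr]
    rw [if_neg (by omega)]
  · simp [fillTo, ht]

theorem runs_gramLoop (hI : I.Small b) (hζ : ∀ i, |w i - y i| ≤ 2 * I.N)
    (hs : RoundState I a Q y w g s)
    (hmat : ∀ t < I.m * I.m, s.arr 6 t = I.mat (fun i => w i - y i) t) :
    ∃ s', Runs (I.bits b) (fillWeight exprMM (.reg 1) exprGram (.reg 10) (I.m * I.m) I.m) gramLoop
      s s' ∧ s.Agree 9 6 s' ∧ s'.arr 7 = fillTo (fun u => I.gramPow (fun i => w i - y i)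
        (u / (I.m * I.m)) (u / I.m % I.m) (u % I.m)) (I.m * I.m) (s.arr 7) := by
  have hdiv : ∀ t < I.m * I.m, t / I.m < I.m := fun t ht => Nat.div_lt_of_lt_mul ht
  have hmod : ∀ t < I.m * I.m, t % I.m < I.m := fun t ht =>
    Nat.mod_lt _ (Nat.pos_of_ne_zero fun h => by simp [h] at ht)
  have hidx : ∀ k < I.m, ∀ r < I.m, k * I.m + r < I.m * I.m := fun k hk r hr => by
    calc k * I.m + r < k * I.m + I.m := by omega
      _ = (k + 1) * I.m := by ring
      _ ≤ I.m * I.m := Nat.mul_le_mul_right _ hk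
  obtain ⟨k, v, h⟩ := Runs.fillLoop (B := I.bits b) (N := I.m * I.m) (M := I.m) (a := 7) (o := 0)
    (bnd := exprMM) (bnd' := .reg 1) (e := exprGram) (idx := .reg 10) (s := s)
    (fun t k => I.mat (fun i => w i - y i) (k * I.m + t / I.m) *
      I.mat (fun i => w i - y i) (k * I.m + t % I.m))
    (fun u => I.gramPow (fun i => w i - y i) (u / (I.m * I.m)) (u / I.m % I.m) (u % I.m))
    (s.arr 7) (by simp)
    (by
      intro t ht
      rw [zero_add, Nat.div_eq_of_lt ht, Nat.mod_eq_of_lt (hdiv t ht)]; rfl)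
    (by
      intro t ht k hk v
      rw [exprGram, Expr.eval_mul, Expr.eval_get (j := k * I.m + t / I.m),
        Expr.eval_get (j := k * I.m + t % I.m)]
      · simp [hmat _ (hidx k hk _ (hdiv t ht)), hmat _ (hidx k hk _ (hmod t ht))]
      · rw [Expr.eval, modExpr_eval]; simp [Expr.eval, hs.reg1]
      · simp [Expr.eval, hs.reg1])
    (by intros; simp [Expr.eval, hs.reg1])
    (by intros; simp [Expr.eval])
    (by intros; simp [Expr.eval, exprMM, hs.reg1])
    (hI.bitLen_le hI.abs_mm_le (by omega)) hI.bitLen_m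
    (by
      intro t _ k hk
      exact hI.bitLen_le (j := 9) (abs_sum_range_le_pow hI.m_le hk fun i _ =>
        abs_mul_le_pow (j := 4) (k := 4) (hI.abs_mat_le hζ _) (hI.abs_mat_le hζ _)) (by omega))
  refine ⟨_, h, ⟨fun i hi => ?_, fun i hi => ?_, by simp⟩, by simp⟩
  · simp only [Machine.setReg_reg, Machine.setArr_reg]
    rw [if_neg (by omega), if_neg (by omega), if_neg (by omega)]
  · simp only [Machine.setReg_arr, Machine.setArr_arr]
    rw [if_neg (by omega)]

theorem runs_powLoop (hI : I.Small b) (hζ : ∀ i, |w i - y i| ≤ 2 * I.N)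
    (hs : RoundState I a Q y w g s) {f₀ : ℕ → ℤ}
    (harr : s.arr 7 = fillTo (fun u => I.gramPow (fun i => w i - y i)
        (u / (I.m * I.m)) (u / I.m % I.m) (u % I.m)) (I.m * I.m) f₀) :
    ∃ s', Runs (I.bits b) (fillWeight (.mul (.reg 1) exprMM) (.reg 1) exprPow
        (.add exprMM (.reg 10)) (I.m * (I.m * I.m)) I.m) powLoop
      s s' ∧ s.Agree 9 6 s' ∧ ∀ t < I.m,
        s'.arr 7 (I.m * (I.m * I.m) + (t * I.m + t)) =
          I.gramPow (fun i => w i - y i) I.m t t := by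
  have hidx : ∀ k < I.m, ∀ r < I.m, k * I.m + r < I.m * I.m := fun k hk r hr => by
    calc k * I.m + r < k * I.m + I.m := by omega
      _ = (k + 1) * I.m := by ring
      _ ≤ I.m * I.m := Nat.mul_le_mul_right _ hk
  obtain ⟨k, v, h⟩ := Runs.fillLoop (B := I.bits b) (N := I.m * (I.m * I.m)) (M := I.m) (a := 7)
    (o := I.m * I.m)
    (bnd := .mul (.reg 1) exprMM) (bnd' := .reg 1) (e := exprPow) (idx := .add exprMM (.reg 10))
    (s := s)
    (fun u k => I.gramPow (fun i => w i - y i) (u / (I.m * I.m)) (u / I.m % I.m) k *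
      I.gram (fun i => w i - y i) k (u % I.m))
    (fun u => I.gramPow (fun i => w i - y i) (u / (I.m * I.m)) (u / I.m % I.m) (u % I.m))
    f₀ harr
    (by
      intro t ht
      have hm : 0 < I.m := Nat.pos_of_ne_zero fun h => by simp [h] at ht
      have e1 : (I.m * I.m + t) / (I.m * I.m) = t / (I.m * I.m) + 1 := by
        rw [Nat.add_div_left _ (by positivity)]
      have e2 : (I.m * I.m + t) / I.m % I.m = t / I.m % I.m := by
        rw [Nat.mul_add_div hm, Nat.add_mod_left]
      have e3 : (I.m * I.m + t) % I.m = t % I.m := by rw [Nat.mul_add_mod]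
      simp only [e1, e2, e3, Inst.gramPow])
    (by
      intro t ht k hk v
      have hm : 0 < I.m := by omega
      rw [exprPow, Expr.eval_mul, Expr.eval_get (j := t / I.m * I.m + k),
        Expr.eval_get (j := k * I.m + t % I.m)]
      · have hlt1 : t / I.m * I.m + k < I.m * I.m + t := by
          have := Nat.div_mul_le_self t I.m
          have : I.m ≤ I.m * I.m := Nat.le_mul_of_pos_left _ hm
          omega
        have hlt0 := hidx k hk _ (Nat.mod_lt t hm)
        have hlt2 : k * I.m + t % I.m < I.m * I.m + t := by omega
        have e1 : (t / I.m * I.m + k) / I.m = t / I.m := by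
          rw [mul_comm, Nat.mul_add_div hm, Nat.div_eq_of_lt hk, add_zero]
        have e2 : (t / I.m * I.m + k) % I.m = k := by
          rw [mul_comm, Nat.mul_add_mod, Nat.mod_eq_of_lt hk]
        have e3 : (t / I.m * I.m + k) / (I.m * I.m) = t / (I.m * I.m) := by
          rw [← Nat.div_div_eq_div_mul, e1, Nat.div_div_eq_div_mul]
        have e4 : (k * I.m + t % I.m) / I.m = k := by
          rw [mul_comm, Nat.mul_add_div hm, Nat.div_eq_of_lt (Nat.mod_lt _ hm), add_zero]
        have e5 : (k * I.m + t % I.m) % I.m = t % I.m := by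
          rw [mul_comm, Nat.mul_add_mod, Nat.mod_mod]
        have e6 : (k * I.m + t % I.m) / (I.m * I.m) = 0 := Nat.div_eq_of_lt hlt0
        simp only [Machine.setReg_arr, Machine.setArr_arr, if_true, fillTo, if_pos hlt1,
          if_pos hlt2, e1, e2, e3, e4, e5, e6, Nat.mod_eq_of_lt hk, Inst.gramPow]
      · rw [Expr.eval, modExpr_eval]; simp [Expr.eval, hs.reg1]
      · simp [Expr.eval, hs.reg1])
    (by intros; simp [Expr.eval, hs.reg1])
    (by intros; simp [Expr.eval, exprMM, hs.reg1])
    (by intros; simp [Expr.eval, exprMM, hs.reg1])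
    (hI.bitLen_le (j := 3) (by
      push_cast
      have := abs_mul_le_pow (x := I.m) (j := 1) (by rw [pow_one, Nat.abs_cast]; exact hI.m_le)
        hI.abs_mm_le
      push_cast at this; exact this) (by omega)) hI.bitLen_m
    (by
      intro t ht k hk
      refine hI.bitLen_le (abs_sum_range_le_pow hI.m_le hk fun i _ =>
        abs_mul_le_pow (hI.abs_gramPow_le hζ _ _ _) (hI.abs_gram_le hζ _ _)) ?_
      have : t / (I.m * I.m) < I.m := Nat.div_lt_of_lt_mul (by rwa [mul_comm])
      omega)
  refine ⟨_, h, ⟨fun i hi => ?_, fun i hi => ?_, by simp⟩, fun t ht => ?_⟩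
  · simp only [Machine.setReg_reg, Machine.setArr_reg]
    rw [if_neg (by omega), if_neg (by omega), if_neg (by omega)]
  · simp only [Machine.setReg_arr, Machine.setArr_arr]
    rw [if_neg (by omega)]
  · have hm : 0 < I.m := by omega
    have h0 := hidx t ht t ht
    have hlt : I.m * (I.m * I.m) + (t * I.m + t) < I.m * I.m + I.m * (I.m * I.m) := by omega
    have e1 : (I.m * (I.m * I.m) + (t * I.m + t)) / (I.m * I.m) = I.m := by
      rw [mul_comm I.m (I.m * I.m), Nat.mul_add_div (by positivity), Nat.div_eq_of_lt h0, add_zero]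
    have e2 : (I.m * (I.m * I.m) + (t * I.m + t)) % I.m = t := by
      rw [Nat.mul_add_mod, mul_comm, Nat.mul_add_mod, Nat.mod_eq_of_lt ht]
    have e3 : (I.m * (I.m * I.m) + (t * I.m + t)) / I.m % I.m = t := by
      rw [Nat.mul_add_div hm, Nat.mul_add_mod, mul_comm t, Nat.mul_add_div hm, Nat.div_eq_of_lt ht,
        add_zero, Nat.mod_eq_of_lt ht]
    simp only [Machine.setReg_arr, Machine.setArr_arr, if_true, fillTo, if_pos hlt, e1, e2, e3]

end
end
-- Size of the objective and definition of the local search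
noncomputable section

namespace Inst
variable {I : Inst} {b : ℕ}

theorem Small.abs_trace_le (h : I.Small b) {ζ : ℕ → ℤ} (hζ : ∀ i, |ζ i| ≤ 2 * I.N) {k : ℕ}
    (hk : k ≤ I.m) :
    |∑ t ∈ Finset.range k, I.gramPow ζ I.m t t| ≤ (2 ^ b) ^ (10 * I.m + 10) :=
  abs_sum_range_le_pow h.m_le hk fun _ _ => h.abs_gramPow_le hζ _ _ _

theorem Small.abs_lin_le (h : I.Small b) {g ζ : ℕ → ℤ} (hζ : ∀ i, |ζ i| ≤ 2 * I.N)
    (hg : ∀ i, |g i| ≤ 1) {k : ℕ} (hk : k ≤ I.n) :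
    |∑ i ∈ Finset.range k, g i * ζ i| ≤ (2 ^ b) ^ 3 :=
  abs_sum_range_le_pow h.n_le hk fun i _ =>
    abs_mul_le_pow (j := 0) (k := 2) (by simpa using hg i) (h.abs_zeta_le hζ i)

theorem Small.abs_first_le (h : I.Small b) {ζ : ℕ → ℤ} (hζ : ∀ i, |ζ i| ≤ 2 * I.N) {a : ℕ}
    (ha : a ≤ I.n) :
    |16 * a * I.N * ∑ t ∈ Finset.range I.m, I.gramPow ζ I.m t t| ≤ (2 ^ b) ^ (10 * I.m + 13) := by
  have h1 : |(16 : ℤ)| ≤ (2 ^ b) ^ 1 := by rw [pow_one]; exact h.T_ge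
  have h2 : |(a : ℤ)| ≤ (2 ^ b) ^ 1 := by
    rw [pow_one, Nat.abs_cast]
    have : (a : ℤ) ≤ I.n := by exact_mod_cast ha
    linarith [h.n_le]
  have h3 : |(I.N : ℤ)| ≤ (2 ^ b) ^ 1 := by rw [pow_one, Nat.abs_cast]; exact h.N_le
  have := abs_mul_le_pow (abs_mul_le_pow (abs_mul_le_pow h1 h2) h3) (h.abs_trace_le hζ le_rfl)
  rwa [show 1 + 1 + 1 + (10 * I.m + 10) = 10 * I.m + 13 by ring] at this

theorem Small.abs_second_le (h : I.Small b) {g ζ : ℕ → ℤ} (hζ : ∀ i, |ζ i| ≤ 2 * I.N)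
    (hg : ∀ i, |g i| ≤ 1) {Q : ℤ} (hQ : |Q| ≤ (2 ^ b) ^ (8 * I.m + 8)) :
    |8 * Q * ∑ i ∈ Finset.range I.n, g i * ζ i| ≤ (2 ^ b) ^ (10 * I.m + 13) := by
  have h1 : |(8 : ℤ)| ≤ (2 ^ b) ^ 1 := by
    rw [pow_one]; have := h.T_ge; norm_num; linarith
  refine (abs_mul_le_pow (abs_mul_le_pow h1 hQ) (h.abs_lin_le hζ hg le_rfl)).trans ?_
  exact pow_le_pow_right₀ h.one_le_T (by omega)

theorem Small.abs_objective_le (h : I.Small b) {g ζ : ℕ → ℤ} (hζ : ∀ i, |ζ i| ≤ 2 * I.N)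
    (hg : ∀ i, |g i| ≤ 1) {Q : ℤ} (hQ : |Q| ≤ (2 ^ b) ^ (8 * I.m + 8)) {a : ℕ} (ha : a ≤ I.n) :
    |I.objective a Q g ζ| ≤ (2 ^ b) ^ (10 * I.m + 14) := by
  rw [objective]
  refine (abs_sub _ _).trans ((add_le_add (h.abs_first_le hζ ha) (h.abs_second_le hζ hg hQ)).trans ?_)
  rw [show 10 * I.m + 14 = (10 * I.m + 13) + 1 by ring, pow_succ _ (10 * I.m + 13)]
  have : (0 : ℤ) ≤ (2 ^ b) ^ (10 * I.m + 13) := by positivity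
  nlinarith [h.T_ge]

variable (I)

/-- The indicator of `|v| < N`, for `|v| ≤ N`. -/
def aliveInd (v : ℤ) : ℤ := 1 - v * v / (I.N * I.N)

/-- Together with `moveSign`, this runs cyclically through all pairs of a coordinate and a sign,
with period 2n. -/
def moveIdx (v : ℕ) : ℕ := v / 2 % I.n

def moveSign (v : ℕ) : ℤ := 1 - 2 * ((v % 2 : ℕ) : ℤ)

/-- The state after trying the move with number `v`. -/
def attempt (a : ℕ) (Q : ℤ) (y g w : ℕ → ℤ) (v : ℕ) : ℕ → ℤ :=
  let w' := Function.update w (I.moveIdx v) (w (I.moveIdx v) + moveSign v)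
  -- One positivity test for two conditions: the coordinate was alive at the start of the round, and
  -- the new value stays in [-N, N]. A move must also gain at least Q, which is 1 / (8N) in units of
  -- the penalty.
  if 0 < I.aliveInd (y (I.moveIdx v)) *
      (I.N * I.N + 1 - (w (I.moveIdx v) + moveSign v) * (w (I.moveIdx v) + moveSign v)) ∧
    I.objective a Q g (fun i => w' i - y i) + Q ≤ I.objective a Q g (fun i => w i - y i)
  then w' else w

def search (a : ℕ) (Q : ℤ) (y g : ℕ → ℤ) : ℕ → ℕ → ℤ
  | 0 => y
  | v + 1 => I.attempt a Q y g (search a Q y g v) v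

theorem aliveInd_nonneg_le {v : ℤ} (hv : |v| ≤ I.N) : 0 ≤ I.aliveInd v ∧ I.aliveInd v ≤ 1 := by
  rw [aliveInd]
  have h1 : v * v ≤ I.N * I.N := by
    rw [← abs_mul_abs_self]; exact mul_self_le_mul_self (abs_nonneg _) hv
  have h2 : 0 ≤ v * v / (I.N * I.N) := Int.ediv_nonneg (mul_self_nonneg _) (mul_self_nonneg _)
  have h3 : v * v / (I.N * I.N) ≤ 1 := by
    rcases Nat.eq_zero_or_pos I.N with h0 | h0
    · simp [h0]
    · exact Int.ediv_le_of_le_mul (by positivity) (by linarith)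
  constructor <;> linarith

end Inst
end
-- Running time and correctness of the evaluation of the objective
noncomputable section

theorem Expr.eval_add (s : Machine) (e f : Expr) :
    (Expr.add e f).eval s = e.eval s + f.eval s := rfl

section
variable {I : Inst} {b a : ℕ} {Q : ℤ} {y w g : ℕ → ℤ} {s : Machine}

theorem runs_evalProgram (hI : I.Small b) (hζ : ∀ i, |w i - y i| ≤ 2 * I.N)
    (hg : ∀ i, |g i| ≤ 1) (hQ : |Q| ≤ (2 ^ b) ^ (8 * I.m + 8)) (ha : a ≤ I.n)
    (hs : RoundState I a Q y w g s) :
    ∃ s', Runs (I.bits b) (evalWeight I.n I.m) evalProgram s s' ∧ s.Agree 9 6 s' ∧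
      s'.reg 9 = I.objective a Q g (fun i => w i - y i) := by
  obtain ⟨s1, r1, a1, h1⟩ := runs_matLoop hI hζ hs
  have hs1 := hs.of_agree (a1.mono (by norm_num) le_rfl)
  obtain ⟨s2, r2, a2, h2⟩ := runs_gramLoop hI hζ hs1 h1
  have hs2 := hs1.of_agree (a2.mono (by norm_num) le_rfl)
  obtain ⟨s3, r3, a3, h3⟩ := runs_powLoop hI hζ hs2 h2
  have hs3 := hs2.of_agree (a3.mono (by norm_num) le_rfl)
  have r4 := Runs.sumLoop (B := I.bits b) (N := I.m) (k := 11) (acc := 12) (bnd := .reg 1)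
    (e := exprDiag) (s := s3) (by norm_num) (fun t => I.gramPow (fun i => w i - y i) I.m t t)
    (by
      intro t ht v
      rw [exprDiag, Expr.eval_get (j := I.m * (I.m * I.m) + (t * I.m + t))]
      · simp [h3 t ht]
      · simp [Expr.eval, exprMM, hs3.reg1])
    (by intros; simp [Expr.eval, hs3.reg1]) hI.bitLen_m
    (fun t ht => hI.bitLen_le (hI.abs_trace_le hζ ht) (by omega))
  set s4 := (s3.setReg 12 (∑ t ∈ Finset.range I.m, I.gramPow (fun i => w i - y i) I.m t t)).setReg
    11 I.m with hs4def
  have a4 : s3.Agree 9 6 s4 := ⟨fun i hi => by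
    simp only [hs4def, Machine.setReg_reg]; rw [if_neg (by omega), if_neg (by omega)],
    fun i _ => rfl, rfl⟩
  have hs4 := hs3.of_agree (a4.mono (by norm_num) le_rfl)
  have r5 := Runs.assign (B := I.bits b) (s := s4) (r := 9)
    (e := .mul (.mul (.mul (.const 16) (.reg 5)) (.reg 2)) (.reg 12))
    (v := 16 * a * I.N * ∑ t ∈ Finset.range I.m, I.gramPow (fun i => w i - y i) I.m t t)
    (by simp only [Expr.eval, hs4.reg5, hs4.reg2]; simp [hs4def])
    (hI.bitLen_le (hI.abs_first_le hζ ha) (by omega))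
  set s5 := s4.setReg 9
    (16 * a * I.N * ∑ t ∈ Finset.range I.m, I.gramPow (fun i => w i - y i) I.m t t) with hs5def
  have a5 : s4.Agree 9 6 s5 := ⟨fun i hi => by
    simp only [hs5def, Machine.setReg_reg]; rw [if_neg (by omega)], fun i _ => rfl, rfl⟩
  have hs5 := hs4.of_agree (a5.mono (by norm_num) le_rfl)
  have r6 := Runs.sumLoop (B := I.bits b) (N := I.n) (k := 11) (acc := 12) (bnd := .reg 0)
    (e := exprLin) (s := s5) (by norm_num) (fun i => g i * (w i - y i))
    (by
      intro t ht v
      rw [exprLin, Expr.eval_mul, Expr.eval_sub, Expr.eval_get (j := t), Expr.eval_get (j := t),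
        Expr.eval_get (j := t)]
      · simp [hs5.arr3, hs5.arr4, hs5.arr5]
      all_goals simp [Expr.eval])
    (by intros; simp [Expr.eval, hs5.reg0]) hI.bitLen_n
    (fun t ht => hI.bitLen_le (hI.abs_lin_le hζ hg ht) (by omega))
  set s6 := (s5.setReg 12 (∑ i ∈ Finset.range I.n, g i * (w i - y i))).setReg 11 I.n with hs6def
  have a6 : s5.Agree 9 6 s6 := ⟨fun i hi => by
    simp only [hs6def, Machine.setReg_reg]; rw [if_neg (by omega), if_neg (by omega)],
    fun i _ => rfl, rfl⟩
  have hs6 := hs5.of_agree (a6.mono (by norm_num) le_rfl)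
  have r7 := Runs.assign (B := I.bits b) (s := s6) (r := 9)
    (e := .sub (.reg 9) (.mul (.mul (.const 8) (.reg 6)) (.reg 12)))
    (v := I.objective a Q g (fun i => w i - y i))
    (by
      simp only [Expr.eval, hs6.reg6]
      simp [hs6def, hs5def, Inst.objective])
    (hI.bitLen_le (hI.abs_objective_le hζ hg hQ ha) (by omega))
  set s7 := s6.setReg 9 (I.objective a Q g (fun i => w i - y i)) with hs7def
  have a7 : s6.Agree 9 6 s7 := ⟨fun i hi => by
    simp only [hs7def, Machine.setReg_reg]; rw [if_neg (by omega)], fun i _ => rfl, rfl⟩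
  refine ⟨s7, (r1.comp (r2.comp (r3.comp (r4.comp (r5.comp (r6.comp r7)))))).mono ?_,
    a1.trans (a2.trans (a3.trans (a4.trans (a5.trans (a6.trans a7))))), by simp [hs7def]⟩
  have e16 : bitLen 16 = 5 := by decide
  have e8 : bitLen 8 = 4 := by decide
  simp only [evalWeight, Expr.weight, Expr.width, e16, e8]
  omega

end

/-! ### Local search -/

def exprMoveIdx : Expr := modExpr (.div (.reg 8) (.const 2)) (.reg 0)

def exprMoveSign : Expr := .sub (.const 1) (.mul (.const 2) (modExpr (.reg 8) (.const 2)))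

def exprMove : Expr := .add (.get 4 exprMoveIdx) exprMoveSign

def exprNN : Expr := .mul (.reg 2) (.reg 2)

/-- The indicator of an alive coordinate. -/
def exprAlive (e : Expr) : Expr := .sub (.const 1) (.div (.mul e e) exprNN)

/-- The move is carried out in place before the evaluation and undone if rejected. Register 7 caches
the objective at the current point. -/
def attemptProgram : Program :=
  .branch (.mul (exprAlive (.get 3 exprMoveIdx))
      (.sub (.add exprNN (.const 1)) (.mul exprMove exprMove)))
    (.comp (.store 4 exprMoveIdx exprMove) <| .comp evalProgram <|
      .branch (.sub (.add (.reg 7) (.const 1)) (.add (.reg 9) (.reg 6))) (.assign 7 (.reg 9))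
        (.store 4 exprMoveIdx (.sub (.get 4 exprMoveIdx) exprMoveSign)))
    .skip

def attemptWeight (n m : ℕ) : ℕ := evalWeight n m + 1000

/-- The state between two moves. -/
structure SearchState (I : Inst) (a : ℕ) (Q : ℤ) (y w g : ℕ → ℤ) (v : ℕ) (s₀ s : Machine) : Prop
    extends RoundState I a Q y w g s where
  reg7 : s.reg 7 = I.objective a Q g (fun i => w i - y i)
  reg8 : s.reg 8 = v
  reg4 : s.reg 4 = s₀.reg 4
  tape : s.tape = s₀.tape

section
variable {I : Inst} {b a v : ℕ} {Q : ℤ} {y w g : ℕ → ℤ} {s₀ s : Machine}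

theorem eval_exprMoveIdx (h0 : s.reg 0 = I.n) (h8 : s.reg 8 = v) :
    exprMoveIdx.eval s = (I.moveIdx v : ℕ) := by
  rw [exprMoveIdx, modExpr_eval, Inst.moveIdx]
  simp [Expr.eval, h0, h8]

theorem eval_exprMoveSign (h8 : s.reg 8 = v) : exprMoveSign.eval s = Inst.moveSign v := by
  rw [exprMoveSign, Expr.eval_sub, Expr.eval_mul, modExpr_eval, Inst.moveSign]
  simp [Expr.eval, h8]

theorem eval_exprMove (h0 : s.reg 0 = I.n) (h8 : s.reg 8 = v) :
    exprMove.eval s = s.arr 4 (I.moveIdx v) + Inst.moveSign v := by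
  rw [exprMove, Expr.eval_add, Expr.eval_get (eval_exprMoveIdx h0 h8), eval_exprMoveSign h8]

theorem eval_exprAlive {e : Expr} (h2 : s.reg 2 = I.N) :
    (exprAlive e).eval s = I.aliveInd (e.eval s) := by
  simp [exprAlive, exprNN, Expr.eval, h2, Inst.aliveInd]

theorem Inst.abs_le_of_mul_self_lt {N : ℕ} {x : ℤ} (h : x * x < N * N + 1) : |x| ≤ N := by
  refine abs_le_of_sq_le_sq ?_ (Nat.cast_nonneg N)
  nlinarith

theorem Inst.abs_attempt_le (hw : ∀ i, |w i| ≤ I.N) (hy : ∀ i, |y i| ≤ I.N) (v i : ℕ) :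
    |I.attempt a Q y g w v i| ≤ I.N := by
  rw [attempt]
  split_ifs with h
  · rw [Function.update_apply]
    split_ifs
    · have h1 := I.aliveInd_nonneg_le (hy (I.moveIdx v))
      have h2 := pos_of_mul_pos_right h.1 h1.1
      exact Inst.abs_le_of_mul_self_lt (by linarith)
    · exact hw i
  · exact hw i

theorem runs_attempt (hI : I.Small b) (hw : ∀ i, |w i| ≤ I.N) (hy : ∀ i, |y i| ≤ I.N)
    (hg : ∀ i, |g i| ≤ 1) (hQ : |Q| ≤ (2 ^ b) ^ (8 * I.m + 8)) (ha : a ≤ I.n)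
    (hs : SearchState I a Q y w g v s₀ s) :
    ∃ s', Runs (I.bits b) (attemptWeight I.n I.m) attemptProgram s s' ∧
      SearchState I a Q y (I.attempt a Q y g w v) g v s₀ s' := by
  have hzeta : ∀ x : ℕ → ℤ, (∀ i, |x i| ≤ I.N) → ∀ i, |x i - y i| ≤ 2 * I.N := by
    intro x hx i
    have := abs_sub (x i) (y i)
    have := hx i
    have := hy i
    linarith
  have e1 : bitLen 1 = 1 := by decide
  have e2 : bitLen 2 = 2 := by decide
  set i := I.moveIdx v with hi
  set σ := Inst.moveSign v with hσ
  have hcond : (Expr.mul (exprAlive (.get 3 exprMoveIdx))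
      (.sub (.add exprNN (.const 1)) (.mul exprMove exprMove))).eval s =
      I.aliveInd (y i) * (I.N * I.N + 1 - (w i + σ) * (w i + σ)) := by
    rw [Expr.eval_mul, eval_exprAlive hs.reg2, Expr.eval_get (eval_exprMoveIdx hs.reg0 hs.reg8),
      Expr.eval_sub, Expr.eval_mul, eval_exprMove hs.reg0 hs.reg8, hs.arr3, hs.arr4]
    simp [Expr.eval, exprNN, hs.reg2, ← hi, ← hσ]
  by_cases hc : 0 < I.aliveInd (y i) * (I.N * I.N + 1 - (w i + σ) * (w i + σ))
  · set w' := Function.update w i (w i + σ) with hw'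
    have hwσ : |w i + σ| ≤ I.N :=
      Inst.abs_le_of_mul_self_lt (by
        have := pos_of_mul_pos_right hc (I.aliveInd_nonneg_le (hy i)).1
        linarith)
    have hw'le : ∀ j, |w' j| ≤ I.N := by
      intro j
      rw [hw', Function.update_apply]
      split_ifs
      exacts [hwσ, hw j]
    have hbit : ∀ x : ℤ, |x| ≤ I.N → bitLen x ≤ I.bits b := fun x hx =>
      hI.bitLen_le (j := 1) (by rw [pow_one]; exact hx.trans hI.N_le) (by omega)
    have r1 := Runs.store (B := I.bits b) (a := 4) (idx := exprMoveIdx) (e := exprMove) (s := s)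
      (eval_exprMoveIdx hs.reg0 hs.reg8) (eval_exprMove hs.reg0 hs.reg8)
      (hbit _ (by rw [hs.arr4]; exact hwσ))
    rw [hs.arr4, ← hi, ← hσ, ← hw'] at r1
    set s1 := s.setArr 4 w' with hs1
    have st1 : RoundState I a Q y w' g s1 := by
      constructor <;> simp [hs1, hs.reg0, hs.reg1, hs.reg2, hs.reg3, hs.reg5, hs.reg6, hs.arr0,
        hs.arr1, hs.arr3, hs.arr5]
    obtain ⟨s2, r2, a2, h9⟩ := runs_evalProgram hI (hzeta w' hw'le) hg hQ ha st1
    have st2 := st1.of_agree (a2.mono (by norm_num) le_rfl)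
    have h7 : s2.reg 7 = I.objective a Q g (fun i => w i - y i) :=
      (a2.reg 7 (by norm_num)).trans hs.reg7
    have h8 : s2.reg 8 = v := (a2.reg 8 (by norm_num)).trans hs.reg8
    have h4 : s2.reg 4 = s₀.reg 4 := (a2.reg 4 (by norm_num)).trans hs.reg4
    have ht : s2.tape = s₀.tape := a2.tape.trans hs.tape
    have hev : (Expr.sub (.add (.reg 7) (.const 1)) (.add (.reg 9) (.reg 6))).eval s2 =
        I.objective a Q g (fun i => w i - y i) + 1 -
          (I.objective a Q g (fun i => w' i - y i) + Q) := by
      simp [Expr.eval, h7, h9, st2.reg6]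
    by_cases hacc : I.objective a Q g (fun i => w' i - y i) + Q ≤
        I.objective a Q g (fun i => w i - y i)
    · have hatt : I.attempt a Q y g w v = w' := if_pos ⟨hc, hacc⟩
      have r3 := Runs.assign (B := I.bits b) (r := 7) (e := .reg 9) (s := s2) h9
        (hI.bitLen_le (hI.abs_objective_le (hzeta w' hw'le) hg hQ ha) (by omega))
      refine ⟨_, (Runs.branch_pos (by rw [hcond]; exact hc) (r1.comp (r2.comp
        (Runs.branch_pos (by rw [hev]; omega) r3)))).mono ?_, ?_⟩
      · simp only [attemptWeight, Expr.weight, Expr.width, exprMove, exprMoveIdx, exprMoveSign,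
          modExpr, exprAlive, exprNN, e1, e2]
        omega
      · rw [hatt]
        constructor
        · constructor <;> simp [st2.reg0, st2.reg1, st2.reg2, st2.reg3, st2.reg5, st2.reg6,
            st2.arr0, st2.arr1, st2.arr3, st2.arr5, st2.arr4]
        all_goals simp [h8, h4, ht]
    · have hatt : I.attempt a Q y g w v = w := if_neg fun h => hacc h.2
      have r3 := Runs.store (B := I.bits b) (a := 4) (idx := exprMoveIdx)
        (e := .sub (.get 4 exprMoveIdx) exprMoveSign) (s := s2) (v := w i)
        (eval_exprMoveIdx st2.reg0 h8) (by
          rw [Expr.eval_sub, Expr.eval_get (eval_exprMoveIdx st2.reg0 h8), eval_exprMoveSign h8,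
            st2.arr4, hw', Function.update_self]
          ring) (hbit _ (hw i))
      have hback : Function.update (s2.arr 4) (I.moveIdx v) (w i) = w := by
        rw [st2.arr4, hw', ← hi, Function.update_idem, Function.update_eq_self]
      rw [hback] at r3
      refine ⟨_, (Runs.branch_pos (by rw [hcond]; exact hc) (r1.comp (r2.comp
        (Runs.branch_neg (by rw [hev]; omega) r3)))).mono ?_, ?_⟩
      · simp only [attemptWeight, Expr.weight, Expr.width, exprMove, exprMoveIdx, exprMoveSign,
          modExpr, exprAlive, exprNN, e1, e2]
        omega
      · rw [hatt]
        constructor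
        · constructor <;> simp [st2.reg0, st2.reg1, st2.reg2, st2.reg3, st2.reg5, st2.reg6,
            st2.arr0, st2.arr1, st2.arr3, st2.arr5]
        all_goals simp [h8, h4, ht, h7]
  · have hatt : I.attempt a Q y g w v = w := if_neg fun h => hc h.1
    refine ⟨s, (Runs.branch_neg (by rw [hcond]; exact not_lt.1 hc) Runs.skip).mono ?_, ?_⟩
    · simp only [attemptWeight, Expr.weight, Expr.width, exprMove, exprMoveIdx, exprMoveSign,
        modExpr, exprAlive, exprNN, e1, e2]
      omega
    · rw [hatt]; exact hs

/-- The number of moves tried in a round. -/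
def Inst.moves (I : Inst) : ℕ := 2 * I.n * (16 * (I.n * I.N) + 1)

def exprMoves : Expr :=
  .mul (.mul (.const 2) (.reg 0)) (.add (.mul (.const 16) (.mul (.reg 0) (.reg 2))) (.const 1))

def searchProgram : Program := forLoop 8 exprMoves attemptProgram

theorem Inst.abs_search_le (hy : ∀ i, |y i| ≤ I.N) (v i : ℕ) :
    |I.search a Q y g v i| ≤ I.N := by
  induction v generalizing i with
  | zero => exact hy i
  | succ v ih => exact Inst.abs_attempt_le ih hy v i

theorem Inst.Small.abs_moves_le (hI : I.Small b) : |(I.moves : ℤ)| ≤ (2 ^ b) ^ 5 := by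
  rw [Nat.abs_cast, Inst.moves]
  push_cast
  have hT := hI.T_ge
  have h0 : (0 : ℤ) ≤ I.n := Nat.cast_nonneg _
  have h0' : (0 : ℤ) ≤ I.N := Nat.cast_nonneg _
  set T : ℤ := 2 ^ b
  have h1 : (I.n : ℤ) * I.N ≤ T * T := mul_le_mul hI.n_le hI.N_le h0' (by linarith)
  have h2 : 16 * ((I.n : ℤ) * I.N) + 1 ≤ T ^ 3 * 2 := by nlinarith
  have h3 : 2 * (I.n : ℤ) ≤ T * 2 := by linarith [hI.n_le]
  calc 2 * (I.n : ℤ) * (16 * ((I.n : ℤ) * I.N) + 1) ≤ T * 2 * (T ^ 3 * 2) :=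
        mul_le_mul h3 h2 (by positivity) (by positivity)
    _ = 4 * T ^ 4 := by ring
    _ ≤ T * T ^ 4 := mul_le_mul_of_nonneg_right (by linarith) (by positivity)
    _ = T ^ 5 := by ring

theorem runs_search (hI : I.Small b) (hy : ∀ i, |y i| ≤ I.N)
    (hg : ∀ i, |g i| ≤ 1) (hQ : |Q| ≤ (2 ^ b) ^ (8 * I.m + 8)) (ha : a ≤ I.n)
    (hs : RoundState I a Q y y g s) (h7 : s.reg 7 = I.objective a Q g (fun _ => 0)) :
    ∃ s', Runs (I.bits b) (forWeight exprMoves I.moves (attemptWeight I.n I.m)) searchProgram s s' ∧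
      RoundState I a Q y (I.search a Q y g I.moves) g s' ∧ s'.reg 4 = s.reg 4 ∧
        s'.tape = s.tape := by
  obtain ⟨s', r, h⟩ := Runs.forLoop (B := I.bits b) (k := attemptWeight I.n I.m) (N := I.moves)
    (r := 8) (bnd := exprMoves) (p := attemptProgram) (s := s)
    (fun v s' => SearchState I a Q y (I.search a Q y g v) g v s s')
    (by
      constructor
      · constructor <;> simp [hs.reg0, hs.reg1, hs.reg2, hs.reg3, hs.reg5, hs.reg6,
            hs.arr0, hs.arr1, hs.arr3, hs.arr5, hs.arr4, Inst.search]
      all_goals simp [h7, Inst.search])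
    (fun v s' h => h.reg8)
    (fun v s' _ h => by simp [exprMoves, Expr.eval, h.reg0, h.reg2, Inst.moves])
    (fun v s' _ h => by
      obtain ⟨s'', r, h'⟩ := runs_attempt hI (Inst.abs_search_le hy v) hy hg hQ ha h
      refine ⟨s'', r, h'.reg8, ?_⟩
      constructor
      · constructor <;> simp [h'.reg0, h'.reg1, h'.reg2, h'.reg3, h'.reg5, h'.reg6,
            h'.arr0, h'.arr1, h'.arr3, h'.arr5, h'.arr4, Inst.search]
      · simp [h'.reg7, Inst.search]
      · simp
      · simp [h'.reg4]
      · simp [h'.tape])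
    (hI.bitLen_le hI.abs_moves_le (by omega))
  exact ⟨s', r, h.toRoundState, h.reg4, h.tape⟩

end
end
noncomputable section

/-! ### A round of the algorithm -/

namespace Inst
variable (I : Inst)

def aliveCount (y : ℕ → ℤ) : ℤ := ∑ i ∈ Finset.range I.n, I.aliveInd (y i)

def aliveNum (y : ℕ → ℤ) : ℕ := (I.aliveCount y).toNat

/-- An integer approximation of the logarithmic factor. -/
def ell (a : ℕ) : ℤ := 1 + ∑ j ∈ Finset.range I.m, (1 - 1 / ((I.m : ℤ) / (a * 2 ^ j) + 1))

/-- The square of N·D·Δ, where Δ² = c·a·ell is the squared norm bound of the round. Only even powers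
of Δ occur in the trace power, so the objective can be scaled to an integer although Δ may be
irrational. -/
def weightBase (a : ℕ) : ℤ := I.c * (I.N * I.N * (I.D * I.D * (a * I.ell a)))

def weight (a : ℕ) : ℤ := I.weightBase a ^ (I.m + 1)

/-- The coloring after one round that starts from `y` with the random signs `g`. -/
def round (y g : ℕ → ℤ) : ℕ → ℤ :=
  let w := I.search (I.aliveNum y) (I.weight (I.aliveNum y)) y g I.moves
  -- A round without enough progress is discarded, so that it costs no discrepancy.
  if (I.d : ℤ) * I.aliveCount w ≤ (I.d - 1) * I.aliveCount y then w else y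

end Inst

/-- The signs given by the first `n` bits. -/
def signs (n : ℕ) (t : List Bool) (i : ℕ) : ℤ :=
  if i < n then (if t.getD i false then 1 else -1) else 0

theorem abs_signs_le (n : ℕ) (t : List Bool) (i : ℕ) : |signs n t i| ≤ 1 := by
  rw [signs]; split_ifs <;> simp

namespace Inst
variable {I : Inst} {b a : ℕ} {y w g : ℕ → ℤ}

theorem abs_aliveSum_le (hy : ∀ i, |y i| ≤ I.N) (k : ℕ) :
    0 ≤ ∑ i ∈ Finset.range k, I.aliveInd (y i) ∧ ∑ i ∈ Finset.range k, I.aliveInd (y i) ≤ k := by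
  refine ⟨Finset.sum_nonneg fun i _ => (I.aliveInd_nonneg_le (hy i)).1, ?_⟩
  calc _ ≤ ∑ i ∈ Finset.range k, (1 : ℤ) :=
        Finset.sum_le_sum fun i _ => (I.aliveInd_nonneg_le (hy i)).2
    _ = k := by simp

theorem aliveNum_cast (hy : ∀ i, |y i| ≤ I.N) : (I.aliveNum y : ℤ) = I.aliveCount y :=
  Int.toNat_of_nonneg (abs_aliveSum_le hy _).1

theorem aliveNum_le (hy : ∀ i, |y i| ≤ I.N) : I.aliveNum y ≤ I.n := by
  have h1 := aliveNum_cast hy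
  have h2 : I.aliveCount y ≤ I.n := (abs_aliveSum_le hy _).2
  omega

theorem ell_term (a j : ℕ) : 0 ≤ 1 - 1 / ((I.m : ℤ) / (a * 2 ^ j) + 1) ∧
    1 - 1 / ((I.m : ℤ) / (a * 2 ^ j) + 1) ≤ 1 := by
  have h1 : (0 : ℤ) ≤ (I.m : ℤ) / (a * 2 ^ j) := Int.ediv_nonneg (by positivity) (by positivity)
  have h2 : (1 : ℤ) / ((I.m : ℤ) / (a * 2 ^ j) + 1) ≤ 1 := Int.ediv_le_self _ (by norm_num)
  have h3 : (0 : ℤ) ≤ 1 / ((I.m : ℤ) / (a * 2 ^ j) + 1) := Int.ediv_nonneg (by norm_num) (by linarith)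
  constructor <;> linarith

theorem ell_partial_le (a k : ℕ) :
    1 ≤ 1 + ∑ j ∈ Finset.range k, (1 - 1 / ((I.m : ℤ) / (a * 2 ^ j) + 1)) ∧
    1 + ∑ j ∈ Finset.range k, (1 - 1 / ((I.m : ℤ) / (a * 2 ^ j) + 1)) ≤ 1 + k := by
  constructor
  · have := Finset.sum_nonneg fun j (_ : j ∈ Finset.range k) => (ell_term (I := I) a j).1
    linarith
  · have := Finset.sum_le_sum fun j (_ : j ∈ Finset.range k) => (ell_term (I := I) a j).2
    simp only [Finset.sum_const, Finset.card_range, nsmul_eq_mul, mul_one] at this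
    linarith

theorem Small.abs_ell_le (hI : I.Small b) (a : ℕ) {k : ℕ} (hk : k ≤ I.m) :
    |1 + ∑ j ∈ Finset.range k, (1 - 1 / ((I.m : ℤ) / (a * 2 ^ j) + 1))| ≤ (2 ^ b) ^ 2 := by
  have h := ell_partial_le (I := I) a k
  rw [abs_of_nonneg (by linarith [h.1])]
  have h1 : (k : ℤ) ≤ I.m := by exact_mod_cast hk
  nlinarith [h.2, hI.m_le, hI.T_ge]

theorem Small.abs_weightBase_le (hI : I.Small b) (ha : a ≤ I.n) :
    |I.weightBase a| ≤ (2 ^ b) ^ 8 := by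
  have hc : |(I.c : ℤ)| ≤ (2 ^ b) ^ 1 := by rw [pow_one, Nat.abs_cast]; exact hI.c_le
  have hN : |(I.N : ℤ)| ≤ (2 ^ b) ^ 1 := by rw [pow_one, Nat.abs_cast]; exact hI.N_le
  have hD : |I.D| ≤ (2 ^ b) ^ 1 := by rw [pow_one]; exact hI.D_le
  have ha' : |(a : ℤ)| ≤ (2 ^ b) ^ 1 := by
    rw [pow_one, Nat.abs_cast]
    have : (a : ℤ) ≤ I.n := by exact_mod_cast ha
    linarith [hI.n_le]
  exact abs_mul_le_pow hc (abs_mul_le_pow (abs_mul_le_pow hN hN)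
    (abs_mul_le_pow (abs_mul_le_pow hD hD) (abs_mul_le_pow ha' (hI.abs_ell_le a le_rfl))))

theorem Small.abs_weight_le (hI : I.Small b) (ha : a ≤ I.n) {k : ℕ} (hk : k ≤ I.m + 1) :
    |I.weightBase a ^ k| ≤ (2 ^ b) ^ (8 * I.m + 8) := by
  rw [abs_pow]
  calc |I.weightBase a| ^ k ≤ ((2 ^ b) ^ 8) ^ k :=
        pow_le_pow_left₀ (abs_nonneg _) (hI.abs_weightBase_le ha) _
    _ = (2 ^ b) ^ (8 * k) := by rw [← pow_mul]
    _ ≤ _ := pow_le_pow_right₀ hI.one_le_T (by omega)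

theorem Small.bitLen_le_N (hI : I.Small b) {x : ℤ} (hx : |x| ≤ I.N) : bitLen x ≤ I.bits b :=
  hI.bitLen_le (j := 1) (by rw [pow_one]; exact hx.trans hI.N_le) (by omega)

theorem Small.bitLen_small (hI : I.Small b) {x : ℤ} (hx : |x| ≤ 16) : bitLen x ≤ I.bits b :=
  hI.bitLen_le (j := 1) (by rw [pow_one]; exact hx.trans hI.T_ge) (by omega)

end Inst

/-- Besides drawing the signs, this resets the trial point in array 4 to the current coloring. -/
def flipLoop : Program :=
  forLoop 10 (.reg 0) <| .comp (.flip 13) <|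
    .comp (.store 5 (.reg 10) (.sub (.mul (.const 2) (.reg 13)) (.const 1)))
      (.store 4 (.reg 10) (.get 3 (.reg 10)))

def ellLoop : Program :=
  .comp (.assign 14 (.reg 5)) <| .comp (.assign 12 (.const 1)) <| forLoop 10 (.reg 1) <|
    .comp (.assign 12 (.add (.reg 12)
        (.sub (.const 1) (.div (.const 1) (.add (.div (.reg 1) (.reg 14)) (.const 1))))))
      (.assign 14 (.mul (.const 2) (.reg 14)))

def exprWeightBase (c : ℕ) : Expr :=
  .mul (.const c) (.mul exprNN (.mul (.mul (.reg 3) (.reg 3)) (.mul (.reg 5) (.reg 12))))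

def weightLoop (c : ℕ) : Program :=
  .comp (.assign 6 (.const 1)) <| forLoop 10 (.add (.reg 1) (.const 1))
    (.assign 6 (.mul (.reg 6) (exprWeightBase c)))

def countLoop (a : ℕ) : Program := sumLoop 11 12 (.reg 0) (exprAlive (.get a (.reg 11)))

def copyLoop : Program := forLoop 10 (.reg 0) (.store 3 (.reg 10) (.get 4 (.reg 10)))

def exprCommit (d : ℕ) : Expr :=
  .sub (.add (.mul (.const (d - 1)) (.reg 5)) (.const 1)) (.mul (.const d) (.reg 12))

def roundProgram (c d : ℕ) : Program :=
  .comp flipLoop <| .comp (countLoop 3) <| .comp (.assign 5 (.reg 12)) <| .comp ellLoop <|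
  .comp (weightLoop c) <| .comp (.assign 7 (.const 0)) <| .comp searchProgram <|
  .comp (countLoop 4) <| .branch (exprCommit d) copyLoop .skip

def roundWeight (c d n m N : ℕ) : ℕ :=
  forWeight (.reg 0) n 100 + 2 * sumWeight (.reg 0) (exprAlive (.get 0 (.reg 11))) n +
  forWeight (.reg 1) m 100 +
  forWeight (.add (.reg 1) (.const 1)) (m + 1) (2 * (exprWeightBase c).weight + 100) +
  forWeight exprMoves (2 * n * (16 * (n * N) + 1)) (attemptWeight n m) +
  (exprCommit d).weight + forWeight (.reg 0) n 100 + 200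

/-- The state between two rounds. -/
structure BaseState (I : Inst) (y : ℕ → ℤ) (j : ℕ) (t : List Bool) (s : Machine) : Prop where
  reg0 : s.reg 0 = I.n
  reg1 : s.reg 1 = I.m
  reg2 : s.reg 2 = I.N
  reg3 : s.reg 3 = I.D
  reg4 : s.reg 4 = j
  arr0 : s.arr 0 = I.num
  arr1 : s.arr 1 = I.den
  arr3 : s.arr 3 = y
  arr4 : ∀ i, I.n ≤ i → s.arr 4 i = 0
  arr5 : ∀ i, I.n ≤ i → s.arr 5 i = 0
  tape : s.tape = t

section
variable {I : Inst} {b j : ℕ} {y w g : ℕ → ℤ} {t : List Bool} {s : Machine}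

theorem fillTo_eq {f f₀ : ℕ → ℤ} {n : ℕ} (h : ∀ i, n ≤ i → f₀ i = f i) : fillTo f n f₀ = f := by
  ext i
  rw [fillTo]
  split_ifs with hi
  exacts [rfl, h i (not_lt.1 hi)]

/-- The loop writes only below n. That arrays 4 and 5, as well as y, vanish from n on upgrades this
to equality of functions on ℕ. -/
theorem runs_flipLoop (hI : I.Small b) (hy : ∀ i, |y i| ≤ I.N) (hy0 : ∀ i, I.n ≤ i → y i = 0)
    (ht : I.n ≤ t.length) (hs : BaseState I y j t s) :
    ∃ s', Runs (I.bits b) (forWeight (.reg 0) I.n 100) flipLoop s s' ∧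
      BaseState I y j (t.drop I.n) s' ∧ s'.arr 4 = y ∧ s'.arr 5 = signs I.n t := by
  have e1 : bitLen 1 = 1 := by decide
  have e2 : bitLen 2 = 2 := by decide
  obtain ⟨s', r, h, h4, h5, -⟩ := Runs.forLoop (B := I.bits b) (k := 100) (N := I.n)
    (r := 10) (bnd := .reg 0) (p := .comp (.flip 13) <|
    .comp (.store 5 (.reg 10) (.sub (.mul (.const 2) (.reg 13)) (.const 1)))
      (.store 4 (.reg 10) (.get 3 (.reg 10)))) (s := s)
    (fun k s' => BaseState I y j (t.drop k) s' ∧ s'.arr 4 = fillTo y k (s.arr 4) ∧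
      s'.arr 5 = fillTo (signs I.n t) k (s.arr 5) ∧ s'.reg 10 = k)
    (by
      refine ⟨?_, by simp, by simp, by simp⟩
      constructor <;> simp [hs.reg0, hs.reg1, hs.reg2, hs.reg3, hs.reg4, hs.arr0, hs.arr1, hs.arr3,
        hs.tape] <;> first | exact hs.arr4 | exact hs.arr5)
    (fun k s' h => h.2.2.2)
    (fun k s' _ h => by simp [Expr.eval, h.1.reg0])
    (by
      rintro k s' hk ⟨h, h4, h5, h10⟩
      have hkt : k < t.length := by omega
      have htape : s'.tape = t[k] :: t.drop (k + 1) := by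
        rw [h.tape, List.drop_eq_getElem_cons hkt]
      have r1 := Runs.flip (B := I.bits b) (r := 13) htape (by
        have := hI.b4; rw [Inst.bits]; nlinarith)
      set s1 : Machine := { s'.setReg 13 (if t[k] then 1 else 0) with tape := t.drop (k + 1) }
        with hs1
      have g10 : s1.reg 10 = k := by simp [hs1, h10]
      have g13 : s1.reg 13 = if t[k] then 1 else 0 := by simp [hs1]
      have hsg : signs I.n t k = 2 * (if t[k] then 1 else 0) - 1 := by
        rw [signs, if_pos hk, List.getD_eq_getElem _ _ hkt]
        split_ifs <;> norm_num
      have r2 := Runs.store (B := I.bits b) (a := 5) (idx := .reg 10)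
        (e := .sub (.mul (.const 2) (.reg 13)) (.const 1)) (s := s1) (j := k) (v := signs I.n t k)
        g10 (by simp only [Expr.eval, g13, hsg])
        (hI.bitLen_small ((abs_signs_le _ _ _).trans (by norm_num)))
      have c5 : Function.update (s1.arr 5) k (signs I.n t k) =
          fillTo (signs I.n t) (k + 1) (s.arr 5) := by
        rw [fillTo_succ, ← h5]; rfl
      rw [c5] at r2
      set s2 := s1.setArr 5 (fillTo (signs I.n t) (k + 1) (s.arr 5)) with hs2
      have r3 := Runs.store (B := I.bits b) (a := 4) (idx := .reg 10)
        (e := .get 3 (.reg 10)) (s := s2) (j := k) (v := y k) g10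
        (by rw [Expr.eval_get (s := s2) (idx := .reg 10) (j := k) g10]; simp [hs2, hs1, h.arr3])
        (hI.bitLen_le_N (hy k))
      have c4 : Function.update (s2.arr 4) k (y k) = fillTo y (k + 1) (s.arr 4) := by
        rw [fillTo_succ, ← h4]; rfl
      rw [c4] at r3
      refine ⟨_, (r1.comp (r2.comp r3)).mono ?_, ?_, ?_, ?_, ?_, ?_⟩
      · simp [Expr.weight, Expr.width, e1, e2]
      · simpa [hs2] using g10
      · constructor <;> simp [hs2, hs1, h.reg0, h.reg1, h.reg2, h.reg3, h.reg4, h.arr0, h.arr1,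
          h.arr3]
        · intro i hi
          rw [fillTo, if_neg (by omega)]; exact hs.arr4 i hi
        · intro i hi
          rw [fillTo, if_neg (by omega)]; exact hs.arr5 i hi
      · simp
      · simp [hs2]
      · simp)
    hI.bitLen_n
  refine ⟨s', r, h, ?_, ?_⟩
  · rw [h4]; exact fillTo_eq fun i hi => by rw [hs.arr4 i hi, hy0 i hi]
  · rw [h5]; exact fillTo_eq fun i hi => by rw [hs.arr5 i hi, signs, if_neg (by omega)]

theorem runs_countLoop (hI : I.Small b) {a : ℕ} (hw : ∀ i, |w i| ≤ I.N)
    (h0 : s.reg 0 = I.n) (h2 : s.reg 2 = I.N) (ha : s.arr a = w) :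
    ∃ s', Runs (I.bits b) (sumWeight (.reg 0) (exprAlive (.get 0 (.reg 11))) I.n) (countLoop a) s s' ∧
      s.Agree 10 10 s' ∧ s'.reg 12 = I.aliveCount w := by
  have r := Runs.sumLoop (B := I.bits b) (N := I.n) (k := 11) (acc := 12) (bnd := .reg 0)
    (e := exprAlive (.get a (.reg 11))) (s := s) (by norm_num) (fun i => I.aliveInd (w i))
    (by
      intro i _ v
      rw [eval_exprAlive (I := I) (by simp [h2]), Expr.eval_get (j := i) (by simp [Expr.eval])]
      simp [ha])
    (by intros; simp [Expr.eval, h0]) hI.bitLen_n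
    (fun k hk => by
      have := Inst.abs_aliveSum_le hw k
      refine hI.bitLen_le (j := 1) ?_ (by omega)
      rw [pow_one, abs_of_nonneg this.1]
      have : (k : ℤ) ≤ I.n := by exact_mod_cast hk
      linarith [hI.n_le])
  refine ⟨_, r, ⟨fun i hi => ?_, fun i _ => rfl, rfl⟩, by simp [Inst.aliveCount]⟩
  simp only [Machine.setReg_reg]; rw [if_neg (by omega), if_neg (by omega)]

theorem runs_ellLoop (hI : I.Small b) {a : ℕ} (ha : a ≤ I.n) (h1 : s.reg 1 = I.m)
    (h5 : s.reg 5 = a) :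
    ∃ s', Runs (I.bits b) (forWeight (.reg 1) I.m 100 + 50) ellLoop s s' ∧
      s.Agree 10 10 s' ∧ s'.reg 12 = I.ell a := by
  have e1 : bitLen 1 = 1 := by decide
  have e2 : bitLen 2 = 2 := by decide
  have hbit : ∀ k ≤ I.m, bitLen ((a : ℤ) * 2 ^ k) ≤ I.bits b := by
    intro k hk
    refine hI.bitLen_le (j := I.m + 1) ?_ (by omega)
    rw [abs_of_nonneg (by positivity), pow_succ, mul_comm]
    have h2 : (a : ℤ) ≤ 2 ^ b := by
      have : (a : ℤ) ≤ I.n := by exact_mod_cast ha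
      linarith [hI.n_le]
    have h3 : (2 : ℤ) ^ k ≤ (2 ^ b) ^ I.m := by
      calc (2 : ℤ) ^ k ≤ (2 ^ b) ^ k :=
            pow_le_pow_left₀ (by norm_num) (by linarith [hI.T_ge]) _
        _ ≤ _ := pow_le_pow_right₀ hI.one_le_T hk
    exact mul_le_mul h3 h2 (by positivity) (by positivity)
  have r1 := Runs.assign (B := I.bits b) (r := 14) (e := .reg 5) (s := s) (v := a) h5
    (by simpa using hbit 0 (by omega))
  have r2 := Runs.assign (B := I.bits b) (r := 12) (e := .const 1) (s := s.setReg 14 a) (v := 1) rfl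
    (hI.bitLen_small (by norm_num))
  set s0 := (s.setReg 14 a).setReg 12 1 with hs0
  obtain ⟨s', r3, hA, h12, -, -⟩ := Runs.forLoop (B := I.bits b) (k := 100) (N := I.m)
    (r := 10) (bnd := .reg 1) (p := .comp (.assign 12 (.add (.reg 12)
        (.sub (.const 1) (.div (.const 1) (.add (.div (.reg 1) (.reg 14)) (.const 1))))))
      (.assign 14 (.mul (.const 2) (.reg 14)))) (s := s0)
    (fun k s' => s.Agree 10 10 s' ∧
      s'.reg 12 = 1 + ∑ j ∈ Finset.range k, (1 - 1 / ((I.m : ℤ) / (a * 2 ^ j) + 1)) ∧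
      s'.reg 14 = a * 2 ^ k ∧ s'.reg 10 = k)
    (by
      refine ⟨⟨fun i hi => ?_, fun i _ => rfl, rfl⟩, by simp [hs0], by simp [hs0], by simp⟩
      simp only [hs0, Machine.setReg_reg]
      rw [if_neg (by omega), if_neg (by omega), if_neg (by omega)])
    (fun k s' h => h.2.2.2)
    (fun k s' _ h => by simp [Expr.eval, h.1.reg 1 (by norm_num), h1])
    (by
      rintro k s' hk ⟨hA, h12, h14, h10⟩
      have g1 : s'.reg 1 = I.m := (hA.reg 1 (by norm_num)).trans h1
      have q1 := Runs.assign (B := I.bits b) (r := 12) (e := .add (.reg 12)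
        (.sub (.const 1) (.div (.const 1) (.add (.div (.reg 1) (.reg 14)) (.const 1))))) (s := s')
        (v := 1 + ∑ j ∈ Finset.range (k + 1), (1 - 1 / ((I.m : ℤ) / (a * 2 ^ j) + 1)))
        (by simp only [Expr.eval, g1, h12, h14, Finset.sum_range_succ, add_assoc])
        (hI.bitLen_le (hI.abs_ell_le a hk) (by omega))
      have q2 := Runs.assign (B := I.bits b) (r := 14) (e := .mul (.const 2) (.reg 14))
        (s := s'.setReg 12 (1 + ∑ j ∈ Finset.range (k + 1), (1 - 1 / ((I.m : ℤ) / (a * 2 ^ j) + 1))))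
        (v := a * 2 ^ (k + 1))
        (by simp only [Expr.eval, Machine.setReg_reg]; norm_num; rw [h14]; ring) (hbit _ hk)
      refine ⟨_, (q1.comp q2).mono ?_, ?_, ⟨fun i hi => ?_, fun i hi => ?_, ?_⟩, ?_, ?_, ?_⟩
      · simp [Expr.weight, Expr.width, e1, e2]
      · simp [h10]
      · simp only [Machine.setReg_reg]
        rw [if_neg (by omega), if_neg (by omega), if_neg (by omega)]
        exact hA.reg i hi
      · exact hA.arr i hi
      · exact hA.tape
      · simp
      · simp
      · simp)
    hI.bitLen_m
  exact ⟨s', (r1.comp (r2.comp r3)).mono (by simp only [Expr.weight, e1]; omega), hA, h12⟩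

theorem runs_weightLoop (hI : I.Small b) {a : ℕ} (ha : a ≤ I.n) (h1 : s.reg 1 = I.m)
    (h2 : s.reg 2 = I.N) (h3 : s.reg 3 = I.D) (h5 : s.reg 5 = a) (h12 : s.reg 12 = I.ell a) :
    ∃ s', Runs (I.bits b) (forWeight (.add (.reg 1) (.const 1)) (I.m + 1)
        (2 * (exprWeightBase I.c).weight + 100) + 50) (weightLoop I.c) s s' ∧
      s.Agree 6 10 s' ∧ s'.reg 6 = I.weight a := by
  have e1 : bitLen 1 = 1 := by decide
  have r1 := Runs.assign (B := I.bits b) (r := 6) (e := .const 1) (s := s) (v := 1) rfl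
    (hI.bitLen_small (by norm_num))
  obtain ⟨s', r3, hA, h6, -⟩ := Runs.forLoop (B := I.bits b)
    (k := 2 * (exprWeightBase I.c).weight + 100) (N := I.m + 1)
    (r := 10) (bnd := .add (.reg 1) (.const 1))
    (p := .assign 6 (.mul (.reg 6) (exprWeightBase I.c))) (s := s.setReg 6 1)
    (fun k s' => s.Agree 6 10 s' ∧ s'.reg 6 = I.weightBase a ^ k ∧ s'.reg 12 = I.ell a ∧
      s'.reg 10 = k)
    (by
      refine ⟨⟨fun i hi => ?_, fun i _ => rfl, rfl⟩, by simp, by simp [h12], by simp⟩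
      simp only [Machine.setReg_reg]
      rw [if_neg (by omega), if_neg (by omega)])
    (fun k s' h => h.2.2.2)
    (fun k s' _ h => by simp [Expr.eval, h.1.reg 1 (by norm_num), h1])
    (by
      rintro k s' hk ⟨hA, h6, h12, h10⟩
      have q1 := Runs.assign (B := I.bits b) (r := 6) (e := .mul (.reg 6) (exprWeightBase I.c))
        (s := s') (v := I.weightBase a ^ (k + 1))
        (by
          simp only [Expr.eval, exprWeightBase, exprNN, h6, h12, hA.reg 2 (by norm_num), h2,
            hA.reg 3 (by norm_num), h3, hA.reg 5 (by norm_num), h5, pow_succ, Inst.weightBase])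
        (hI.bitLen_le (hI.abs_weight_le ha (by omega)) (by omega))
      refine ⟨_, q1.mono ?_, ?_, ⟨fun i hi => ?_, fun i hi => ?_, ?_⟩, ?_, ?_, ?_⟩
      · have := (exprWeightBase I.c).width_le_weight
        simp only [Expr.weight, Expr.width]; omega
      · simp [h10]
      · simp only [Machine.setReg_reg]
        rw [if_neg (by omega), if_neg (by omega)]
        exact hA.reg i hi
      · exact hA.arr i hi
      · exact hA.tape
      · simp
      · simp [h12]
      · simp)
    (hI.bitLen_le (j := 2) (by
      rw [Nat.abs_cast]; push_cast; nlinarith [hI.m_le, hI.T_ge]) (by omega))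
  exact ⟨s', (r1.comp r3).mono (by simp only [Expr.weight, e1]; omega), hA, h6⟩

theorem runs_copyLoop (hI : I.Small b) (hw : ∀ i, |w i| ≤ I.N) (h0 : s.reg 0 = I.n)
    (h4 : s.arr 4 = w) :
    ∃ s', Runs (I.bits b) (forWeight (.reg 0) I.n 100) copyLoop s s' ∧
      s.Agree 10 3 s' ∧ s'.arr 3 = fillTo w I.n (s.arr 3) ∧ s'.arr 4 = w ∧ s'.arr 5 = s.arr 5 := by
  obtain ⟨s', r3, hA, h3, h4, h5, -⟩ := Runs.forLoop (B := I.bits b)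
    (k := 100) (N := I.n) (r := 10) (bnd := .reg 0)
    (p := .store 3 (.reg 10) (.get 4 (.reg 10))) (s := s)
    (fun k s' => s.Agree 10 3 s' ∧ s'.arr 3 = fillTo w k (s.arr 3) ∧ s'.arr 4 = w ∧
      s'.arr 5 = s.arr 5 ∧ s'.reg 10 = k)
    (by
      refine ⟨⟨fun i hi => ?_, fun i _ => rfl, rfl⟩, by simp, by simp [h4], by simp, by simp⟩
      simp only [Machine.setReg_reg]
      rw [if_neg (by omega)])
    (fun k s' h => h.2.2.2.2)
    (fun k s' _ h => by simp [Expr.eval, h.1.reg 0 (by norm_num), h0])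
    (by
      rintro k s' hk ⟨hA, h3, h4, h5, h10⟩
      have q1 := Runs.store (B := I.bits b) (a := 3) (idx := .reg 10) (e := .get 4 (.reg 10))
        (s := s') (j := k) (v := w k) h10 (by rw [Expr.eval_get (s := s') (idx := .reg 10) (j := k) h10, h4])
        (hI.bitLen_le_N (hw k))
      refine ⟨_, q1.mono ?_, ?_, ⟨fun i hi => ?_, fun i hi => ?_, ?_⟩, ?_, ?_, ?_, ?_⟩
      · simp [Expr.weight]
      · simp [h10]
      · simp only [Machine.setReg_reg, Machine.setArr_reg]
        rw [if_neg (by omega)]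
        exact hA.reg i hi
      · simp only [Machine.setReg_arr, Machine.setArr_arr]
        rw [if_neg (by omega)]
        exact hA.arr i hi
      · exact hA.tape
      · simp [h3, fillTo_succ]
      · simp [h4]
      · simp [h5]
      · simp)
    hI.bitLen_n
  exact ⟨s', r3, hA, h3, h4, h5⟩

end
end
-- Correctness of one round
noncomputable section

namespace Inst
variable {I : Inst} {b a : ℕ} {Q : ℤ} {y w g : ℕ → ℤ}

theorem attempt_eq_of_le (hn : 0 < I.n) (v : ℕ) {i : ℕ} (hi : I.n ≤ i) :
    I.attempt a Q y g w v i = w i := by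
  have : I.moveIdx v < I.n := Nat.mod_lt _ hn
  rw [attempt]
  split_ifs
  · rw [Function.update_of_ne (by omega)]
  · rfl

theorem search_eq_of_le (v : ℕ) (hn : 0 < I.n) {i : ℕ} (hi : I.n ≤ i) :
    I.search a Q y g v i = y i := by
  induction v with
  | zero => rfl
  | succ v ih => rw [search, attempt_eq_of_le hn v hi, ih]

theorem search_moves_eq_of_le {i : ℕ} (hi : I.n ≤ i) : I.search a Q y g I.moves i = y i := by
  rcases Nat.eq_zero_or_pos I.n with hn | hn
  · simp [moves, hn, search]
  · exact search_eq_of_le _ hn hi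

theorem round_eq_of_le {i : ℕ} (hi : I.n ≤ i) : I.round y g i = y i := by
  rw [round]
  split_ifs
  exacts [search_moves_eq_of_le hi, rfl]

theorem abs_round_le (hy : ∀ i, |y i| ≤ I.N) (i : ℕ) : |I.round y g i| ≤ I.N := by
  rw [round]
  split_ifs
  exacts [abs_search_le hy _ _, hy i]

theorem mat_zero (t : ℕ) : I.mat (fun _ => 0) t = 0 := by simp [mat]

theorem gram_zero (r c : ℕ) : I.gram (fun _ => 0) r c = 0 := by simp [gram, mat_zero]

theorem gramPow_zero (j r c : ℕ) : I.gramPow (fun _ => 0) j r c = 0 := by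
  cases j <;> simp [gramPow, gram_zero]

/-- This justifies initializing the cached objective in register 7 with 0. -/
theorem objective_zero : I.objective a Q g (fun _ => 0) = 0 := by
  simp [objective, gramPow_zero]

end Inst

theorem runs_round {I : Inst} {b j : ℕ} {y : ℕ → ℤ} {t : List Bool} {s : Machine}
    (hI : I.Small b) (hy : ∀ i, |y i| ≤ I.N) (hy0 : ∀ i, I.n ≤ i → y i = 0)
    (ht : I.n ≤ t.length) (hs : BaseState I y j t s) :
    ∃ s', Runs (I.bits b) (roundWeight I.c I.d I.n I.m I.N) (roundProgram I.c I.d) s s' ∧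
      BaseState I (I.round y (signs I.n t)) j (t.drop I.n) s' := by
  obtain ⟨s1, r1, h1, h14, h15⟩ := runs_flipLoop hI hy hy0 ht hs
  obtain ⟨s2, r2, A2, h2⟩ := runs_countLoop (a := 3) hI hy h1.reg0 h1.reg2 h1.arr3
  set a := I.aliveNum y with ha
  have ha_le : a ≤ I.n := Inst.aliveNum_le hy
  have hac : (a : ℤ) = I.aliveCount y := Inst.aliveNum_cast hy
  have r3 := Runs.assign (B := I.bits b) (r := 5) (e := .reg 12) (s := s2) (v := a)
    (h2.trans hac.symm) (hI.bitLen_le (j := 1) (by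
      rw [pow_one, Nat.abs_cast]
      have : (a : ℤ) ≤ I.n := by exact_mod_cast ha_le
      linarith [hI.n_le]) (by omega))
  set s3 := s2.setReg 5 a with hs3
  have g1 : s3.reg 1 = I.m := by simp [hs3, A2.reg 1 (by norm_num), h1.reg1]
  obtain ⟨s4, r4, A4, h4⟩ := runs_ellLoop (s := s3) hI ha_le g1 (by simp [hs3])
  have k4 : ∀ i < 10, i ≠ 5 → s4.reg i = s1.reg i := fun i hi h5 => by
    rw [A4.reg i hi, hs3, Machine.setReg_reg, if_neg h5, A2.reg i hi]
  have k45 : s4.reg 5 = a := by rw [A4.reg 5 (by norm_num), hs3, Machine.setReg_reg, if_pos rfl]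
  have ka4 : ∀ i < 10, s4.arr i = s1.arr i := fun i hi => (A4.arr i hi).trans (A2.arr i hi)
  have kt4 : s4.tape = s1.tape := A4.tape.trans A2.tape
  obtain ⟨s5, r5, A5, h5⟩ := runs_weightLoop (s := s4) hI ha_le
    ((k4 1 (by norm_num) (by norm_num)).trans h1.reg1)
    ((k4 2 (by norm_num) (by norm_num)).trans h1.reg2)
    ((k4 3 (by norm_num) (by norm_num)).trans h1.reg3) k45 h4
  have r6 := Runs.assign (B := I.bits b) (r := 7) (e := .const 0) (s := s5) (v := 0) rfl
    (hI.bitLen_small (by norm_num))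
  set s6 := s5.setReg 7 0 with hs6
  have k6 : ∀ i < 6, s6.reg i = s4.reg i := fun i hi => by
    rw [hs6, Machine.setReg_reg, if_neg (by omega), A5.reg i hi]
  have ka6 : ∀ i < 10, s6.arr i = s1.arr i := fun i hi => (A5.arr i hi).trans (ka4 i hi)
  have kt6 : s6.tape = s1.tape := A5.tape.trans kt4
  have hg : ∀ i, |signs I.n t i| ≤ 1 := abs_signs_le _ _
  have R6 : RoundState I a (I.weight a) y y (signs I.n t) s6 := by
    constructor
    · rw [k6 0 (by norm_num), k4 0 (by norm_num) (by norm_num), h1.reg0]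
    · rw [k6 1 (by norm_num), k4 1 (by norm_num) (by norm_num), h1.reg1]
    · rw [k6 2 (by norm_num), k4 2 (by norm_num) (by norm_num), h1.reg2]
    · rw [k6 3 (by norm_num), k4 3 (by norm_num) (by norm_num), h1.reg3]
    · rw [k6 5 (by norm_num), k45]
    · rw [hs6, Machine.setReg_reg, if_neg (by norm_num), h5]
    · rw [ka6 0 (by norm_num), h1.arr0]
    · rw [ka6 1 (by norm_num), h1.arr1]
    · rw [ka6 3 (by norm_num), h1.arr3]
    · rw [ka6 4 (by norm_num), h14]
    · rw [ka6 5 (by norm_num), h15]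
  obtain ⟨s7, r7, R7, h74, h7t⟩ := runs_search (Q := I.weight a) hI hy hg
    (hI.abs_weight_le ha_le le_rfl) ha_le R6
    (by rw [Inst.objective_zero]; simp [hs6])
  set w := I.search a (I.weight a) y (signs I.n t) I.moves with hw
  have hwN : ∀ i, |w i| ≤ I.N := Inst.abs_search_le hy _
  have hw0 : ∀ i, I.n ≤ i → w i = 0 := fun i hi => by
    rw [hw, Inst.search_moves_eq_of_le hi, hy0 i hi]
  obtain ⟨s8, r8, A8, h8⟩ := runs_countLoop (a := 4) (s := s7) hI hwN R7.reg0 R7.reg2 R7.arr4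
  have R8 := R7.of_agree (A8.mono (by norm_num) (by norm_num))
  have h84 : s8.reg 4 = j := by
    rw [A8.reg 4 (by norm_num), h74, k6 4 (by norm_num), k4 4 (by norm_num) (by norm_num), h1.reg4]
  have h8t : s8.tape = t.drop I.n := by rw [A8.tape, h7t, kt6, h1.tape]
  have B8 : BaseState I y j (t.drop I.n) s8 :=
    ⟨R8.reg0, R8.reg1, R8.reg2, R8.reg3, h84, R8.arr0, R8.arr1, R8.arr3,
      fun i hi => by rw [R8.arr4, hw0 i hi],
      fun i hi => by rw [R8.arr5, signs, if_neg (by omega)], h8t⟩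
  have hcond : (exprCommit I.d).eval s8 =
      ((I.d : ℤ) - 1) * I.aliveCount y + 1 - I.d * I.aliveCount w := by
    simp only [exprCommit, Expr.eval, R8.reg5, h8, hac]
  have e1 : bitLen 1 = 1 := by decide
  have e0 : bitLen 0 = 0 := by decide
  have hcw : ∀ a, (sumWeight (.reg 0) (exprAlive (.get a (.reg 11))) I.n) =
    (sumWeight (.reg 0) (exprAlive (.get 0 (.reg 11))) I.n) := fun _ => rfl
  by_cases hc : (I.d : ℤ) * I.aliveCount w ≤ (I.d - 1) * I.aliveCount y
  · have hround : I.round y (signs I.n t) = w := if_pos hc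
    obtain ⟨s9, r9, A9, h93, h94, h95⟩ := runs_copyLoop (s := s8) hI hwN R8.reg0 R8.arr4
    refine ⟨s9, (r1.comp (r2.comp (r3.comp (r4.comp (r5.comp (r6.comp (r7.comp (r8.comp
      (Runs.branch_pos (by rw [hcond]; omega) r9))))))))).mono ?_, ?_⟩
    · simp only [roundWeight, Expr.weight, e0, Inst.moves]; omega
    · rw [hround]
      refine ⟨(A9.reg 0 (by norm_num)).trans B8.reg0, (A9.reg 1 (by norm_num)).trans B8.reg1,
        (A9.reg 2 (by norm_num)).trans B8.reg2, (A9.reg 3 (by norm_num)).trans B8.reg3,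
        (A9.reg 4 (by norm_num)).trans B8.reg4, (A9.arr 0 (by norm_num)).trans B8.arr0,
        (A9.arr 1 (by norm_num)).trans B8.arr1, ?_, fun i hi => by rw [h94, hw0 i hi],
        fun i hi => by rw [h95]; exact B8.arr5 i hi, A9.tape.trans h8t⟩
      rw [h93, B8.arr3]
      exact fillTo_eq fun i hi => by rw [hy0 i hi, hw0 i hi]
  · have hround : I.round y (signs I.n t) = y := if_neg hc
    refine ⟨s8, (r1.comp (r2.comp (r3.comp (r4.comp (r5.comp (r6.comp (r7.comp (r8.comp
      (Runs.branch_neg (by rw [hcond]; omega) Runs.skip))))))))).mono ?_, ?_⟩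
    · simp only [roundWeight, Expr.weight, e0, Inst.moves]; omega
    · rw [hround]; exact B8

/-! ### The whole program -/

namespace Inst

/-- The coloring after `k` rounds. -/
def coloring (I : Inst) (t : List Bool) : ℕ → ℕ → ℤ
  | 0 => fun _ => 0
  | k + 1 => I.round (coloring I t k) (signs I.n (t.drop (k * I.n)))

variable {I : Inst} {t : List Bool}

theorem abs_coloring_le (k i : ℕ) : |I.coloring t k i| ≤ I.N := by
  induction k generalizing i with
  | zero => simp [coloring]
  | succ k ih => exact abs_round_le ih i

theorem coloring_eq_zero (k : ℕ) {i : ℕ} (hi : I.n ≤ i) : I.coloring t k i = 0 := by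
  induction k with
  | zero => rfl
  | succ k ih => rw [coloring, round_eq_of_le hi, ih]

/-- The number of rounds. -/
def rounds (I : Inst) : ℕ := 5 * (I.n + I.m)

end Inst

def exprN : Expr :=
  .mul (.mul (.const 4000) (.add (.reg 0) (.const 1)))
    (.mul (.add (.reg 1) (.const 1)) (.mul (.add (.reg 1) (.const 1)) (.add (.reg 1) (.const 1))))

def denLoop : Program :=
  .comp (.assign 3 (.const 1)) <|
    forLoop 10 (.mul (.reg 0) exprMM) (.assign 3 (.mul (.reg 3) (.get 1 (.reg 10))))

def exprRounds : Expr := .mul (.const 5) (.add (.reg 0) (.reg 1))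

def outputLoop : Program :=
  forLoop 10 (.reg 0) (.store 2 (.reg 10) (.div (.get 3 (.reg 10)) (.reg 2)))

/-- The discrepancy algorithm. -/
def spencerProgram (c d : ℕ) : Program :=
  .comp (.assign 2 exprN) <| .comp denLoop <|
    .comp (forLoop 4 exprRounds (roundProgram c d)) outputLoop

def spencerWeight (c d n m N : ℕ) : ℕ :=
  exprN.weight + forWeight (.mul (.reg 0) exprMM) (n * (m * m)) 100 +
  forWeight exprRounds (5 * (n + m)) (roundWeight c d n m N) + forWeight (.reg 0) n 100 + 100

/-- The initial state on an instance. -/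
structure InitState (I : Inst) (t : List Bool) (s : Machine) : Prop where
  reg0 : s.reg 0 = I.n
  reg1 : s.reg 1 = I.m
  arr0 : s.arr 0 = I.num
  arr1 : s.arr 1 = I.den
  arr : ∀ i, 3 ≤ i → ∀ p, s.arr i p = 0
  tape : s.tape = t

theorem runs_denLoop {I : Inst} {b : ℕ} {s : Machine} (hI : I.Small b)
    (h0 : s.reg 0 = I.n) (h1 : s.reg 1 = I.m) (ha : s.arr 1 = I.den) :
    ∃ s', Runs (I.bits b) (forWeight (.mul (.reg 0) exprMM) (I.n * (I.m * I.m)) 100 + 10)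
      denLoop s s' ∧ s.Agree 3 10 s' ∧ s'.reg 3 = I.D := by
  have e1 : bitLen 1 = 1 := by decide
  have r1 := Runs.assign (B := I.bits b) (r := 3) (e := .const 1) (s := s) (v := 1) rfl
    (hI.bitLen_small (by norm_num))
  obtain ⟨s', r3, hA, h3, -⟩ := Runs.forLoop (B := I.bits b)
    (k := 100) (N := I.n * (I.m * I.m)) (r := 10) (bnd := .mul (.reg 0) exprMM)
    (p := .assign 3 (.mul (.reg 3) (.get 1 (.reg 10)))) (s := s.setReg 3 1)
    (fun k s' => s.Agree 3 10 s' ∧ s'.reg 3 = ∏ u ∈ Finset.range k, I.den u ∧ s'.reg 10 = k)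
    (by
      refine ⟨⟨fun i hi => ?_, fun i _ => rfl, rfl⟩, by simp, by simp⟩
      simp only [Machine.setReg_reg]
      rw [if_neg (by omega), if_neg (by omega)])
    (fun k s' h => h.2.2)
    (fun k s' _ h => by
      simp [Expr.eval, exprMM, h.1.reg 0 (by norm_num), h.1.reg 1 (by norm_num), h0, h1])
    (by
      rintro k s' hk ⟨hA, h3, h10⟩
      have q1 := Runs.assign (B := I.bits b) (r := 3) (e := .mul (.reg 3) (.get 1 (.reg 10)))
        (s := s') (v := ∏ u ∈ Finset.range (k + 1), I.den u)
        (by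
          rw [Expr.eval_mul, Expr.eval_get (s := s') (idx := .reg 10) (j := k) h10,
            hA.arr 1 (by norm_num), ha, Finset.prod_range_succ, ← h3]; rfl)
        (hI.bitLen_le (j := 1) (by rw [pow_one]; exact hI.prod_le _ hk) (by omega))
      refine ⟨_, q1.mono ?_, ?_, ⟨fun i hi => ?_, fun i hi => ?_, ?_⟩, ?_, ?_⟩
      · simp [Expr.weight, Expr.width]
      · simp [h10]
      · simp only [Machine.setReg_reg]
        rw [if_neg (by omega), if_neg (by omega)]
        exact hA.reg i hi
      · exact hA.arr i hi
      · exact hA.tape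
      · simp
      · simp)
    (hI.bitLen_le (j := 3) (by
      have := abs_mul_le_pow (x := I.n) (j := 1) (by rw [pow_one, Nat.abs_cast]; exact hI.n_le)
        hI.abs_mm_le
      push_cast at this ⊢; exact this) (by omega))
  exact ⟨s', (r1.comp r3).mono (by simp only [Expr.weight, e1]; omega), hA, h3⟩

theorem runs_outputLoop {I : Inst} {b : ℕ} {y : ℕ → ℤ} {s : Machine} (hI : I.Small b)
    (hy : ∀ i, |y i| ≤ I.N)
    (h0 : s.reg 0 = I.n) (h2 : s.reg 2 = I.N) (h3 : s.arr 3 = y) :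
    ∃ s', Runs (I.bits b) (forWeight (.reg 0) I.n 100) outputLoop s s' ∧
      ∀ i < I.n, s'.arr 2 i = y i / I.N := by
  obtain ⟨s', r3, h0', h2', h3', h, -⟩ := Runs.forLoop (B := I.bits b)
    (k := 100) (N := I.n) (r := 10) (bnd := .reg 0)
    (p := .store 2 (.reg 10) (.div (.get 3 (.reg 10)) (.reg 2))) (s := s)
    (fun k s' => s'.reg 0 = I.n ∧ s'.reg 2 = I.N ∧ s'.arr 3 = y ∧
      s'.arr 2 = fillTo (fun i => y i / I.N) k (s.arr 2) ∧ s'.reg 10 = k)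
    (by simp [h0, h2, h3])
    (fun k s' h => h.2.2.2.2)
    (fun k s' _ h => by simp [Expr.eval, h.1])
    (by
      rintro k s' hk ⟨h0, h2, h3, h, h10⟩
      have q1 := Runs.store (B := I.bits b) (a := 2) (idx := .reg 10)
        (e := .div (.get 3 (.reg 10)) (.reg 2)) (s := s') (j := k) (v := y k / I.N) h10
        (by
          rw [Expr.eval_div, Expr.eval_get (s := s') (idx := .reg 10) (j := k) h10, h3]
          simp [Expr.eval, h2])
        ((bitLen_div_le _ _).trans (hI.bitLen_le_N (hy k)))
      refine ⟨_, q1.mono ?_, ?_, ?_⟩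
      · simp [Expr.weight, Expr.width]
      · simp [h10]
      · simp [h0, h2, h3, h, fillTo_succ])
    hI.bitLen_n
  refine ⟨s', r3, fun i hi => ?_⟩
  rw [h, fillTo, if_pos hi]

theorem runs_spencerProgram {I : Inst} {b : ℕ} {t : List Bool} {s : Machine} (hI : I.Small b)
    (hN : I.N = 4000 * (I.n + 1) * (I.m + 1) ^ 3) (ht : I.rounds * I.n ≤ t.length)
    (hs : InitState I t s) :
    ∃ s', Runs (I.bits b) (spencerWeight I.c I.d I.n I.m I.N) (spencerProgram I.c I.d) s s' ∧
      ∀ i < I.n, s'.arr 2 i = I.coloring t I.rounds i / I.N := by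
  have r1 := Runs.assign (B := I.bits b) (r := 2) (e := exprN) (s := s) (v := I.N)
    (by simp only [exprN, Expr.eval, hs.reg0, hs.reg1, hN]; push_cast; ring)
    (hI.bitLen_le_N (by simp))
  set s1 := s.setReg 2 I.N with hs1
  obtain ⟨s2, r2, A2, h2⟩ := runs_denLoop (s := s1) hI (by simp [hs1, hs.reg0])
    (by simp [hs1, hs.reg1]) (by simp [hs1, hs.arr1])
  have B2 : BaseState I (I.coloring t 0) 0 t (s2.setReg 4 0) := by
    constructor
    · simp [A2.reg 0, hs1, hs.reg0]
    · simp [A2.reg 1, hs1, hs.reg1]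
    · simp [A2.reg 2, hs1]
    · simp [h2]
    · simp
    · simp [A2.arr 0, hs1, hs.arr0]
    · simp [A2.arr 1, hs1, hs.arr1]
    · simp only [Machine.setReg_arr, A2.arr 3 (by norm_num)]
      ext p; exact hs.arr 3 (by norm_num) p
    · intro i _; simp only [Machine.setReg_arr, A2.arr 4 (by norm_num)]
      exact hs.arr 4 (by norm_num) i
    · intro i _; simp only [Machine.setReg_arr, A2.arr 5 (by norm_num)]
      exact hs.arr 5 (by norm_num) i
    · simp [A2.tape, hs1, hs.tape]
  obtain ⟨s3, r3, B3⟩ := Runs.forLoop (B := I.bits b) (k := roundWeight I.c I.d I.n I.m I.N)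
    (N := I.rounds) (r := 4) (bnd := exprRounds) (p := roundProgram I.c I.d) (s := s2)
    (fun k s' => BaseState I (I.coloring t k) k (t.drop (k * I.n)) s')
    (by simpa using B2)
    (fun k s' h => h.reg4)
    (fun k s' _ h => by simp [exprRounds, Expr.eval, h.reg0, h.reg1, Inst.rounds])
    (by
      intro k s' hk h
      obtain ⟨s'', r, h'⟩ := runs_round hI (Inst.abs_coloring_le k)
        (fun i hi => Inst.coloring_eq_zero k hi) (by
          rw [List.length_drop]
          have : (k + 1) * I.n ≤ I.rounds * I.n := Nat.mul_le_mul_right _ hk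
          rw [add_mul, one_mul] at this
          omega) h
      refine ⟨s'', r, h'.reg4, ?_⟩
      rw [List.drop_drop, show k * I.n + I.n = (k + 1) * I.n by ring] at h'
      constructor
      · simp [h'.reg0]
      · simp [h'.reg1]
      · simp [h'.reg2]
      · simp [h'.reg3]
      · simp
      · simp [h'.arr0]
      · simp [h'.arr1]
      · simp [h'.arr3, Inst.coloring]
      · simpa using h'.arr4
      · simpa using h'.arr5
      · simp [h'.tape])
    (hI.bitLen_le (j := 3) (by
      rw [Nat.abs_cast, Inst.rounds]; push_cast
      have h1 := hI.n_le
      have h2 := hI.m_le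
      have hT := hI.T_ge
      set T : ℤ := 2 ^ b
      have : T ^ 3 = T * T * T := by ring
      nlinarith [mul_nonneg (by linarith : (0 : ℤ) ≤ T) (by nlinarith : (0 : ℤ) ≤ T * T - 10)])
      (by omega))
  obtain ⟨s4, r4, h4⟩ := runs_outputLoop hI (Inst.abs_coloring_le _) B3.reg0 B3.reg2 B3.arr3
  refine ⟨s4, (r1.comp (r2.comp (r3.comp r4))).mono ?_, h4⟩
  simp only [spencerWeight, Inst.rounds]
  omega

end
noncomputable section

/-! ### Polynomial bounds -/

/-- `f n m` is at most a polynomial in any bound on `n` and `m`. -/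
def PolyBounded (f : ℕ → ℕ → ℕ) : Prop :=
  ∃ p : Polynomial ℕ, ∀ n m X, n ≤ X → m ≤ X → f n m ≤ p.eval X

namespace PolyBounded
variable {f g h : ℕ → ℕ → ℕ}

theorem const (c : ℕ) : PolyBounded fun _ _ => c := ⟨.C c, fun _ _ _ _ _ => by simp⟩

theorem fst : PolyBounded fun n _ => n := ⟨.X, fun _ _ _ h _ => by simpa using h⟩

theorem snd : PolyBounded fun _ m => m := ⟨.X, fun _ _ _ _ h => by simpa using h⟩

theorem add (hf : PolyBounded f) (hg : PolyBounded g) : PolyBounded fun n m => f n m + g n m := by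
  obtain ⟨p, hp⟩ := hf
  obtain ⟨q, hq⟩ := hg
  exact ⟨p + q, fun n m X h h' => by
    rw [Polynomial.eval_add]; exact add_le_add (hp n m X h h') (hq n m X h h')⟩

theorem mul (hf : PolyBounded f) (hg : PolyBounded g) : PolyBounded fun n m => f n m * g n m := by
  obtain ⟨p, hp⟩ := hf
  obtain ⟨q, hq⟩ := hg
  exact ⟨p * q, fun n m X h h' => by
    rw [Polynomial.eval_mul]; exact Nat.mul_le_mul (hp n m X h h') (hq n m X h h')⟩

theorem pow (hf : PolyBounded f) (k : ℕ) : PolyBounded fun n m => f n m ^ k := by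
  obtain ⟨p, hp⟩ := hf
  exact ⟨p ^ k, fun n m X h h' => by
    rw [Polynomial.eval_pow]; exact Nat.pow_le_pow_left (hp n m X h h') _⟩

theorem forWeight (bnd : Expr) (hf : PolyBounded f) (hg : PolyBounded g) :
    PolyBounded fun n m => forWeight bnd (f n m) (g n m) :=
  (hf.mul (((hg.add (const _)).add (const _)).add (const _))).add (const _)

theorem sumWeight (bnd e : Expr) (hf : PolyBounded f) :
    PolyBounded fun n m => sumWeight bnd e (f n m) :=
  (hf.forWeight bnd (const _)).add (const _)

theorem fillWeight (bnd bnd' e idx : Expr) (hf : PolyBounded f) (hg : PolyBounded g) :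
    PolyBounded fun n m => fillWeight bnd bnd' e idx (f n m) (g n m) :=
  hf.forWeight bnd (((hg.sumWeight bnd' e).add (const _)).add (const _))

theorem evalWeight : PolyBounded evalWeight :=
  have mm := snd.mul snd
  (((((mm.fillWeight _ _ _ _ fst).add (mm.fillWeight _ _ _ _ snd)).add
    ((snd.mul mm).fillWeight _ _ _ _ snd)).add (snd.sumWeight _ _)).add (fst.sumWeight _ _)).add
    (const _)

theorem roundWeight (c d : ℕ) (hf : PolyBounded f) :
    PolyBounded fun n m => roundWeight c d n m (f n m) :=
  ((((((fst.forWeight _ (const _)).add ((const 2).mul (fst.sumWeight _ _))).add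
    (snd.forWeight _ (const _))).add ((snd.add (const 1)).forWeight _ (const _))).add
    ((((const 2).mul fst).mul (((const 16).mul (fst.mul hf)).add (const 1))).forWeight _
      (evalWeight.add (const _)))).add (const _)).add (fst.forWeight _ (const _)) |>.add (const _)

theorem spencerWeight (c d : ℕ) (hf : PolyBounded f) :
    PolyBounded fun n m => spencerWeight c d n m (f n m) :=
  ((((const _).add ((fst.mul (snd.mul snd)).forWeight _ (const _))).add
    (((const 5).mul (fst.add snd)).forWeight _ (hf.roundWeight c d))).add
    (fst.forWeight _ (const _))).add (const _)

end PolyBounded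

/-! ### The instance given by rational matrices -/

theorem sum_range_mul {M : Type*} [AddCommMonoid M] (f : ℕ → M) (n q : ℕ) :
    ∑ u ∈ Finset.range (n * q), f u =
      ∑ i ∈ Finset.range n, ∑ t ∈ Finset.range q, f (i * q + t) := by
  induction n with
  | zero => simp
  | succ n ih => rw [add_mul, one_mul, Finset.sum_range_add, ih, Finset.sum_range_succ]

section
variable {n m : ℕ} (A : Fin n → Matrix (Fin m) (Fin m) ℚ)

theorem flat_lt (i : Fin n) (j k : Fin m) :
    (i : ℕ) * (m * m) + (j * m + k) < n * (m * m) := by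
  have h1 : (j : ℕ) * m + k < m * m := by
    calc (j : ℕ) * m + k < j * m + m := by omega
      _ = (j + 1) * m := by ring
      _ ≤ m * m := Nat.mul_le_mul_right _ j.2
  calc (i : ℕ) * (m * m) + (j * m + k) < i * (m * m) + m * m := by omega
    _ = (i + 1) * (m * m) := by ring
    _ ≤ n * (m * m) := Nat.mul_le_mul_right _ i.2

theorem flatEntry_flat (i : Fin n) (j k : Fin m) :
    flatEntry A (i * (m * m) + (j * m + k)) (flat_lt i j k) = A i j k := by
  have hm : 0 < m := j.pos
  have h1 : (j : ℕ) * m + k < m * m := by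
    calc (j : ℕ) * m + k < j * m + m := by omega
      _ = (j + 1) * m := by ring
      _ ≤ m * m := Nat.mul_le_mul_right _ j.2
  have e1 : ((i : ℕ) * (m * m) + (j * m + k)) / (m * m) = i := by
    rw [mul_comm, Nat.mul_add_div (by positivity), Nat.div_eq_of_lt h1, add_zero]
  have e2 : ((i : ℕ) * (m * m) + (j * m + k)) / m % m = j := by
    rw [show (i : ℕ) * (m * m) + (j * m + k) = m * (i * m + j) + k by ring, Nat.mul_add_div hm,
      Nat.div_eq_of_lt k.2, add_zero, mul_comm, Nat.mul_add_mod, Nat.mod_eq_of_lt j.2]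
  have e3 : ((i : ℕ) * (m * m) + (j * m + k)) % m = k := by
    rw [show (i : ℕ) * (m * m) + (j * m + k) = m * (i * m + j) + k by ring, Nat.mul_add_mod,
      Nat.mod_eq_of_lt k.2]
  simp only [flatEntry, e1, e2, e3]

/-- The data of the algorithm on rational matrices. -/
def Inst.ofMatrices (c d : ℕ) : Inst where
  n := n
  m := m
  N := 4000 * (n + 1) * (m + 1) ^ 3
  c := c
  d := d
  num := (inputState A []).arr 0
  den := (inputState A []).arr 1

variable {A} {c d : ℕ}

theorem num_flat (i : Fin n) (j k : Fin m) :
    (Inst.ofMatrices A c d).num (i * (m * m) + (j * m + k)) = (A i j k).num := by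
  simp only [Inst.ofMatrices, inputState, dif_pos (flat_lt i j k), if_true, flatEntry_flat]

theorem den_flat (i : Fin n) (j k : Fin m) :
    (Inst.ofMatrices A c d).den (i * (m * m) + (j * m + k)) = (A i j k).den := by
  simp [Inst.ofMatrices, inputState, dif_pos (flat_lt i j k), flatEntry_flat]

theorem exists_flat {u : ℕ} (hu : u < n * (m * m)) :
    ∃ (i : Fin n) (j k : Fin m), u = i * (m * m) + (j * m + k) := by
  have hm : 0 < m := Nat.pos_of_ne_zero fun h => by simp [h] at hu
  refine ⟨⟨u / (m * m), Nat.div_lt_of_lt_mul (by rwa [mul_comm])⟩, ⟨u / m % m, Nat.mod_lt _ hm⟩,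
    ⟨u % m, Nat.mod_lt _ hm⟩, ?_⟩
  have h1 := Nat.div_add_mod u m
  have h2 := Nat.div_add_mod (u / m) m
  rw [Nat.div_div_eq_div_mul] at h2
  simp only
  calc u = m * (u / m) + u % m := h1.symm
    _ = m * (m * (u / (m * m)) + u / m % m) + u % m := by rw [h2]
    _ = _ := by ring

theorem den_pos {u : ℕ} (hu : u < n * (m * m)) : 1 ≤ (Inst.ofMatrices A c d).den u := by
  obtain ⟨i, j, k, rfl⟩ := exists_flat hu
  rw [den_flat]
  exact_mod_cast (A i j k).pos

theorem num_eq_zero {u : ℕ} (hu : ¬ u < n * (m * m)) : (Inst.ofMatrices A c d).num u = 0 := by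
  simp only [Inst.ofMatrices, inputState, dif_neg hu]

theorem den_eq_zero {u : ℕ} (hu : ¬ u < n * (m * m)) : (Inst.ofMatrices A c d).den u = 0 := by
  simp only [Inst.ofMatrices, inputState, dif_neg hu]

theorem sum_bitLen_le : (∑ u ∈ Finset.range (n * (m * m)),
    (bitLen ((Inst.ofMatrices A c d).num u) + bitLen ((Inst.ofMatrices A c d).den u))) + (n + m) =
      inputSize A := by
  rw [sum_range_mul, inputSize, add_comm, Finset.sum_range]
  congr 1
  refine Finset.sum_congr rfl fun i _ => ?_
  rw [sum_range_mul, Finset.sum_range]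
  refine Finset.sum_congr rfl fun j _ => ?_
  rw [Finset.sum_range]
  exact Finset.sum_congr rfl fun k _ => by rw [num_flat, den_flat]

theorem bitLen_num_den_le (u : ℕ) :
    bitLen ((Inst.ofMatrices A c d).num u) + bitLen ((Inst.ofMatrices A c d).den u) ≤
      inputSize A := by
  by_cases hu : u < n * (m * m)
  · rw [← sum_bitLen_le (c := c) (d := d)]
    have := Finset.single_le_sum (f := fun u => bitLen ((Inst.ofMatrices A c d).num u) +
      bitLen ((Inst.ofMatrices A c d).den u)) (fun _ _ => Nat.zero_le _) (Finset.mem_range.2 hu)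
    omega
  · rw [num_eq_zero hu, den_eq_zero hu, bitLen_zero]; exact Nat.zero_le _

theorem abs_prod_den_le {k : ℕ} (hk : k ≤ n * (m * m)) :
    |∏ u ∈ Finset.range k, (Inst.ofMatrices A c d).den u| ≤ 2 ^ inputSize A := by
  rw [Finset.abs_prod]
  calc ∏ u ∈ Finset.range k, |(Inst.ofMatrices A c d).den u|
      ≤ ∏ u ∈ Finset.range k, 2 ^ bitLen ((Inst.ofMatrices A c d).den u) :=
        Finset.prod_le_prod (fun _ _ => abs_nonneg _) fun u _ => (bitLen_le_iff.1 le_rfl).le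
    _ = 2 ^ ∑ u ∈ Finset.range k, bitLen ((Inst.ofMatrices A c d).den u) :=
        Finset.prod_pow_eq_pow_sum _ _ _
    _ ≤ _ := by
        refine pow_le_pow_right₀ (by norm_num) ?_
        rw [← sum_bitLen_le (c := c) (d := d), Finset.sum_add_distrib]
        have := Finset.sum_le_sum_of_subset (f := fun u => bitLen ((Inst.ofMatrices A c d).den u))
          (Finset.range_subset_range.2 hk)
        omega

/-- The summand 12 covers 4000 ≤ 2 ^ 12, c covers the constant itself, and three times the input
size covers both the factor (n + 1)(m + 1)³ of N and a numerator times a quotient of the common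
denominator. -/
theorem small_ofMatrices : (Inst.ofMatrices A c d).Small (12 + c + 3 * inputSize A) := by
  have hX : n + m ≤ inputSize A := by rw [← sum_bitLen_le (c := c) (d := d)]; omega
  set X := inputSize A
  have two : ∀ {k l : ℕ}, k ≤ l → (2 : ℤ) ^ k ≤ 2 ^ l := fun h => pow_le_pow_right₀ (by norm_num) h
  have self : ∀ k : ℕ, (k : ℤ) ≤ 2 ^ k := fun k => by exact_mod_cast Nat.lt_two_pow_self.le
  have self' : ∀ k : ℕ, (k : ℤ) + 1 ≤ 2 ^ k := fun k => by exact_mod_cast Nat.lt_two_pow_self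
  refine ⟨by omega, (self n).trans (two (by omega)), (self m).trans (two (by omega)), ?_,
    (self c).trans (two (by omega)), fun k hk => (abs_prod_den_le hk).trans (two (by change X ≤ _; omega)), ?_⟩
  · have : ((Inst.ofMatrices A c d).N : ℤ) = 4000 * (n + 1) * (m + 1) ^ 3 := by
      simp [Inst.ofMatrices]
    rw [this]
    calc (4000 : ℤ) * (n + 1) * (m + 1) ^ 3 ≤ 2 ^ 12 * 2 ^ n * (2 ^ m) ^ 3 :=
          mul_le_mul (mul_le_mul (by norm_num) (self' n) (by positivity) (by positivity))
            (pow_le_pow_left₀ (by positivity) (self' m) 3) (by positivity) (by positivity)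
      _ = 2 ^ (12 + n + m * 3) := by rw [← pow_mul, ← pow_add, ← pow_add]
      _ ≤ _ := two (by omega)
  · intro u
    rw [abs_mul]
    have h1 : |(Inst.ofMatrices A c d).num u| ≤ 2 ^ X :=
      (bitLen_le_iff.1 ((Nat.le_add_right _ _).trans (bitLen_num_den_le u))).le
    have h2 : |(Inst.ofMatrices A c d).D / (Inst.ofMatrices A c d).den u| ≤ 2 ^ X := by
      refine le_trans ?_ (abs_prod_den_le (A := A) (c := c) (d := d) le_rfl)
      rw [Int.abs_eq_natAbs, Int.abs_eq_natAbs]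
      exact_mod_cast Int.natAbs_ediv_le_natAbs _ _
    calc _ ≤ (2 : ℤ) ^ X * 2 ^ X := mul_le_mul h1 h2 (abs_nonneg _) (by positivity)
      _ = 2 ^ (X + X) := (pow_add _ _ _).symm
      _ ≤ _ := two (by omega)

theorem inputState_bounded (t : List Bool) {B : ℕ} (hB : inputSize A ≤ B) :
    (inputState A t).Bounded B := by
  have hX : n + m ≤ inputSize A := by rw [← sum_bitLen_le (c := 0) (d := 0)]; omega
  have self : ∀ k : ℕ, bitLen k ≤ k := fun k => by
    rw [bitLen_le_iff, Nat.abs_cast]; exact_mod_cast Nat.lt_two_pow_self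
  refine ⟨fun r => ?_, fun a u => ?_⟩
  · simp only [inputState]
    split_ifs
    · exact (self n).trans (by omega)
    · exact (self m).trans (by omega)
    · simp [bitLen_zero]
  · have h := bitLen_num_den_le (A := A) (c := 0) (d := 0) u
    simp only [Inst.ofMatrices, inputState] at h ⊢
    split_ifs at h ⊢ <;> simp_all [bitLen_zero] <;> omega

theorem initState_ofMatrices (t : List Bool) :
    InitState (Inst.ofMatrices A c d) t (inputState A t) where
  reg0 := rfl
  reg1 := rfl
  arr0 := rfl
  arr1 := rfl
  arr i hi p := by
    simp only [inputState]
    split_ifs <;> first | rfl | omega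
  tape := rfl

/-- Each of the 5(n + m) rounds reads n random bits. -/
theorem coins_enough : 5 * (n + m) * n ≤ 5 * inputSize A ^ 2 := by
  have hX : n + m ≤ inputSize A := by rw [← sum_bitLen_le (c := 0) (d := 0)]; omega
  rw [pow_two, mul_assoc]
  exact Nat.mul_le_mul_left _ (Nat.mul_le_mul hX (by omega))

end

/-- The program halts in polynomial time, and its output is given by `Inst.coloring`. -/
theorem exec_spencerProgram (c d : ℕ) : ∃ time : Polynomial ℕ,
    ∀ (n m : ℕ) (A : Fin n → Matrix (Fin m) (Fin m) ℚ) (t : List Bool),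
      5 * inputSize A ^ 2 ≤ t.length → ∃ (k : ℕ) (s : Machine),
        Exec (spencerProgram c d) (inputState A t) k s ∧ k ≤ time.eval (inputSize A) ∧
        ∀ i < n, s.arr 2 i = (Inst.ofMatrices A c d).coloring t (5 * (n + m)) i /
          (Inst.ofMatrices A c d).N := by
  obtain ⟨p, hp⟩ := PolyBounded.spencerWeight c d
    (((PolyBounded.const 4000).mul (PolyBounded.fst.add (.const 1))).mul
      ((PolyBounded.snd.add (.const 1)).pow 3))
  refine ⟨p * ((.C (12 + c) + .C 3 * .X) * (.C 10 * .X + .C 20) + .C 1), fun n m A t ht => ?_⟩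
  have hX : n + m ≤ inputSize A := by rw [← sum_bitLen_le (c := c) (d := d)]; omega
  have hs := small_ofMatrices (A := A) (c := c) (d := d)
  obtain ⟨s, hr, hout⟩ := runs_spencerProgram (I := Inst.ofMatrices A c d) (t := t) hs rfl
    (coins_enough.trans ht) (initState_ofMatrices t)
  have hB : inputSize A ≤ (Inst.ofMatrices A c d).bits (12 + c + 3 * inputSize A) := by
    rw [Inst.bits]; nlinarith
  obtain ⟨-, k, he, hk⟩ := hr (inputState_bounded t hB)
  refine ⟨k, s, he, hk.trans ?_, hout⟩
  simp only [Polynomial.eval_mul, Polynomial.eval_add, Polynomial.eval_C, Polynomial.eval_X]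
  refine Nat.mul_le_mul (hp n m _ (by omega) (by omega)) ?_
  simp only [Inst.bits, Inst.ofMatrices]
  have : 10 * m + 20 ≤ 10 * inputSize A + 20 := by omega
  exact Nat.add_le_add_right (Nat.mul_le_mul_left _ this) 1

end
noncomputable section

/-! ### The local search finds a local minimum -/

namespace Inst
variable {I : Inst} {a : ℕ} {Q : ℤ} {y w g ζ : ℕ → ℤ}

/-- The combination of the matrices given by `ζ`, times the common denominator. -/
def matR (I : Inst) (ζ : ℕ → ℤ) : Matrix (Fin I.m) (Fin I.m) ℝ :=
  Matrix.of fun j k => (I.mat ζ (j * I.m + k) : ℝ)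

theorem gram_cast (r c : Fin I.m) :
    (I.gram ζ r c : ℝ) = ((I.matR ζ).transpose * I.matR ζ) r c := by
  simp [gram, Matrix.mul_apply, matR, Finset.sum_range]

theorem gramPow_cast (p : ℕ) (r c : Fin I.m) :
    (I.gramPow ζ p r c : ℝ) = (((I.matR ζ).transpose * I.matR ζ) ^ (p + 1)) r c := by
  induction p generalizing c with
  | zero => rw [zero_add, pow_one]; exact gram_cast r c
  | succ p ih =>
    rw [pow_succ, Matrix.mul_apply, gramPow, Finset.sum_range]
    push_cast
    exact Finset.sum_congr rfl fun k _ => by rw [ih, gram_cast]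

theorem trace_cast : ((∑ t ∈ Finset.range I.m, I.gramPow ζ I.m t t : ℤ) : ℝ) =
    schatten (I.m + 1) (I.matR ζ) := by
  rw [Finset.sum_range, schatten, Matrix.trace]
  push_cast
  exact Finset.sum_congr rfl fun k _ => gramPow_cast _ _ _

theorem trace_nonneg : 0 ≤ ∑ t ∈ Finset.range I.m, I.gramPow ζ I.m t t := by
  have h := schatten_nonneg (I.m + 1) (I.matR ζ)
  rw [← trace_cast] at h
  exact_mod_cast h

/-- The trace is nonnegative, so only the linear term can be negative. Dividing by Q bounds the
number of accepted moves. -/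
theorem neg_le_objective (hQ : 0 ≤ Q) (hg : ∀ i, |g i| ≤ 1) (hζ : ∀ i, |ζ i| ≤ 2 * I.N) :
    -(16 * (I.n * I.N) * Q) ≤ I.objective a Q g ζ := by
  have h1 : ∑ i ∈ Finset.range I.n, g i * ζ i ≤ I.n * (2 * I.N) := by
    calc ∑ i ∈ Finset.range I.n, g i * ζ i ≤ ∑ i ∈ Finset.range I.n, (2 * I.N : ℤ) :=
          Finset.sum_le_sum fun i _ => by
            refine (le_abs_self _).trans ?_
            rw [abs_mul]
            have := mul_le_mul (hg i) (hζ i) (abs_nonneg _) zero_le_one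
            linarith
      _ = _ := by simp
  have h2 : 0 ≤ 16 * a * I.N * ∑ t ∈ Finset.range I.m, I.gramPow ζ I.m t t :=
    mul_nonneg (by positivity) trace_nonneg
  rw [objective]
  nlinarith

theorem aliveInd_eq (hN : 0 < I.N) {v : ℤ} (hv : |v| ≤ I.N) :
    I.aliveInd v = if |v| < I.N then 1 else 0 := by
  rw [aliveInd, ← abs_mul_abs_self]
  split_ifs with h
  · rw [Int.ediv_eq_zero_of_lt (by positivity) (mul_self_lt_mul_self (abs_nonneg _) h), sub_zero]
  · rw [le_antisymm hv (not_lt.1 h), Int.ediv_self (by positivity), sub_self]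

theorem attempt_cases (v : ℕ) : I.attempt a Q y g w v = w ∨
    I.objective a Q g (fun i => I.attempt a Q y g w v i - y i) + Q ≤
      I.objective a Q g (fun i => w i - y i) := by
  by_cases h : 0 < I.aliveInd (y (I.moveIdx v)) *
      (I.N * I.N + 1 - (w (I.moveIdx v) + moveSign v) * (w (I.moveIdx v) + moveSign v)) ∧
    I.objective a Q g (fun i => Function.update w (I.moveIdx v)
      (w (I.moveIdx v) + moveSign v) i - y i) + Q ≤ I.objective a Q g (fun i => w i - y i)
  · right
    rw [attempt, if_pos h]; exact h.2
  · left
    rw [attempt, if_neg h]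

theorem attempt_add_period (v k : ℕ) :
    I.attempt a Q y g w (2 * I.n * k + v) = I.attempt a Q y g w v := by
  have h1 : I.moveIdx (2 * I.n * k + v) = I.moveIdx v := by
    rw [moveIdx, mul_assoc, Nat.mul_add_div (by norm_num), Nat.mul_add_mod, moveIdx]
  have h2 : moveSign (2 * I.n * k + v) = moveSign v := by
    rw [moveSign, mul_assoc, Nat.mul_add_mod, moveSign]
  simp only [attempt, h1, h2]

theorem objective_search_antitone (hQ : 0 ≤ Q) (v k : ℕ) :
    I.objective a Q g (fun i => I.search a Q y g (v + k) i - y i) ≤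
      I.objective a Q g (fun i => I.search a Q y g v i - y i) := by
  induction k with
  | zero => rfl
  | succ k ih =>
    rw [← add_assoc, search]
    rcases attempt_cases (I := I) (a := a) (Q := Q) (y := y) (g := g)
      (w := I.search a Q y g (v + k)) (v + k) with h | h
    · rw [h]; exact ih
    · linarith

/-- Every attempt either changes nothing or gains Q, so a stretch of attempts is idle throughout or
gains Q in total. -/
theorem search_cycle (hQ : 0 ≤ Q) (v k : ℕ) :
    (∀ j ≤ k, I.search a Q y g (v + j) = I.search a Q y g v) ∨
    I.objective a Q g (fun i => I.search a Q y g (v + k) i - y i) + Q ≤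
      I.objective a Q g (fun i => I.search a Q y g v i - y i) := by
  induction k with
  | zero => left; intro j hj; rw [Nat.le_zero.1 hj, add_zero]
  | succ k ih =>
    rcases ih with h | h
    · rcases attempt_cases (I := I) (a := a) (Q := Q) (y := y) (g := g)
        (w := I.search a Q y g (v + k)) (v + k) with h' | h'
      · left
        intro j hj
        rcases Nat.lt_or_ge j (k + 1) with h1 | h1
        · exact h j (by omega)
        · rw [le_antisymm hj h1, ← add_assoc, search, h', h k le_rfl]
      · right
        rw [← add_assoc, search]
        nth_rewrite 2 [h k le_rfl] at h'
        exact h'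
    · right
      have := objective_search_antitone (I := I) (a := a) (y := y) (g := g) hQ (v + k) 1
      rw [← add_assoc]
      linarith

/-- An idle sweep of 2n attempts has rejected every pair of a coordinate and a sign at the same
point, so by periodicity nothing is accepted later. Otherwise each sweep gains Q. -/
theorem search_stable_or (hQ : 0 ≤ Q) (hn : 0 < I.n) (k : ℕ) :
    (∀ u, I.attempt a Q y g (I.search a Q y g (2 * I.n * k)) u = I.search a Q y g (2 * I.n * k)) ∨
    I.objective a Q g (fun i => I.search a Q y g (2 * I.n * k) i - y i) + k * Q ≤ 0 := by
  induction k with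
  | zero => right; simp [search, objective_zero]
  | succ k ih =>
    rcases ih with h | h
    · left
      have hst : ∀ j, I.search a Q y g (2 * I.n * k + j) = I.search a Q y g (2 * I.n * k) := by
        intro j
        induction j with
        | zero => rfl
        | succ j ih => rw [← add_assoc, search, ih, h]
      rw [show 2 * I.n * (k + 1) = 2 * I.n * k + 2 * I.n by ring, hst]
      exact h
    · rw [show 2 * I.n * (k + 1) = 2 * I.n * k + 2 * I.n by ring]
      rcases search_cycle (I := I) (a := a) (y := y) (g := g) hQ (2 * I.n * k) (2 * I.n) with h' | h'
      · left
        intro u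
        rw [h' _ le_rfl]
        have hu : u % (2 * I.n) < 2 * I.n := Nat.mod_lt _ (by omega)
        have h1 := h' (u % (2 * I.n) + 1) hu
        rw [← add_assoc, search, h' _ hu.le, attempt_add_period] at h1
        rw [← Nat.div_add_mod u (2 * I.n), attempt_add_period]
        exact h1
      · right
        push_cast
        linarith

/-- If all 16nN + 1 sweeps were productive, the objective would fall below its lower bound -16nN·Q.
This explains the number `Inst.moves`. -/
theorem search_moves_stable (hQ : 0 < Q) (hn : 0 < I.n) (hy : ∀ i, |y i| ≤ I.N)
    (hg : ∀ i, |g i| ≤ 1) (u : ℕ) :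
    I.attempt a Q y g (I.search a Q y g I.moves) u = I.search a Q y g I.moves := by
  rcases search_stable_or (I := I) (a := a) (y := y) (g := g) hQ.le hn (16 * (I.n * I.N) + 1)
    with h | h
  · exact h u
  · exfalso
    have h1 := neg_le_objective (I := I) (a := a) (Q := Q) (g := g)
      (ζ := fun i => I.search a Q y g (2 * I.n * (16 * (I.n * I.N) + 1)) i - y i) hQ.le hg
      (fun i => by
        have h1 := abs_sub (I.search a Q y g (2 * I.n * (16 * (I.n * I.N) + 1)) i) (y i)
        have h2 := abs_search_le (a := a) (Q := Q) (g := g) hy (2 * I.n * (16 * (I.n * I.N) + 1)) i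
        have := hy i
        linarith)
    push_cast at h
    nlinarith

theorem objective_search_nonpos (hQ : 0 ≤ Q) (v : ℕ) :
    I.objective a Q g (fun i => I.search a Q y g v i - y i) ≤ 0 := by
  have := objective_search_antitone (I := I) (a := a) (y := y) (g := g) hQ 0 v
  rw [zero_add] at this
  refine this.trans (le_of_eq ?_)
  simp [search, objective_zero]

theorem search_moves_local_min (hQ : 0 < Q) (hN : 0 < I.N) (hy : ∀ i, |y i| ≤ I.N)
    (hg : ∀ i, |g i| ≤ 1) {i : ℕ} (hi : i < I.n) (hyi : |y i| < I.N) {σ : ℤ} (hσ : σ = 1 ∨ σ = -1)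
    (hw : |I.search a Q y g I.moves i + σ| ≤ I.N) :
    I.objective a Q g (fun j => I.search a Q y g I.moves j - y j) - Q <
      I.objective a Q g (fun j => Function.update (I.search a Q y g I.moves) i
        (I.search a Q y g I.moves i + σ) j - y j) := by
  set w := I.search a Q y g I.moves
  -- Attempts 2i and 2i + 1 are the two moves of coordinate i.
  obtain ⟨v, hv, hs⟩ : ∃ v, I.moveIdx v = i ∧ moveSign v = σ := by
    rcases hσ with rfl | rfl
    · refine ⟨2 * i, ?_, ?_⟩
      · rw [moveIdx, Nat.mul_div_cancel_left _ (by norm_num), Nat.mod_eq_of_lt hi]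
      · simp [moveSign]
    · refine ⟨2 * i + 1, ?_, ?_⟩
      · rw [moveIdx, show (2 * i + 1) / 2 = i by omega, Nat.mod_eq_of_lt hi]
      · rw [moveSign, show (2 * i + 1) % 2 = 1 by omega]; rfl
  have h := search_moves_stable (I := I) (a := a) hQ (by omega) hy hg v
  by_contra! hlt
  rw [attempt, if_pos] at h
  · have := congrFun h i
    rw [hv, Function.update_self, hs] at this
    rcases hσ with rfl | rfl <;> linarith
  · rw [hv, hs]
    refine ⟨?_, by linarith⟩
    rw [aliveInd_eq hN hyi.le, if_pos hyi, one_mul]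
    have : (w i + σ) * (w i + σ) ≤ I.N * I.N := by
      rw [← abs_mul_abs_self]; exact mul_self_le_mul_self (abs_nonneg _) hw
    linarith

/-- Coordinates that are tight are never moved. -/
theorem search_eq_of_not_alive (hN : 0 < I.N) (hy : ∀ i, |y i| ≤ I.N) {i : ℕ} (hyi : ¬ |y i| < I.N)
    (v : ℕ) : I.search a Q y g v i = y i := by
  induction v with
  | zero => rfl
  | succ v ih =>
    rw [search, attempt]
    split_ifs with h
    · rw [Function.update_of_ne, ih]
      rintro rfl
      rw [aliveInd_eq hN (hy _), if_neg hyi, zero_mul] at h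
      exact lt_irrefl _ h.1
    · exact ih

end Inst
end
noncomputable section

/-! ### The logarithmic factor -/

namespace Inst
variable {I : Inst}

/-- With floor division, 1 / (k + 1) is 1 for k = 0 and 0 for k > 0, which yields an indicator
without branching. -/
theorem ell_term_eq {a : ℕ} (ha : 0 < a) (j : ℕ) :
    1 - 1 / ((I.m : ℤ) / (a * 2 ^ j) + 1) = if a * 2 ^ j ≤ I.m then 1 else 0 := by
  have hpos : 0 < a * 2 ^ j := by positivity
  split_ifs with h
  · have h1 : 1 ≤ (I.m : ℤ) / (a * 2 ^ j) := by
      exact_mod_cast (Nat.one_le_div_iff hpos).2 h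
    rw [Int.ediv_eq_zero_of_lt (by norm_num) (by linarith), sub_zero]
  · have h1 : (I.m : ℤ) / (a * 2 ^ j) = 0 := by
      exact_mod_cast Nat.div_eq_of_lt (not_le.1 h)
    simp [h1]

/-- J is the least exponent with m < a·2^J. It is at most m, so summing over j < m loses nothing. -/
theorem exists_ell_eq {a : ℕ} (ha : 0 < a) : ∃ J : ℕ, I.ell a = 1 + J ∧ I.m < a * 2 ^ J ∧
    ∀ j < J, a * 2 ^ j ≤ I.m := by
  have hex : ∃ J, I.m < a * 2 ^ J := ⟨I.m, Nat.lt_two_pow_self.trans_le (Nat.le_mul_of_pos_left _ ha)⟩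
  refine ⟨Nat.find hex, ?_, Nat.find_spec hex, fun j hj => not_lt.1 (Nat.find_min hex hj)⟩
  have hJ : Nat.find hex ≤ I.m :=
    Nat.find_min' hex (Nat.lt_two_pow_self.trans_le (Nat.le_mul_of_pos_left _ ha))
  rw [ell]
  simp only [ell_term_eq ha]
  rw [← Finset.sum_filter]
  have : Finset.filter (fun j => a * 2 ^ j ≤ I.m) (Finset.range I.m) =
      Finset.range (Nat.find hex) := by
    ext j
    simp only [Finset.mem_filter, Finset.mem_range]
    constructor
    · rintro ⟨-, h⟩
      by_contra! hj
      have h1 := Nat.find_spec hex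
      have h2 : a * 2 ^ Nat.find hex ≤ a * 2 ^ j :=
        Nat.mul_le_mul_left _ (Nat.pow_le_pow_right (by norm_num) hj)
      omega
    · intro hj
      exact ⟨by omega, not_lt.1 (Nat.find_min hex hj)⟩
  simp [this]

theorem logFactor_le_ell {a : ℕ} (ha : 0 < a) : logFactor a I.m ≤ I.ell a := by
  obtain ⟨J, hJ, h1, -⟩ := exists_ell_eq (I := I) ha
  rw [hJ, logFactor]
  push_cast
  refine max_le (by linarith [(Nat.cast_nonneg J : (0 : ℝ) ≤ J)]) ?_
  rcases Nat.eq_zero_or_pos I.m with hm | hm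
  · simp [hm]; positivity
  have haR : (0 : ℝ) < a := by exact_mod_cast ha
  have hmR : (0 : ℝ) < I.m := by exact_mod_cast hm
  have h2 : (I.m : ℝ) / a ≤ 2 ^ J := by
    rw [div_le_iff₀ haR, mul_comm]; exact_mod_cast h1.le
  calc Real.log (I.m / a) ≤ Real.log (2 ^ J) := Real.log_le_log (by positivity) h2
    _ = J * Real.log 2 := by rw [Real.log_pow]
    _ ≤ J * 1 := mul_le_mul_of_nonneg_left (by linarith [Real.log_two_lt_d9]) (Nat.cast_nonneg J)
    _ ≤ 1 + J := by linarith

/-- Minimality gives 2^(J-1) ≤ m / a for J > 0, so with log 2 > 1/2 the value 1 + J is at most 2 + 2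
log(m / a). -/
theorem ell_le_logFactor {a : ℕ} (ha : 0 < a) : (I.ell a : ℝ) ≤ 4 * logFactor a I.m := by
  obtain ⟨J, hJ, -, h1⟩ := exists_ell_eq (I := I) ha
  rw [hJ]
  push_cast
  have hL := one_le_logFactor a I.m
  rcases J with - | J
  · simp; linarith
  have haR : (0 : ℝ) < a := by exact_mod_cast ha
  have h2 : (2 : ℝ) ^ J ≤ I.m / a := by
    rw [le_div_iff₀ haR, mul_comm]; exact_mod_cast h1 J (by omega)
  have h3 : (J : ℝ) * Real.log 2 ≤ Real.log (I.m / a) := by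
    rw [← Real.log_pow]; exact Real.log_le_log (by positivity) h2
  have h4 : Real.log (I.m / a) ≤ logFactor a I.m := le_max_right _ _
  have h5 := Real.log_two_gt_d9
  have h6 : (J : ℝ) * (1 / 2) ≤ J * Real.log 2 :=
    mul_le_mul_of_nonneg_left (by linarith) (Nat.cast_nonneg J)
  push_cast
  linarith

theorem one_le_ell (a : ℕ) : 1 ≤ I.ell a := (ell_partial_le a _).1

end Inst

/-! ### The objective is the penalty -/

theorem schatten_smul {ι : Type*} [Fintype ι] [DecidableEq ι] (p : ℕ) (t : ℝ) (M : Matrix ι ι ℝ) :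
    schatten p (t • M) = t ^ (2 * p) * schatten p M := by
  rw [schatten, schatten, Matrix.transpose_smul, Matrix.smul_mul, Matrix.mul_smul, smul_smul,
    smul_pow, Matrix.trace_smul, smul_eq_mul, pow_mul, pow_two]

section
variable {n m c d : ℕ} {A : Fin n → Matrix (Fin m) (Fin m) ℚ}

theorem den_dvd_D {u : ℕ} (hu : u < n * (m * m)) :
    (Inst.ofMatrices A c d).den u ∣ (Inst.ofMatrices A c d).D :=
  Finset.dvd_prod_of_mem _ (Finset.mem_range.2 hu)

theorem D_pos : 0 < (Inst.ofMatrices A c d).D :=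
  Finset.prod_pos fun u hu => by
    have := den_pos (A := A) (c := c) (d := d) (u := u) (Finset.mem_range.1 hu)
    omega

theorem matR_eq (ζ : ℕ → ℤ) : (Inst.ofMatrices A c d).matR ζ =
    ((Inst.ofMatrices A c d).D : ℝ) • ∑ i : Fin n, (ζ i : ℝ) • toReal A i := by
  suffices key : ∀ j k : Fin m, (((Inst.ofMatrices A c d).mat ζ (j * m + k) : ℤ) : ℝ) =
      (((Inst.ofMatrices A c d).D : ℝ) • ∑ i : Fin n, (ζ i : ℝ) • toReal A i) j k from Matrix.ext key
  intro j k
  rw [Matrix.smul_apply, Matrix.sum_apply, smul_eq_mul, Finset.mul_sum]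
  simp only [Inst.mat]
  rw [show (Inst.ofMatrices A c d).n = n from rfl, show (Inst.ofMatrices A c d).m = m from rfl,
    Finset.sum_range]
  push_cast
  refine Finset.sum_congr rfl fun i _ => ?_
  have hden : (((Inst.ofMatrices A c d).den (i * (m * m) + (j * m + k)) : ℤ) : ℝ) ≠ 0 := by
    have := den_pos (A := A) (c := c) (d := d) (flat_lt i j k)
    exact_mod_cast (by omega : (Inst.ofMatrices A c d).den (i * (m * m) + (j * m + k)) ≠ 0)
  rw [Int.cast_div (den_dvd_D (flat_lt i j k)) hden, num_flat, den_flat]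
  have hA : toReal A i j k = ((A i j k).num : ℝ) / ((A i j k).den : ℝ) := by
    simp only [toReal, Matrix.map_apply]
    exact Rat.cast_def _
  rw [Matrix.smul_apply, smul_eq_mul, hA]
  push_cast
  ring

/-- Alive coordinates. -/
abbrev Alive (A : Fin n → Matrix (Fin m) (Fin m) ℚ) (c d : ℕ) (y : ℕ → ℤ) : Type :=
  {i : Fin n // |y i| < (Inst.ofMatrices A c d).N}

theorem ofMatrices_N_pos : 0 < (Inst.ofMatrices A c d).N := by
  simp only [Inst.ofMatrices]; positivity

variable {y w g ζ : ℕ → ℤ}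

theorem aliveCount_eq (hy : ∀ i, |y i| ≤ (Inst.ofMatrices A c d).N) :
    (Inst.ofMatrices A c d).aliveCount y = Fintype.card (Alive A c d y) := by
  rw [Inst.aliveCount, show (Inst.ofMatrices A c d).n = n from rfl, Finset.sum_range,
    Fintype.card_subtype, Finset.card_filter]
  push_cast
  exact Finset.sum_congr rfl fun i _ => Inst.aliveInd_eq ofMatrices_N_pos (hy i)

theorem aliveNum_eq (hy : ∀ i, |y i| ≤ (Inst.ofMatrices A c d).N) :
    (Inst.ofMatrices A c d).aliveNum y = Fintype.card (Alive A c d y) := by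
  have := Inst.aliveNum_cast hy
  rw [aliveCount_eq hy] at this
  exact_mod_cast this

theorem sum_alive {M : Type*} [AddCommMonoid M] {f : Fin n → M}
    (hf : ∀ i : Fin n, ¬ |y i| < (Inst.ofMatrices A c d).N → f i = 0) :
    ∑ i, f i = ∑ u : Alive A c d y, f u := by
  rw [← Finset.sum_subtype (Finset.univ.filter fun i : Fin n => |y i| < (Inst.ofMatrices A c d).N)
    (by simp) f, Finset.sum_filter_of_ne]
  intro i _ hi
  by_contra h
  exact hi (hf i h)

/-- The discrepancy allowed in a round with `a` alive coordinates. -/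
def stepBound (A : Fin n → Matrix (Fin m) (Fin m) ℚ) (c d a : ℕ) : ℝ :=
  √(c * a * (Inst.ofMatrices A c d).ell a)

theorem one_le_stepBound {a : ℕ} (hc : 1 ≤ c) (ha : 0 < a) : 1 ≤ stepBound A c d a := by
  rw [stepBound, Real.one_le_sqrt]
  have h1 : (1 : ℝ) ≤ (Inst.ofMatrices A c d).ell a := by exact_mod_cast Inst.one_le_ell a
  have h2 : (1 : ℝ) ≤ c := by exact_mod_cast hc
  have h3 : (1 : ℝ) ≤ a := by exact_mod_cast ha
  exact one_le_mul_of_one_le_of_one_le (one_le_mul_of_one_le_of_one_le h2 h3) h1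

theorem weight_eq {a : ℕ} : ((Inst.ofMatrices A c d).weight a : ℝ) =
    (((Inst.ofMatrices A c d).N : ℝ) * (Inst.ofMatrices A c d).D * stepBound A c d a) ^
      (2 * (m + 1)) := by
  have h1 : (1 : ℝ) ≤ (Inst.ofMatrices A c d).ell a := by exact_mod_cast Inst.one_le_ell a
  rw [pow_mul, mul_pow _ (stepBound A c d a), stepBound, Real.sq_sqrt (by positivity), Inst.weight,
    Inst.weightBase]
  push_cast
  rw [show (Inst.ofMatrices A c d).m = m from rfl, show (Inst.ofMatrices A c d).c = c from rfl]
  congr 1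
  ring

/-- The trace power is homogeneous of degree 2(m + 1), and `weight` is (N·D·Δ)^(2(m+1)), which
clears N, the common denominator D and Δ. In these units the acceptance threshold, one `weight`, is
1 / (8N), as `lt_norm_of_local_min` requires. -/
theorem objective_eq_penalty {a : ℕ} (ha : Fintype.card (Alive A c d y) = a) (ha0 : 0 < a)
    (hc : 1 ≤ c) (hζ : ∀ i : Fin n, ¬ |y i| < (Inst.ofMatrices A c d).N → ζ i = 0) :
    ((Inst.ofMatrices A c d).objective a ((Inst.ofMatrices A c d).weight a) g ζ : ℝ) =
      8 * (Inst.ofMatrices A c d).N * (Inst.ofMatrices A c d).weight a *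
      penalty (fun u : Alive A c d y => toReal A u) (fun u => (g u : ℝ)) (stepBound A c d a) (m + 1)
        (fun u => (ζ u : ℝ) / (Inst.ofMatrices A c d).N) := by
  set N : ℝ := ((Inst.ofMatrices A c d).N : ℝ) with hN
  have hN0 : N ≠ 0 := by
    rw [hN]; exact_mod_cast (ofMatrices_N_pos (A := A) (c := c) (d := d)).ne'
  set D : ℝ := ((Inst.ofMatrices A c d).D : ℝ) with hD
  set Δ := stepBound A c d a with hΔ
  have hΔ0 : Δ ≠ 0 := (zero_lt_one.trans_le (one_le_stepBound hc ha0)).ne'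
  rw [Inst.objective]
  push_cast
  have ht := Inst.trace_cast (I := Inst.ofMatrices A c d) (ζ := ζ)
  push_cast at ht
  rw [ht]
  have hM : (Inst.ofMatrices A c d).matR ζ =
      (N * D * Δ) • (Δ⁻¹ • ∑ u : Alive A c d y, ((ζ u : ℝ) / N) • toReal A u) := by
    rw [matR_eq, sum_alive (y := y) (c := c) (d := d) (fun i hi => by rw [hζ i hi]; simp), smul_smul,
      Finset.smul_sum, Finset.smul_sum]
    refine Finset.sum_congr rfl fun u _ => ?_
    rw [smul_smul, smul_smul]
    congr 1
    rw [← hD]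
    field_simp
  have hs := schatten_smul (m + 1) (N * D * Δ)
    (Δ⁻¹ • ∑ u : Alive A c d y, ((ζ u : ℝ) / N) • toReal A u)
  have hlin : ∑ i ∈ Finset.range (Inst.ofMatrices A c d).n, (g i : ℝ) * (ζ i : ℝ) =
      N * ∑ u : Alive A c d y, (g u : ℝ) * ((ζ u : ℝ) / N) := by
    rw [show (Inst.ofMatrices A c d).n = n from rfl, Finset.sum_range,
      sum_alive (y := y) (c := c) (d := d) (fun i hi => by rw [hζ i hi]; simp), Finset.mul_sum]
    refine Finset.sum_congr rfl fun u _ => ?_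
    field_simp
  rw [← weight_eq] at hs
  rw [hlin, penalty, ha, show schatten ((Inst.ofMatrices A c d).m + 1)
    ((Inst.ofMatrices A c d).matR ζ) = _ from (congrArg (schatten (m + 1)) hM).trans hs]
  ring

end
end
-- From the result of the local search to stuck signs
noncomputable section

section
variable {n m c d : ℕ} {A : Fin n → Matrix (Fin m) (Fin m) ℚ} {y g : ℕ → ℤ} {γ : Fin n → ℤˣ}

/-- The result of the local search from `y` with the signs `g`. -/
def searchResult (A : Fin n → Matrix (Fin m) (Fin m) ℚ) (c d : ℕ) (y g : ℕ → ℤ) : ℕ → ℤ :=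
  (Inst.ofMatrices A c d).search ((Inst.ofMatrices A c d).aliveNum y)
    ((Inst.ofMatrices A c d).weight ((Inst.ofMatrices A c d).aliveNum y)) y g
    (Inst.ofMatrices A c d).moves

theorem weight_pos (hc : 1 ≤ c) {a : ℕ} (ha : 0 < a) : 0 < (Inst.ofMatrices A c d).weight a := by
  have h1 := Inst.one_le_ell (I := Inst.ofMatrices A c d) a
  have h2 := D_pos (A := A) (c := c) (d := d)
  have h3 := ofMatrices_N_pos (A := A) (c := c) (d := d)
  have h4 : 0 < (Inst.ofMatrices A c d).c := hc
  rw [Inst.weight, Inst.weightBase]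
  positivity

theorem abs_searchResult_le (hy : ∀ i, |y i| ≤ (Inst.ofMatrices A c d).N) (i : ℕ) :
    |searchResult A c d y g i| ≤ (Inst.ofMatrices A c d).N :=
  Inst.abs_search_le hy _ _

theorem searchResult_eq (hy : ∀ i, |y i| ≤ (Inst.ofMatrices A c d).N) {i : ℕ}
    (hi : ¬ |y i| < (Inst.ofMatrices A c d).N) : searchResult A c d y g i = y i :=
  Inst.search_eq_of_not_alive ofMatrices_N_pos hy hi _

theorem card_alive_pos_iff (hy : ∀ i, |y i| ≤ (Inst.ofMatrices A c d).N) :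
    0 < (Inst.ofMatrices A c d).aliveNum y ↔ Nonempty (Alive A c d y) := by
  rw [aliveNum_eq hy]; exact Fintype.card_pos_iff

theorem abs_sub_div_le {N : ℕ} (hN : 0 < N) {u v : ℤ} (hu : |u| ≤ N) (hv : |v| ≤ N) :
    |((u - v : ℤ) : ℝ) / N| ≤ 2 := by
  have hNR : (0 : ℝ) < N := by exact_mod_cast hN
  rw [abs_div, abs_of_pos hNR, div_le_iff₀ hNR]
  have h : |u - v| ≤ 2 * N := by
    have := abs_sub u v
    linarith
  exact_mod_cast h

theorem penalty_searchResult_nonpos (hc : 1 ≤ c) (hy : ∀ i, |y i| ≤ (Inst.ofMatrices A c d).N)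
    (ha0 : 0 < (Inst.ofMatrices A c d).aliveNum y) :
    penalty (fun u : Alive A c d y => toReal A u) (fun u => (g u : ℝ))
      (stepBound A c d ((Inst.ofMatrices A c d).aliveNum y)) (m + 1)
      (fun u => ((searchResult A c d y g u - y u : ℤ) : ℝ) / (Inst.ofMatrices A c d).N) ≤ 0 := by
  have hQ := weight_pos (A := A) (d := d) hc ha0
  have hN := ofMatrices_N_pos (A := A) (c := c) (d := d)
  have h := Inst.objective_search_nonpos (I := Inst.ofMatrices A c d)
    (a := (Inst.ofMatrices A c d).aliveNum y) (y := y) (g := g) hQ.le (Inst.ofMatrices A c d).moves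
  have h2 := objective_eq_penalty (g := g) (ζ := fun i => searchResult A c d y g i - y i)
    (aliveNum_eq hy).symm ha0 hc (fun i hi => by rw [searchResult_eq hy hi, sub_self])
  have h3 : (((Inst.ofMatrices A c d).objective ((Inst.ofMatrices A c d).aliveNum y)
      ((Inst.ofMatrices A c d).weight ((Inst.ofMatrices A c d).aliveNum y)) g
      fun i => searchResult A c d y g i - y i : ℤ) : ℝ) ≤ 0 := by exact_mod_cast h
  rw [h2] at h3
  have hQR : (0 : ℝ) < (Inst.ofMatrices A c d).weight ((Inst.ofMatrices A c d).aliveNum y) := by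
    exact_mod_cast hQ
  have hNR : (0 : ℝ) < (Inst.ofMatrices A c d).N := by exact_mod_cast hN
  exact nonpos_of_mul_nonpos_right h3 (by positivity)

/-- Coordinates that are not alive do not move, so the sum runs over alive ones, where nonpositivity
of the penalty bounds the norm. -/
theorem norm_step_le (hc : 1 ≤ c) (hy : ∀ i, |y i| ≤ (Inst.ofMatrices A c d).N)
    (ha0 : 0 < (Inst.ofMatrices A c d).aliveNum y) (hg : ∀ i : Fin n, g i = (γ i : ℤ)) :
    ‖∑ i : Fin n, (((searchResult A c d y g i - y i : ℤ) : ℝ) / (Inst.ofMatrices A c d).N) •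
      toReal A i‖ ≤ stepBound A c d ((Inst.ofMatrices A c d).aliveNum y) := by
  have := (card_alive_pos_iff hy).1 ha0
  rw [sum_alive (y := y) (c := c) (d := d) (A := A)
    (fun i hi => by rw [searchResult_eq hy hi]; simp)]
  exact norm_le_of_penalty_nonpos (fun u => by rw [hg u]; exact abs_int_unit _)
    (zero_lt_one.trans_le (one_le_stepBound hc ha0))
    (fun u => abs_sub_div_le ofMatrices_N_pos (abs_searchResult_le hy _) (hy _))
    (penalty_searchResult_nonpos hc hy ha0)

theorem lt_norm_of_searchResult (hA : ∀ i, ‖toReal A i‖ ≤ 1) (hc : 1 ≤ c)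
    (hy : ∀ i, |y i| ≤ (Inst.ofMatrices A c d).N)
    (ha0 : 0 < (Inst.ofMatrices A c d).aliveNum y) (hg : ∀ i : Fin n, g i = (γ i : ℤ))
    (hg1 : ∀ i, |g i| ≤ 1)
    {q : Alive A c d y → ℝ} (hq0 : ∀ u, 0 ≤ q u)
    (hqT : ∀ u : Alive A c d y, |searchResult A c d y g u| = (Inst.ofMatrices A c d).N → q u = 0)
    (hq1 : ∑ u, q u = 1) :
    stepBound A c d ((Inst.ofMatrices A c d).aliveNum y) /
      (10 * (Inst.ofMatrices A c d).aliveNum y : ℝ) <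
      ‖∑ u : Alive A c d y, (q u * (((γ u : ℤˣ) : ℤ) : ℝ)) • toReal A u‖ := by
  have hne := (card_alive_pos_iff hy).1 ha0
  have hN := ofMatrices_N_pos (A := A) (c := c) (d := d)
  have hF := penalty_searchResult_nonpos (g := g) hc hy ha0
  have hQ := weight_pos (A := A) (d := d) hc ha0
  set N := (Inst.ofMatrices A c d).N with hNdef
  set a := (Inst.ofMatrices A c d).aliveNum y with ha
  set w := searchResult A c d y g with hw
  have hNR : (0 : ℝ) < N := by exact_mod_cast hN
  have hQR : (0 : ℝ) < (Inst.ofMatrices A c d).weight a := by exact_mod_cast hQ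
  have hcard : Fintype.card (Alive A c d y) = a := (aliveNum_eq hy).symm
  have hwN : ∀ i, |w i| ≤ N := abs_searchResult_le hy
  have hyz : ∀ i, (y i : ℝ) / N + ((w i - y i : ℤ) : ℝ) / N = (w i : ℝ) / N := fun i => by
    push_cast; ring
  have habs : ∀ v : ℤ, |(v : ℝ) / N| = ((|v| : ℤ) : ℝ) / N := fun v => by
    rw [abs_div, abs_of_pos hNR, Int.cast_abs]
  have ha_n : a ≤ n := Inst.aliveNum_le (I := Inst.ofMatrices A c d) hy
  have key := lt_norm_of_local_min (A := fun u : Alive A c d y => toReal A u)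
    (g := fun u => (g u : ℝ)) (Δ := stepBound A c d a) (N := N)
    (y := fun u => (y u : ℝ) / N) (z := fun u => ((w u - y u : ℤ) : ℝ) / N) (q := q)
    (by
      rw [hcard]
      change 4000 * a * (m + 1) ^ 3 ≤ 4000 * (n + 1) * (m + 1) ^ 3
      exact Nat.mul_le_mul_right _ (by omega))
    (fun u => hA u) (fun u => by rw [hg u]; exact abs_int_unit _) (one_le_stepBound hc ha0)
    (fun u => by
      rw [habs, div_lt_one hNR]; exact_mod_cast u.2)
    (fun u => by
      rw [hyz, habs, div_le_one hNR]; exact_mod_cast hwN u)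
    (fun u => by
      rw [hyz, habs]
      rcases (hwN u).eq_or_lt with h | h
      · left; rw [h]; push_cast; exact div_self hNR.ne'
      · right
        rw [div_le_iff₀ hNR, sub_mul, one_div, inv_mul_cancel₀ hNR.ne', one_mul]
        have h' : |w u| ≤ N - 1 := by omega
        exact_mod_cast h')
    hF
    (by
      intro u σ hσ hle z' hz' hz''
      obtain ⟨τ, hτ, rfl⟩ : ∃ τ : ℤ, (τ = 1 ∨ τ = -1) ∧ (τ : ℝ) = σ := by
        rcases hσ with rfl | rfl
        · exact ⟨1, Or.inl rfl, by simp⟩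
        · exact ⟨-1, Or.inr rfl, by simp⟩
      have hwτ : |w u + τ| ≤ N := by
        rw [hyz, ← add_div, ← Int.cast_add, habs, div_le_one hNR] at hle
        exact_mod_cast hle
      have h1 := Inst.search_moves_local_min (I := Inst.ofMatrices A c d) (a := a) hQ hN hy hg1
        u.1.2 u.2 hτ hwτ
      change (Inst.ofMatrices A c d).objective a ((Inst.ofMatrices A c d).weight a) g
        (fun j => w j - y j) - (Inst.ofMatrices A c d).weight a <
          (Inst.ofMatrices A c d).objective a ((Inst.ofMatrices A c d).weight a) g
            (fun j => Function.update w u (w u + τ) j - y j) at h1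
      have h2 := objective_eq_penalty (g := g) (ζ := fun i => w i - y i) hcard ha0 hc
        (fun i hi => by rw [hw, searchResult_eq hy hi, sub_self])
      have h3 := objective_eq_penalty (g := g)
        (ζ := fun i => Function.update w u (w u + τ) i - y i) hcard ha0 hc
        (fun i hi => by
          rw [Function.update_of_ne, hw, searchResult_eq hy hi, sub_self]
          intro h
          rw [h] at hi
          exact hi u.2)
      have h4 : z' = fun v : Alive A c d y =>
          ((Function.update w u (w u + τ) v - y v : ℤ) : ℝ) / N := by
        funext v
        by_cases hv : v = u
        · subst hv
          rw [hz', Function.update_self]; push_cast; ring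
        · rw [hz'' v hv, Function.update_of_ne]
          exact fun h => hv (Subtype.ext (Fin.ext h))
      rw [← h4] at h3
      have h5 := (Int.cast_lt (R := ℝ)).2 h1
      rw [Int.cast_sub, h2, h3] at h5
      generalize hp1 : penalty (fun u : Alive A c d y => toReal A u) (fun u => (g u : ℝ))
        (stepBound A c d a) (m + 1) (fun u => ((w u - y u : ℤ) : ℝ) / N) = p₁ at h5 ⊢
      generalize penalty (fun u : Alive A c d y => toReal A u) (fun u => (g u : ℝ))
        (stepBound A c d a) (m + 1) z' = p₂ at h5 ⊢
      change 8 * (N : ℝ) * (Inst.ofMatrices A c d).weight a * p₁ - _ <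
        8 * (N : ℝ) * (Inst.ofMatrices A c d).weight a * p₂ at h5
      have h8 : 0 < 8 * (N : ℝ) * (Inst.ofMatrices A c d).weight a := by positivity
      refine lt_of_mul_lt_mul_left (lt_of_eq_of_lt ?_ h5) h8.le
      field_simp)
    hq0
    (fun u h => hqT u (by
      rw [hyz, habs, div_eq_one_iff_eq hNR.ne'] at h
      exact_mod_cast h))
    hq1
  rw [hcard] at key
  refine key.trans_eq ?_
  congr 1
  exact Finset.sum_congr rfl fun u _ => by rw [hg u]

/-- T consists of the coordinates that became tight in this round. A missed commit means that there
are fewer than a / d ≤ δa of them. Local minimality bounds all combinations off T below by Δ /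
(10a), and Δ² = c·a·ell with c ≥ 100κ² makes this at least κ√(L / a), L being the logarithmic factor
for a matrices. -/
theorem isStuck_of_not_commit (hA : ∀ i, ‖toReal A i‖ ≤ 1) (hc : 1 ≤ c) {κ δ : ℝ}
    (hcκ : 100 * κ ^ 2 ≤ c) (hd : 1 ≤ δ * d)
    (hy : ∀ i, |y i| ≤ (Inst.ofMatrices A c d).N)
    (ha0 : 0 < (Inst.ofMatrices A c d).aliveNum y) (hg : ∀ i : Fin n, g i = (γ i : ℤ))
    (hg1 : ∀ i, |g i| ≤ 1)
    (hcommit : ((d : ℤ) - 1) * (Inst.ofMatrices A c d).aliveCount y <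
      d * (Inst.ofMatrices A c d).aliveCount (searchResult A c d y g)) :
    IsStuck (fun u : Alive A c d y => toReal A u) (fun u => γ u)
      (δ * (Inst.ofMatrices A c d).aliveNum y)
      (κ * √(logFactor ((Inst.ofMatrices A c d).aliveNum y) m /
        (Inst.ofMatrices A c d).aliveNum y)) := by
  classical
  set N := (Inst.ofMatrices A c d).N with hNdef
  set a := (Inst.ofMatrices A c d).aliveNum y with ha
  set w := searchResult A c d y g with hw
  have haR : (0 : ℝ) < a := by exact_mod_cast ha0
  refine ⟨Finset.univ.filter fun u : Alive A c d y => |w u| = N, ?_, fun p hp0 hpT hp1 => ?_⟩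
  · have h1 : (Inst.ofMatrices A c d).aliveCount w +
        (Finset.univ.filter fun u : Alive A c d y => |w u| = N).card = a := by
      have hwN : ∀ i, |w i| ≤ N := abs_searchResult_le hy
      rw [Inst.aliveCount, show (Inst.ofMatrices A c d).n = n from rfl, Finset.sum_range,
        sum_alive (y := y) (c := c) (d := d) (A := A) (fun i hi => by
          rw [Inst.aliveInd_eq ofMatrices_N_pos (hwN i), if_neg]
          rwa [hw, searchResult_eq hy hi]), Finset.card_filter, Nat.cast_sum,
        ← Finset.sum_add_distrib, ha, aliveNum_eq hy, ← Finset.card_univ, Finset.cast_card]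
      refine Finset.sum_congr rfl fun u _ => ?_
      rw [Inst.aliveInd_eq ofMatrices_N_pos (hwN u)]
      rcases (hwN u).eq_or_lt with h | h
      · rw [if_neg (by rw [h]; exact lt_irrefl _), if_pos h]; simp
      · rw [if_pos h, if_neg h.ne]; simp
    rw [← Inst.aliveNum_cast hy] at hcommit
    have h2 : (d : ℤ) * (Finset.univ.filter fun u : Alive A c d y => |w u| = N).card < a := by
      have : (d : ℤ) * ((Inst.ofMatrices A c d).aliveCount w +
        (Finset.univ.filter fun u : Alive A c d y => |w u| = N).card) = d * a := by rw [h1]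
      linarith
    have h3 : (d : ℝ) * (Finset.univ.filter fun u : Alive A c d y => |w u| = N).card ≤ a := by
      exact_mod_cast h2.le
    have hd0 : 0 < (d : ℝ) := by
      rcases Nat.eq_zero_or_pos d with h | h
      · rw [h] at hd; norm_num at hd
      · exact_mod_cast h
    have h4 : (a : ℝ) ≤ δ * d * a := le_mul_of_one_le_left haR.le hd
    exact le_of_mul_le_mul_left (by linarith) hd0
  · have h := lt_norm_of_searchResult hA hc hy ha0 hg hg1 hp0
      (fun u hu => hpT u (Finset.mem_filter.2 ⟨Finset.mem_univ _, hu⟩)) hp1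
    refine le_trans ?_ h.le
    have hL := one_le_logFactor a m
    have hℓ : logFactor a m ≤ (Inst.ofMatrices A c d).ell a :=
      Inst.logFactor_le_ell (I := Inst.ofMatrices A c d) ha0
    rw [← ha, le_div_iff₀ (by positivity), stepBound]
    refine Real.le_sqrt_of_sq_le ?_
    rw [mul_pow, mul_pow, Real.sq_sqrt (by positivity)]
    calc κ ^ 2 * (logFactor a m / a) * (10 * a) ^ 2 = 100 * κ ^ 2 * a * logFactor a m := by
          field_simp; ring
      _ ≤ c * a * logFactor a m := by gcongr
      _ ≤ _ := by gcongr

end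
end
noncomputable section

/-! ### Probability that coordinates remain alive -/

/-- If each step does not increase `alive`, and for at least half of the coins decreases it unless
it is `0`, then after `T` steps it is `0` with probability at least `1 - (3 / 4) ^ T * 2 ^ alive`. -/
theorem card_alive_pos_le {σ : Type*} {n : ℕ} (alive : σ → ℕ) (P : σ → Prop)
    (step : σ → (Fin n → Bool) → σ) (play : ℕ → σ → List Bool → σ) (h0 : ∀ s t, play 0 s t = s)
    (hs : ∀ k s u l, play (k + 1) s (List.ofFn u ++ l) = play k (step s u) l)
    (hP : ∀ s u, P s → P (step s u)) (hmono : ∀ s u, P s → alive (step s u) ≤ alive s)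
    (hdec : ∀ s, P s → 0 < alive s →
      2 ^ n ≤ 2 * (Finset.univ.filter fun u => alive (step s u) < alive s).card)
    (T : ℕ) (s : σ) (L : ℕ) (hsP : P s) (hL : T * n ≤ L) :
    4 ^ T * (Finset.univ.filter fun t : Fin L → Bool => 0 < alive (play T s (List.ofFn t))).card ≤
      3 ^ T * (2 ^ alive s - 1) * 2 ^ L := by
  induction T generalizing s L with
  | zero =>
    simp only [pow_zero, one_mul, h0]
    rcases Nat.eq_zero_or_pos (alive s) with h | h
    · simp [h]
    · have h1 : 2 ^ 1 ≤ 2 ^ alive s := Nat.pow_le_pow_right (by norm_num) h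
      calc _ ≤ (Finset.univ : Finset (Fin L → Bool)).card := Finset.card_filter_le _ _
        _ = 2 ^ L := by simp
        _ ≤ _ := Nat.le_mul_of_pos_left _ (by omega)
  | succ T ih =>
    obtain ⟨L', rfl⟩ : ∃ L', L = n + L' := ⟨L - n, by rw [add_mul] at hL; omega⟩
    have hL' : T * n ≤ L' := by rw [add_mul] at hL; omega
    have hsplit : (Finset.univ.filter fun t : Fin (n + L') → Bool =>
        0 < alive (play (T + 1) s (List.ofFn t))).card = ∑ u : Fin n → Bool,
        (Finset.univ.filter fun t : Fin L' → Bool =>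
          0 < alive (play T (step s u) (List.ofFn t))).card := by
      simp only [Finset.card_filter]
      rw [← (Fin.appendEquiv n L').sum_comp, Fintype.sum_prod_type]
      refine Finset.sum_congr rfl fun u _ => Finset.sum_congr rfl fun t _ => ?_
      rw [show (Fin.appendEquiv n L') (u, t) = Fin.append u t from rfl, List.ofFn_fin_append, hs]
    have h1 : 4 ^ T * ∑ u : Fin n → Bool, (Finset.univ.filter fun t : Fin L' → Bool =>
        0 < alive (play T (step s u) (List.ofFn t))).card ≤
        3 ^ T * (∑ u : Fin n → Bool, (2 ^ alive (step s u) - 1)) * 2 ^ L' := by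
      rw [Finset.mul_sum, Finset.mul_sum, Finset.sum_mul]
      exact Finset.sum_le_sum fun u _ => ih _ _ (hP s u hsP) hL'
    have h2 : 4 * ∑ u : Fin n → Bool, (2 ^ alive (step s u) - 1) ≤ 3 * (2 ^ alive s - 1) * 2 ^ n := by
      -- The potential 2^alive - 1 at least halves whenever a coordinate dies and never grows.
      -- Halving for at least half of the coins gives an average factor of at most 3/4.
      have h3 : ∀ u : Fin n → Bool, 2 * (2 ^ alive (step s u) - 1) +
          (if alive (step s u) < alive s then 2 ^ alive s - 1 else 0) ≤ 2 * (2 ^ alive s - 1) := by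
        intro u
        have h4 : 2 ^ alive (step s u) ≤ 2 ^ alive s :=
          Nat.pow_le_pow_right (by norm_num) (hmono s u hsP)
        split_ifs with h
        · have h5 : 2 ^ (alive (step s u) + 1) ≤ 2 ^ alive s :=
            Nat.pow_le_pow_right (by norm_num) h
          rw [pow_succ] at h5
          omega
        · omega
      have h4 := Finset.sum_le_sum fun u (_ : u ∈ (Finset.univ : Finset (Fin n → Bool))) => h3 u
      rw [Finset.sum_add_distrib, ← Finset.mul_sum, ← Finset.sum_filter, Finset.sum_const,
        Finset.sum_const] at h4
      simp only [smul_eq_mul, Finset.card_univ, Fintype.card_fun, Fintype.card_bool,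
        Fintype.card_fin] at h4
      rcases Nat.eq_zero_or_pos (alive s) with h | h
      · have : 2 ^ alive s - 1 = 0 := by simp [h]
        rw [this] at h4 ⊢
        omega
      · have h5 := Nat.mul_le_mul_right (2 ^ alive s - 1) (hdec s hsP h)
        nlinarith
    rw [hsplit]
    calc 4 ^ (T + 1) * ∑ u : Fin n → Bool, (Finset.univ.filter fun t : Fin L' → Bool =>
          0 < alive (play T (step s u) (List.ofFn t))).card
        = 4 * (4 ^ T * ∑ u : Fin n → Bool, (Finset.univ.filter fun t : Fin L' → Bool =>
          0 < alive (play T (step s u) (List.ofFn t))).card) := by ring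
      _ ≤ 4 * (3 ^ T * (∑ u : Fin n → Bool, (2 ^ alive (step s u) - 1)) * 2 ^ L') :=
          Nat.mul_le_mul_left _ h1
      _ = 3 ^ T * (4 * ∑ u : Fin n → Bool, (2 ^ alive (step s u) - 1)) * 2 ^ L' := by ring
      _ ≤ 3 ^ T * (3 * (2 ^ alive s - 1) * 2 ^ n) * 2 ^ L' :=
          Nat.mul_le_mul_right _ (Nat.mul_le_mul_left _ h2)
      _ = 3 ^ (T + 1) * (2 ^ alive s - 1) * 2 ^ (n + L') := by ring

/-! ### Stuck signs on subsets -/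

/-- Signs as bits. -/
def boolUnits : Bool ≃ ℤˣ where
  toFun b := if b then 1 else -1
  invFun x := decide (x = 1)
  left_inv b := by cases b <;> decide
  right_inv x := by rcases Int.units_eq_one_or x with rfl | rfl <;> decide

theorem IsStuck.comp_equiv {ι ι' : Type*} [Fintype ι] [Fintype ι'] {m : ℕ}
    {A : ι → Matrix (Fin m) (Fin m) ℝ} {g : ι → ℤˣ} {t ε : ℝ} (h : IsStuck A g t ε) (e : ι' ≃ ι) :
    IsStuck (A ∘ e) (g ∘ e) t ε := by
  obtain ⟨T, hT, h⟩ := h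
  refine ⟨T.map e.symm.toEmbedding, by rwa [Finset.card_map], fun p hp0 hpT hp1 => ?_⟩
  have := h (p ∘ e.symm) (fun i => hp0 _)
    (fun i hi => hpT _ (Finset.mem_map_of_mem e.symm.toEmbedding hi))
    (by rw [← hp1]; exact e.symm.sum_comp p)
  refine this.trans_eq ?_
  congr 1
  rw [← e.sum_comp]
  simp

/-- `isStuck_rare` for matrices indexed by any type and for coins. -/
theorem card_isStuck_le {δ κ : ℝ} {m : ℕ}
    (hrare : ∀ (n m : ℕ) (A : Fin n → Matrix (Fin m) (Fin m) ℝ), 0 < n → (∀ i, ‖A i‖ ≤ 1) →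
        2 * ({g | IsStuck A g (δ * n) (κ * √(logFactor n m / n))} : Set (Fin n → ℤˣ)).ncard
          ≤ 2 ^ n)
    {n : ℕ} {p : Fin n → Prop} [DecidablePred p] {A : {i // p i} → Matrix (Fin m) (Fin m) ℝ}
    (hA : ∀ i, ‖A i‖ ≤ 1) {a : ℕ} (ha : Fintype.card {i // p i} = a) (ha0 : 0 < a)
    (G : Finset (Fin n → Bool)) (hG : ∀ u ∈ G, IsStuck A (fun v : {i // p i} => boolUnits (u v))
      (δ * a) (κ * √(logFactor a m / a))) :
    2 * G.card ≤ 2 ^ n := by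
  classical
  obtain ⟨e⟩ : Nonempty (Fin a ≃ {i // p i}) := ⟨(Fintype.equivFinOfCardEq ha).symm⟩
  set S : Set (Fin a → ℤˣ) := {g | IsStuck (A ∘ e) g (δ * a) (κ * √(logFactor a m / a))} with hS
  have h1 : 2 * S.ncard ≤ 2 ^ a := hrare a m (A ∘ e) ha0 fun i => hA _
  have hfin : S.Finite := Set.toFinite _
  -- Stuckness depends only on the bits of the a selected indices; the other n - a bits are free.
  have h2 : G.card ≤ S.ncard * 2 ^ (n - a) := by
    have hb : Fintype.card {i // ¬ p i} = n - a := by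
      rw [Fintype.card_subtype_compl, Fintype.card_fin, ha]
    have hcard : (hfin.toFinset ×ˢ (Finset.univ : Finset ({i // ¬ p i} → Bool))).card =
        S.ncard * 2 ^ (n - a) := by
      rw [Finset.card_product, Set.ncard_eq_toFinset_card S hfin, Finset.card_univ,
        Fintype.card_fun, Fintype.card_bool, hb]
    rw [← hcard]
    refine Finset.card_le_card_of_injOn
      (fun u => (fun i => boolUnits (u (e i)), fun i => u i)) ?_ ?_
    · intro u hu
      simp only [Finset.coe_product, Set.mem_prod, Finset.mem_coe, Set.Finite.mem_toFinset,
        Finset.mem_univ, and_true]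
      exact (hG u hu).comp_equiv e
    · intro u _ u' _ h
      rw [Prod.mk.injEq] at h
      funext i
      by_cases hi : p i
      · have := congrFun h.1 (e.symm ⟨i, hi⟩)
        simpa using this
      · exact congrFun h.2 ⟨i, hi⟩
  have han : a ≤ n := by
    rw [← ha]; exact (Fintype.card_subtype_le _).trans_eq (Fintype.card_fin n)
  calc 2 * G.card ≤ 2 * (S.ncard * 2 ^ (n - a)) := Nat.mul_le_mul_left _ h2
    _ = 2 * S.ncard * 2 ^ (n - a) := by ring
    _ ≤ 2 ^ a * 2 ^ (n - a) := Nat.mul_le_mul_right _ h1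
    _ = 2 ^ n := by rw [← pow_add, Nat.add_sub_cancel' han]

/-! ### The algorithm as a random process -/

namespace Inst

/-- The coloring after `k` rounds from `y`. -/
def play (I : Inst) : ℕ → (ℕ → ℤ) → List Bool → ℕ → ℤ
  | 0, y, _ => y
  | k + 1, y, t => play I k (I.round y (signs I.n t)) (t.drop I.n)

/-- The program appends rounds at the end, as in `coloring`, whereas the probability estimate
conditions on the coins of the first round, as in `play`. This identity reconciles the two
recursions. -/
theorem play_succ (I : Inst) (k : ℕ) (y : ℕ → ℤ) (t : List Bool) :
    I.play (k + 1) y t = I.round (I.play k y t) (signs I.n (t.drop (k * I.n))) := by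
  induction k generalizing y t with
  | zero => simp [play]
  | succ k ih =>
    rw [play, ih, play, List.drop_drop, show I.n + k * I.n = (k + 1) * I.n by ring]

theorem coloring_eq_play (I : Inst) (k : ℕ) (t : List Bool) :
    I.coloring t k = I.play k (fun _ => 0) t := by
  induction k with
  | zero => rfl
  | succ k ih => rw [coloring, play_succ, ih]

end Inst

theorem signs_ofFn_append {n : ℕ} (u : Fin n → Bool) (l : List Bool) (i : Fin n) :
    signs n (List.ofFn u ++ l) i = ((boolUnits (u i) : ℤˣ) : ℤ) := by
  rw [signs, if_pos i.2, List.getD_append _ _ _ _ (by simp),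
    List.getD_eq_getElem _ _ (by simp), List.getElem_ofFn]
  cases u i <;> simp [boolUnits]

theorem signs_ofFn_append' {n : ℕ} (u : Fin n → Bool) (l : List Bool) :
    signs n (List.ofFn u ++ l) = signs n (List.ofFn u) := by
  funext i
  by_cases hi : i < n
  · rw [signs_ofFn_append u l ⟨i, hi⟩]
    have := signs_ofFn_append u [] ⟨i, hi⟩
    rw [List.append_nil] at this
    exact this.symm
  · rw [signs, signs, if_neg hi, if_neg hi]

section
variable {n m c d : ℕ} {A : Fin n → Matrix (Fin m) (Fin m) ℚ} {y : ℕ → ℤ}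

theorem round_ofMatrices (y g : ℕ → ℤ) : (Inst.ofMatrices A c d).round y g =
    if (d : ℤ) * (Inst.ofMatrices A c d).aliveCount (searchResult A c d y g) ≤
      (d - 1) * (Inst.ofMatrices A c d).aliveCount y then searchResult A c d y g else y := rfl

theorem aliveNum_round_le (hd : 1 ≤ d) (hy : ∀ i, |y i| ≤ (Inst.ofMatrices A c d).N) (g : ℕ → ℤ) :
    (Inst.ofMatrices A c d).aliveNum ((Inst.ofMatrices A c d).round y g) ≤
      (Inst.ofMatrices A c d).aliveNum y := by
  rw [round_ofMatrices]
  split_ifs with h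
  · rw [← Inst.aliveNum_cast hy, ← Inst.aliveNum_cast (abs_searchResult_le hy)] at h
    have hd' : (1 : ℤ) ≤ d := by exact_mod_cast hd
    have h1 : (d : ℤ) * (Inst.ofMatrices A c d).aliveNum (searchResult A c d y g) ≤
        d * (Inst.ofMatrices A c d).aliveNum y := by
      have : (0 : ℤ) ≤ (Inst.ofMatrices A c d).aliveNum y := Nat.cast_nonneg _
      linarith
    exact_mod_cast le_of_mul_le_mul_left h1 (by linarith)
  · exact le_rfl

theorem aliveNum_searchResult_lt (hd : 1 ≤ d) (hy : ∀ i, |y i| ≤ (Inst.ofMatrices A c d).N)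
    (ha : 0 < (Inst.ofMatrices A c d).aliveNum y) {g : ℕ → ℤ}
    (h : (d : ℤ) * (Inst.ofMatrices A c d).aliveCount (searchResult A c d y g) ≤
      (d - 1) * (Inst.ofMatrices A c d).aliveCount y) :
    (Inst.ofMatrices A c d).aliveNum (searchResult A c d y g) <
      (Inst.ofMatrices A c d).aliveNum y := by
  rw [← Inst.aliveNum_cast hy, ← Inst.aliveNum_cast (abs_searchResult_le hy)] at h
  have hd' : (1 : ℤ) ≤ d := by exact_mod_cast hd
  have h1 : (d : ℤ) * (Inst.ofMatrices A c d).aliveNum (searchResult A c d y g) <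
      d * (Inst.ofMatrices A c d).aliveNum y := by
    have : (0 : ℤ) < (Inst.ofMatrices A c d).aliveNum y := by exact_mod_cast ha
    linarith
  exact_mod_cast lt_of_mul_lt_mul_left h1 (by linarith)

theorem card_alive_after_rounds_le {δ κ : ℝ}
    (hrare : ∀ (n m : ℕ) (A : Fin n → Matrix (Fin m) (Fin m) ℝ), 0 < n → (∀ i, ‖A i‖ ≤ 1) →
        2 * ({g | IsStuck A g (δ * n) (κ * √(logFactor n m / n))} : Set (Fin n → ℤˣ)).ncard
          ≤ 2 ^ n)
    (hA : ∀ i, ‖toReal A i‖ ≤ 1) (hc : 1 ≤ c) (hcκ : 100 * κ ^ 2 ≤ c) (hd1 : 1 ≤ d)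
    (hd : 1 ≤ δ * d) (T L : ℕ) (hL : T * n ≤ L) :
    4 ^ T * (Finset.univ.filter fun t : Fin L → Bool => 0 < (Inst.ofMatrices A c d).aliveNum
      ((Inst.ofMatrices A c d).coloring (List.ofFn t) T)).card ≤ 3 ^ T * 2 ^ n * 2 ^ L := by
  have h := card_alive_pos_le (n := n) (Inst.ofMatrices A c d).aliveNum
    (fun y => ∀ i, |y i| ≤ (Inst.ofMatrices A c d).N)
    (fun y u => (Inst.ofMatrices A c d).round y (signs n (List.ofFn u)))
    (Inst.ofMatrices A c d).play (fun _ _ => rfl)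
    (fun k y u l => by
      rw [Inst.play, show (Inst.ofMatrices A c d).n = n from rfl, signs_ofFn_append',
        List.drop_append_of_le_length (by simp), List.drop_of_length_le (by simp), List.nil_append])
    (fun y u hy => Inst.abs_round_le hy) (fun y u hy => aliveNum_round_le hd1 hy _)
    (fun y hy ha => by
      -- Coins for which no coordinate dies are coins whose round was not committed, hence stuck
      -- ones.
      have hstuck := card_isStuck_le hrare (p := fun i : Fin n => |y i| < (Inst.ofMatrices A c d).N)
        (A := fun u : Alive A c d y => toReal A u) (fun u => hA u) (aliveNum_eq hy).symm ha
        (Finset.univ.filter fun u : Fin n → Bool => ¬ (Inst.ofMatrices A c d).aliveNum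
          ((Inst.ofMatrices A c d).round y (signs n (List.ofFn u))) <
            (Inst.ofMatrices A c d).aliveNum y)
        (fun u hu => by
          refine isStuck_of_not_commit (γ := fun i => boolUnits (u i)) hA hc hcκ hd hy ha
            (fun i => by simpa using signs_ofFn_append u [] i) (abs_signs_le n (List.ofFn u)) ?_
          by_contra! h
          refine (Finset.mem_filter.1 hu).2 ?_
          rw [round_ofMatrices, if_pos h]
          exact aliveNum_searchResult_lt hd1 hy ha h)
      have htot := Finset.card_filter_add_card_filter_not (s := (Finset.univ : Finset (Fin n → Bool)))
        (fun u => (Inst.ofMatrices A c d).aliveNum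
          ((Inst.ofMatrices A c d).round y (signs n (List.ofFn u))) <
            (Inst.ofMatrices A c d).aliveNum y)
      rw [Finset.card_univ, Fintype.card_fun, Fintype.card_bool, Fintype.card_fin] at htot
      omega)
    T (fun _ => 0) L (fun i => by simp) hL
  simp only [Inst.coloring_eq_play]
  refine h.trans (Nat.mul_le_mul_right _ (Nat.mul_le_mul_left _ ((Nat.sub_le _ _).trans ?_)))
  exact Nat.pow_le_pow_right (by norm_num)
    (Inst.aliveNum_le (I := Inst.ofMatrices A c d) (y := fun _ => 0) (by simp))

end
end
noncomputable section

/-! ### The discrepancy of the coloring -/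

/-- Up to a constant, a bound on the discrepancy incurred from `a` alive coordinates on. -/
def futureBound (n m a : ℕ) : ℝ := √(√(a * n)) * √(logFactor n m)

theorem futureBound_self (n m : ℕ) : futureBound n m n = spencerBound n m := by
  rw [futureBound, spencerBound_eq, Real.sqrt_mul_self (Nat.cast_nonneg n),
    ← Real.sqrt_mul (Nat.cast_nonneg n)]

theorem futureBound_mono {n m a a' : ℕ} (h : a ≤ a') : futureBound n m a ≤ futureBound n m a' := by
  have : (a : ℝ) ≤ a' := by exact_mod_cast h
  rw [futureBound, futureBound]
  gcongr

theorem futureBound_nonneg (n m a : ℕ) : 0 ≤ futureBound n m a := by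
  rw [futureBound]; positivity

/-- Passing from n to a matrices increases the logarithm by log(n / a) ≤ 2√(n / a), and a·√(n / a) =
√(an). The growing logarithm is thus absorbed by giving up half of the decay in a. -/
theorem mul_logFactor_le {n m a : ℕ} (ha : 0 < a) (han : a ≤ n) :
    a * logFactor a m ≤ 3 * √(a * n) * logFactor n m := by
  have haR : (0 : ℝ) < a := by exact_mod_cast ha
  have hanR : (a : ℝ) ≤ n := by exact_mod_cast han
  have hnR : (0 : ℝ) < n := haR.trans_le hanR
  have hL := one_le_logFactor n m
  have ha_le : (a : ℝ) ≤ √(a * n) := Real.le_sqrt_of_sq_le (by nlinarith)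
  have hs : 0 ≤ √((a : ℝ) * n) := Real.sqrt_nonneg _
  have key : logFactor a m ≤ logFactor n m + 2 * √(n / a) := by
    have h0 : 0 ≤ √((n : ℝ) / a) := Real.sqrt_nonneg _
    refine max_le (by linarith) ?_
    rcases Nat.eq_zero_or_pos m with hm | hm
    · rw [hm, Nat.cast_zero, zero_div, Real.log_zero]; rw [hm] at hL; linarith
    have hmR : (0 : ℝ) < m := by exact_mod_cast hm
    have h1 : Real.log (m / a) = Real.log (m / n) + Real.log (n / a) := by
      rw [← Real.log_mul (by positivity) (by positivity)]
      congr 1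
      field_simp
    have h2 : Real.log (n / a) ≤ 2 * √(n / a) := by
      have h3 : Real.log √(n / a) ≤ √(n / a) - 1 :=
        Real.log_le_sub_one_of_pos (Real.sqrt_pos.2 (by positivity))
      rw [Real.log_sqrt (by positivity)] at h3
      linarith
    have h3 : Real.log (m / n) ≤ logFactor n m := le_max_right _ _
    linarith
  have h4 : a * √((n : ℝ) / a) = √(a * n) := by
    rw [show (a : ℝ) * n = a ^ 2 * (n / a) by field_simp, Real.sqrt_mul (by positivity),
      Real.sqrt_sq haR.le]
  calc a * logFactor a m ≤ a * (logFactor n m + 2 * √(n / a)) :=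
        mul_le_mul_of_nonneg_left key haR.le
    _ = a * logFactor n m + 2 * √(a * n) := by rw [← h4]; ring
    _ ≤ √(a * n) * logFactor n m + 2 * √(a * n) * logFactor n m := by
        refine add_le_add (mul_le_mul_of_nonneg_right ha_le (by linarith)) ?_
        exact le_mul_of_one_le_right (by positivity) hL
    _ = _ := by ring

/-- With x = 1 / (4d), Bernoulli gives 1 - 1/d = 1 - 4x ≤ (1 - x)⁴; then take fourth roots. -/
theorem futureBound_le_of_progress {n m a a' d : ℕ} (hd : 1 ≤ d)
    (h : (d : ℤ) * a' ≤ (d - 1) * a) :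
    futureBound n m a' ≤ (1 - 1 / (4 * d)) * futureBound n m a := by
  have hdR : (1 : ℝ) ≤ d := by exact_mod_cast hd
  have hd0 : (0 : ℝ) < d := by linarith
  have h' : (d : ℝ) * a' ≤ (d - 1) * a := by exact_mod_cast h
  set x : ℝ := 1 / (4 * d) with hx
  have hx0 : 0 < x := by positivity
  have hx1 : x ≤ 1 := by
    rw [hx, div_le_one (by positivity)]; linarith
  have hxd : 4 * d * x = 1 := by rw [hx]; field_simp
  have h1 : 1 - 4 * x ≤ (1 - x) ^ 4 := by
    have := one_add_mul_le_pow (a := -x) (by linarith) 4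
    push_cast at this
    calc 1 - 4 * x = 1 + 4 * -x := by ring
      _ ≤ (1 + -x) ^ 4 := this
      _ = (1 - x) ^ 4 := by ring
  have h2 : (a' : ℝ) ≤ (1 - 4 * x) * a := by
    refine le_of_mul_le_mul_left ?_ hd0
    calc (d : ℝ) * a' ≤ (d - 1) * a := h'
      _ = (d - 4 * d * x) * a := by rw [hxd]
      _ = _ := by ring
  have h3 : (a' : ℝ) * n ≤ ((1 - x) ^ 2) ^ 2 * (a * n) := by
    have : (a' : ℝ) ≤ (1 - x) ^ 4 * a :=
      h2.trans (mul_le_mul_of_nonneg_right h1 (Nat.cast_nonneg a))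
    calc (a' : ℝ) * n ≤ ((1 - x) ^ 4 * a) * n := mul_le_mul_of_nonneg_right this (Nat.cast_nonneg n)
      _ = _ := by ring
  have h4 : √(a' * n) ≤ (1 - x) ^ 2 * √(a * n) := by
    calc √(a' * n) ≤ √(((1 - x) ^ 2) ^ 2 * (a * n)) := Real.sqrt_le_sqrt h3
      _ = _ := by rw [Real.sqrt_mul (by positivity), Real.sqrt_sq (by positivity)]
  have h5 : √(√(a' * n)) ≤ (1 - x) * √(√(a * n)) := by
    calc √(√(a' * n)) ≤ √((1 - x) ^ 2 * √(a * n)) := Real.sqrt_le_sqrt h4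
      _ = _ := by rw [Real.sqrt_mul (by positivity), Real.sqrt_sq (by linarith)]
  rw [futureBound, futureBound, ← mul_assoc]
  exact mul_le_mul_of_nonneg_right h5 (Real.sqrt_nonneg _)

section
variable {n m c d : ℕ} {A : Fin n → Matrix (Fin m) (Fin m) ℚ} {y : ℕ → ℤ}

/-- The matrix combination given by a coloring with values in `ℤ / N`. -/
def combination (A : Fin n → Matrix (Fin m) (Fin m) ℚ) (c d : ℕ) (y : ℕ → ℤ) :
    Matrix (Fin m) (Fin m) ℝ :=
  ∑ i : Fin n, ((y i : ℝ) / (Inst.ofMatrices A c d).N) • toReal A i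

/-- The 12 is the factor 4 between `ell` and the logarithmic factor times the 3 of
`mul_logFactor_le`. -/
theorem stepBound_le {a : ℕ} (ha : 0 < a) (han : a ≤ n) :
    stepBound A c d a ≤ √(12 * c) * futureBound n m a := by
  have h1 := Inst.ell_le_logFactor (I := Inst.ofMatrices A c d) ha
  have h2 := mul_logFactor_le (m := m) ha han
  have hL := one_le_logFactor n m
  change (((Inst.ofMatrices A c d).ell a : ℤ) : ℝ) ≤ 4 * logFactor a m at h1
  rw [futureBound, ← Real.sqrt_mul (Real.sqrt_nonneg _), ← Real.sqrt_mul (by positivity), stepBound]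
  refine Real.sqrt_le_sqrt ?_
  calc (c : ℝ) * a * (Inst.ofMatrices A c d).ell a ≤ c * a * (4 * logFactor a m) := by gcongr
    _ = 4 * c * (a * logFactor a m) := by ring
    _ ≤ 4 * c * (3 * √(a * n) * logFactor n m) := by gcongr
    _ = _ := by ring

/-- A potential argument in place of a geometric series: a committed round adds at most
√(12c)·`futureBound` to the norm, and by `futureBound_le_of_progress` the second summand loses at
least this amount. Discarded rounds change nothing. -/
theorem norm_combination_round_le (hc : 1 ≤ c) (hd : 1 ≤ d)
    (hy : ∀ i, |y i| ≤ (Inst.ofMatrices A c d).N) (t : List Bool) :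
    ‖combination A c d ((Inst.ofMatrices A c d).round y (signs n t))‖ +
        4 * d * √(12 * c) * futureBound n m ((Inst.ofMatrices A c d).aliveNum
          ((Inst.ofMatrices A c d).round y (signs n t))) ≤
      ‖combination A c d y‖ +
        4 * d * √(12 * c) * futureBound n m ((Inst.ofMatrices A c d).aliveNum y) := by
  have hd0 : (0 : ℝ) < d := by exact_mod_cast hd
  by_cases h : (d : ℤ) * (Inst.ofMatrices A c d).aliveCount (searchResult A c d y (signs n t)) ≤
      (d - 1) * (Inst.ofMatrices A c d).aliveCount y
  swap
  · rw [round_ofMatrices, if_neg h]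
  have hle := aliveNum_round_le (g := signs n t) hd hy
  rw [round_ofMatrices, if_pos h] at hle ⊢
  set w := searchResult A c d y (signs n t) with hw
  rcases Nat.eq_zero_or_pos ((Inst.ofMatrices A c d).aliveNum y) with ha | ha
  · have hcomb : combination A c d w = combination A c d y := by
      refine Finset.sum_congr rfl fun i _ => ?_
      rw [hw, searchResult_eq hy]
      intro hi
      have := (card_alive_pos_iff hy).2 ⟨⟨i, hi⟩⟩
      omega
    rw [hcomb, Nat.le_antisymm (hle.trans ha.le) (Nat.zero_le _), ha]
  · have hstep : ‖combination A c d w - combination A c d y‖ ≤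
        √(12 * c) * futureBound n m ((Inst.ofMatrices A c d).aliveNum y) := by
      have h1 := norm_step_le (g := signs n t)
        (γ := fun i : Fin n => if t.getD i false then 1 else -1) hc hy ha (fun i => by
          rw [signs, if_pos i.2]; split_ifs <;> simp)
      have h2 : ∑ i : Fin n, (((w i - y i : ℤ) : ℝ) / (Inst.ofMatrices A c d).N) • toReal A i =
          combination A c d w - combination A c d y := by
        rw [combination, combination, ← Finset.sum_sub_distrib]
        refine Finset.sum_congr rfl fun i _ => ?_
        rw [← sub_smul]; push_cast; congr 1; ring
      rw [← h2]
      exact h1.trans (stepBound_le ha (Inst.aliveNum_le (I := Inst.ofMatrices A c d) hy))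
    rw [← Inst.aliveNum_cast hy, ← Inst.aliveNum_cast (abs_searchResult_le hy)] at h
    have hf := futureBound_le_of_progress (n := n) (m := m) hd h
    have htri : ‖combination A c d w‖ ≤ ‖combination A c d y‖ +
        ‖combination A c d w - combination A c d y‖ := by
      have := norm_add_le (combination A c d y) (combination A c d w - combination A c d y)
      rwa [add_sub_cancel] at this
    have hmul := mul_le_mul_of_nonneg_left hf (by positivity : (0 : ℝ) ≤ 4 * d * √(12 * c))
    have he : 4 * (d : ℝ) * √(12 * c) * ((1 - 1 / (4 * d)) *
        futureBound n m ((Inst.ofMatrices A c d).aliveNum y)) =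
        4 * d * √(12 * c) * futureBound n m ((Inst.ofMatrices A c d).aliveNum y) -
          √(12 * c) * futureBound n m ((Inst.ofMatrices A c d).aliveNum y) := by
      field_simp
    linarith

theorem norm_combination_coloring_le (hc : 1 ≤ c) (hd : 1 ≤ d) (t : List Bool) (k : ℕ) :
    ‖combination A c d ((Inst.ofMatrices A c d).coloring t k)‖ ≤
      4 * d * √(12 * c) * spencerBound n m := by
  have key : ‖combination A c d ((Inst.ofMatrices A c d).coloring t k)‖ +
      4 * d * √(12 * c) * futureBound n m ((Inst.ofMatrices A c d).aliveNum
        ((Inst.ofMatrices A c d).coloring t k)) ≤ 4 * d * √(12 * c) * spencerBound n m := by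
    induction k with
    | zero =>
      have h0 : combination A c d ((Inst.ofMatrices A c d).coloring t 0) = 0 := by
        simp [combination, Inst.coloring]
      rw [h0, norm_zero, zero_add, ← futureBound_self]
      exact mul_le_mul_of_nonneg_left (futureBound_mono
        (Inst.aliveNum_le (I := Inst.ofMatrices A c d) (Inst.abs_coloring_le 0))) (by positivity)
    | succ k ih =>
      exact (norm_combination_round_le hc hd (Inst.abs_coloring_le k) _).trans ih
  have := mul_nonneg (by positivity : (0 : ℝ) ≤ 4 * d * √(12 * c))
    (futureBound_nonneg n m ((Inst.ofMatrices A c d).aliveNum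
        ((Inst.ofMatrices A c d).coloring t k)))
  linarith

/-- Once nothing is alive all coordinates are ±N, so the integer division by N in the output is
exact. -/
theorem outputsSigning_of_not_alive (hc : 1 ≤ c) (hd : 1 ≤ d) {t : List Bool} {k : ℕ}
    (h : ¬ 0 < (Inst.ofMatrices A c d).aliveNum ((Inst.ofMatrices A c d).coloring t k))
    {s : Machine} (hs : ∀ i < n, s.arr 2 i = (Inst.ofMatrices A c d).coloring t k i /
      (Inst.ofMatrices A c d).N) :
    OutputsSigning A (4 * d * √(12 * c) * spencerBound n m) s := by
  have hN := ofMatrices_N_pos (A := A) (c := c) (d := d)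
  set N := (Inst.ofMatrices A c d).N with hNdef
  have hNZ : (N : ℤ) ≠ 0 := by exact_mod_cast hN.ne'
  have hNR : (N : ℝ) ≠ 0 := by exact_mod_cast hN.ne'
  set y := (Inst.ofMatrices A c d).coloring t k with hy
  have hyN : ∀ i, |y i| ≤ N := Inst.abs_coloring_le k
  have hx : ∀ i : Fin n, ∃ x : ℤˣ, y i = x * N := by
    intro i
    have hi : ¬ |y i| < N := fun hi => h ((card_alive_pos_iff hyN).2 ⟨⟨i, hi⟩⟩)
    have h1 : |y i| = N := le_antisymm (hyN i) (not_lt.1 hi)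
    rcases abs_choice (y i) with h2 | h2
    · exact ⟨1, by rw [← h1, h2]; simp⟩
    · exact ⟨-1, by rw [← h1, h2]; simp⟩
  choose x hx using hx
  refine ⟨x, fun i => ?_, ?_⟩
  · rw [hs i i.2, hx, Int.mul_ediv_cancel _ hNZ]
  · have h2 := norm_combination_coloring_le (A := A) hc hd t k
    rw [signedNorm]
    refine le_of_eq_of_le ?_ h2
    congr 1
    refine Finset.sum_congr rfl fun i _ => ?_
    change _ = ((y i : ℝ) / N) • _
    rw [hx]; push_cast
    rw [mul_div_cancel_right₀ _ hNR]

end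
end
-- Success probability of the program and signings of real matrices
noncomputable section

theorem OutputsSigning.mono {n m : ℕ} {A : Fin n → Matrix (Fin m) (Fin m) ℚ} {D D' : ℝ}
    {s : Machine} (h : OutputsSigning A D s) (hD : D ≤ D') : OutputsSigning A D' s :=
  let ⟨x, h1, h2⟩ := h
  ⟨x, h1, h2.trans hD⟩

/-- The number 5(n + m) of rounds is chosen for 3⁵ · 2 · 2 = 972 ≤ 1024 = 4⁵: one factor 2 pays for
the initial potential, the other for the failure probability. -/
theorem three_quarters_pow_le (n m : ℕ) :
    3 ^ (5 * (n + m)) * 2 ^ n * 2 ^ (n + m) ≤ 4 ^ (5 * (n + m)) := by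
  calc 3 ^ (5 * (n + m)) * 2 ^ n * 2 ^ (n + m)
      ≤ 3 ^ (5 * (n + m)) * 2 ^ (n + m) * 2 ^ (n + m) :=
        Nat.mul_le_mul_right _ (Nat.mul_le_mul_left _ (Nat.pow_le_pow_right (by norm_num) (by omega)))
    _ = 972 ^ (n + m) := by
        rw [pow_mul, ← mul_pow, ← mul_pow]; norm_num
    _ ≤ 1024 ^ (n + m) := Nat.pow_le_pow_left (by norm_num) _
    _ = 4 ^ (5 * (n + m)) := by rw [pow_mul]; norm_num

theorem spencerProgram_findsSignings {δ κ : ℝ}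
    (hrare : ∀ (n m : ℕ) (A : Fin n → Matrix (Fin m) (Fin m) ℝ), 0 < n → (∀ i, ‖A i‖ ≤ 1) →
        2 * ({g | IsStuck A g (δ * n) (κ * √(logFactor n m / n))} : Set (Fin n → ℤˣ)).ncard
          ≤ 2 ^ n)
    {c d : ℕ} (hc : 1 ≤ c) (hcκ : 100 * κ ^ 2 ≤ c) (hd1 : 1 ≤ d) (hd : 1 ≤ δ * d)
    {C : ℝ} (hC : 4 * d * √(12 * c) ≤ C) :
    FindsSigningsInPolyTime (spencerProgram c d) C := by
  classical
  obtain ⟨time, htime⟩ := exec_spencerProgram c d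
  refine ⟨time, .C 5 * .X ^ 2, fun n m A hA => ?_⟩
  have hcoins : (Polynomial.C 5 * Polynomial.X ^ 2 : Polynomial ℕ).eval (inputSize A) =
      5 * inputSize A ^ 2 := by simp
  rw [hcoins]
  set L := 5 * inputSize A ^ 2 with hL
  refine ⟨fun t => ?_, ?_⟩
  · obtain ⟨k, s, h1, h2, -⟩ := htime n m A (List.ofFn t) (by simp [hL])
    exact ⟨k, s, h1, h2⟩
  · have hbad := card_alive_after_rounds_le hrare hA hc hcκ hd1 hd (5 * (n + m)) L coins_enough
    set B := Finset.univ.filter fun t : Fin L → Bool => 0 < (Inst.ofMatrices A c d).aliveNum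
      ((Inst.ofMatrices A c d).coloring (List.ofFn t) (5 * (n + m))) with hB
    have hsub : ((Bᶜ : Finset (Fin L → Bool)) : Set (Fin L → Bool)) ⊆
        {t : Fin L → Bool | ∃ (k : ℕ) (s : Machine),
          Exec (spencerProgram c d) (inputState A (List.ofFn t)) k s ∧
            OutputsSigning A (C * spencerBound n m) s} := by
      intro t ht
      simp only [hB, Finset.coe_compl, Set.mem_compl_iff, Finset.mem_coe, Finset.mem_filter,
        Finset.mem_univ, true_and] at ht
      obtain ⟨k, s, h1, -, h2⟩ := htime n m A (List.ofFn t) (by simp [hL])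
      exact ⟨k, s, h1, (outputsSigning_of_not_alive hc hd1 ht h2).mono
        (mul_le_mul_of_nonneg_right hC (Real.sqrt_nonneg _))⟩
    have hcard := Set.ncard_le_ncard hsub (Set.toFinite _)
    rw [Set.ncard_coe_finset, Finset.card_compl] at hcard
    have htot : Fintype.card (Fin L → Bool) = 2 ^ L := by simp
    rw [htot] at hcard
    have hB' : B.card * 2 ^ (n + m) ≤ 2 ^ L := by
      refine Nat.le_of_mul_le_mul_left ?_ (by positivity : 0 < 4 ^ (5 * (n + m)))
      calc 4 ^ (5 * (n + m)) * (B.card * 2 ^ (n + m))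
          = 4 ^ (5 * (n + m)) * B.card * 2 ^ (n + m) := by ring
        _ ≤ 3 ^ (5 * (n + m)) * 2 ^ n * 2 ^ L * 2 ^ (n + m) := Nat.mul_le_mul_right _ hbad
        _ = 3 ^ (5 * (n + m)) * 2 ^ n * 2 ^ (n + m) * 2 ^ L := by ring
        _ ≤ 4 ^ (5 * (n + m)) * 2 ^ L := Nat.mul_le_mul_right _ (three_quarters_pow_le n m)
    have hB'' : (B.card : ℝ) ≤ 1 / 2 ^ (n + m) * 2 ^ L := by
      rw [one_div, inv_mul_eq_div, le_div_iff₀ (by positivity)]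
      exact_mod_cast hB'
    have hle : (2 : ℝ) ^ L - B.card ≤ ((2 ^ L - B.card : ℕ) : ℝ) := by
      have h : B.card ≤ 2 ^ L := by rw [← htot]; exact Finset.card_le_univ B
      rw [Nat.cast_sub h]; push_cast; exact le_rfl
    calc (1 - 1 / 2 ^ (n + m)) * (2 : ℝ) ^ L = 2 ^ L - 1 / 2 ^ (n + m) * 2 ^ L := by ring
      _ ≤ 2 ^ L - B.card := by linarith
      _ ≤ ((2 ^ L - B.card : ℕ) : ℝ) := hle
      _ ≤ _ := by exact_mod_cast hcard

/-! ### Signings of real matrices -/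

theorem exists_rat_matrix_near {m : ℕ} (M : Matrix (Fin m) (Fin m) ℝ) {η : ℝ} (hη : 0 < η) :
    ∃ B : Matrix (Fin m) (Fin m) ℚ, ‖B.map (fun a => (a : ℝ)) - M‖ < η := by
  let f : (Fin m → Fin m → ℝ) →ₗ[ℝ] Matrix (Fin m) (Fin m) ℝ :=
    (Matrix.ofLinearEquiv ℝ : (Fin m → Fin m → ℝ) ≃ₗ[ℝ] Matrix (Fin m) (Fin m) ℝ).toLinearMap
  have hf : Continuous f := f.continuous_of_finiteDimensional
  have hd : DenseRange (Pi.map fun _ => Pi.map fun _ => (Rat.cast : ℚ → ℝ) :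
      (Fin m → Fin m → ℚ) → Fin m → Fin m → ℝ) :=
    .piMap fun _ => .piMap fun _ => Rat.denseRange_cast
  obtain ⟨B, hB⟩ := hd.exists_mem_open (Metric.isOpen_ball.preimage hf)
    ⟨fun i j => M i j, show f _ ∈ Metric.ball M η from Metric.mem_ball_self hη⟩
  exact ⟨Matrix.of B, mem_ball_iff_norm.1 hB⟩

/-- A positive success probability provides a signing. For n = m = 0 the guaranteed probability is
0, so n must be positive. -/
theorem FindsSigningsInPolyTime.exists_signing_rat {P : Program} {C : ℝ}
    (h : FindsSigningsInPolyTime P C) {n m : ℕ} (hn : 0 < n)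
    (A : Fin n → Matrix (Fin m) (Fin m) ℚ) (hA : ∀ i, ‖toReal A i‖ ≤ 1) :
    ∃ x : Fin n → ℤˣ, signedNorm (toReal A) x ≤ C * spencerBound n m := by
  obtain ⟨time, coins, h⟩ := h
  have h2 := (h n m A hA).2
  have hpos : (0 : ℝ) < (1 - 1 / 2 ^ (n + m)) * 2 ^ coins.eval (inputSize A) := by
    have : (1 : ℝ) < 2 ^ (n + m) := one_lt_pow₀ (by norm_num) (by omega)
    have h3 : 1 / (2 : ℝ) ^ (n + m) < 1 := (div_lt_one (by positivity)).2 this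
    exact mul_pos (by linarith) (by positivity)
  have hcard := hpos.trans_le h2
  rw [Nat.cast_pos] at hcard
  obtain ⟨t, k, s, -, x, -, hx⟩ := Set.nonempty_of_ncard_ne_zero hcard.ne'
  exact ⟨x, hx⟩

theorem FindsSigningsInPolyTime.exists_signing {P : Program} {C : ℝ}
    (h : FindsSigningsInPolyTime P C) (hC : 0 ≤ C) (n m : ℕ)
    (A : Fin n → Matrix (Fin m) (Fin m) ℝ) (hA : ∀ i, ‖A i‖ ≤ 1) :
    ∃ x : Fin n → ℤˣ, signedNorm A x ≤ C * spencerBound n m := by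
  rcases Nat.eq_zero_or_pos n with rfl | hn
  · refine ⟨fun _ => 1, ?_⟩
    simp only [signedNorm, Finset.univ_eq_empty, Finset.sum_empty, norm_zero]
    exact mul_nonneg hC (Real.sqrt_nonneg _)
  -- The optimal signing is fixed before the approximation, so it satisfies the bound up to every ε
  -- and hence exactly.
  obtain ⟨x, hx⟩ := Finite.exists_min (signedNorm A)
  refine ⟨x, le_of_forall_pos_le_add fun ε hε => ?_⟩
  have hnR : (0 : ℝ) < n := by exact_mod_cast hn
  set η := min (1 / 2) (ε / (2 * n)) with hη
  have hη0 : 0 < η := by positivity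
  have hη1 : η ≤ 1 / 2 := min_le_left _ _
  have hη2 : 2 * n * η ≤ ε := by
    have : η ≤ ε / (2 * n) := min_le_right _ _
    rwa [le_div_iff₀ (by positivity), mul_comm] at this
  -- Shrinking by 1 - η first keeps the rational matrices within norm 1. Each is then within 2η of A
  -- i, and n such errors add up to at most ε.
  choose B hB using fun i => exists_rat_matrix_near ((1 - η) • A i) hη0
  have hB' : ∀ i, ‖toReal B i - (1 - η) • A i‖ < η := hB
  have hscale : ∀ i, ‖(1 - η) • A i‖ ≤ 1 - η := fun i => by
    rw [norm_smul, Real.norm_of_nonneg (by linarith)]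
    exact mul_le_of_le_one_right (by linarith) (hA i)
  have hB1 : ∀ i, ‖toReal B i‖ ≤ 1 := fun i => by
    have h1 : toReal B i = (1 - η) • A i + (toReal B i - (1 - η) • A i) := by abel
    rw [h1]
    exact (norm_add_le _ _).trans (by linarith [hscale i, hB' i])
  have hdiff : ∀ i, ‖A i - toReal B i‖ ≤ 2 * η := fun i => by
    have h1 : A i - toReal B i = η • A i - (toReal B i - (1 - η) • A i) := by
      rw [sub_smul, one_smul]; abel
    rw [h1]
    refine (norm_sub_le _ _).trans ?_
    have h2 : ‖η • A i‖ ≤ η := by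
      rw [norm_smul, Real.norm_of_nonneg hη0.le]
      exact mul_le_of_le_one_right hη0.le (hA i)
    linarith [hB' i]
  obtain ⟨x', hx'⟩ := h.exists_signing_rat hn B hB1
  refine (hx x').trans ?_
  have hsplit : ∑ i, (((x' i : ℤˣ) : ℤ) : ℝ) • A i = ∑ i, (((x' i : ℤˣ) : ℤ) : ℝ) • toReal B i +
      ∑ i, (((x' i : ℤˣ) : ℤ) : ℝ) • (A i - toReal B i) := by
    rw [← Finset.sum_add_distrib]
    exact Finset.sum_congr rfl fun i _ => by rw [smul_sub]; abel
  rw [signedNorm, hsplit]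
  refine (norm_add_le _ _).trans (add_le_add hx' ?_)
  calc ‖∑ i, (((x' i : ℤˣ) : ℤ) : ℝ) • (A i - toReal B i)‖ ≤ ∑ i : Fin n, 2 * η :=
        norm_sum_le_of_le _ fun i _ => by
          rw [norm_smul, Real.norm_eq_abs, abs_int_unit, one_mul]; exact hdiff i
    _ = 2 * n * η := by simp; ring
    _ ≤ ε := hη2

end

theorem mainTheorem3 (hconj : QuantumOneWayConjecture) :
    ∃ C : ℝ, 0 < C ∧
      -- every family of matrices of norm at most one has a signing of small discrepancy
      (∀ (n m : ℕ) (A : Fin n → Matrix (Fin m) (Fin m) ℝ), (∀ i, ‖A i‖ ≤ 1) →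
        ∃ x : Fin n → ℤˣ, signedNorm A x ≤ C * spencerBound n m) ∧
      -- partial colorings: the semidefinite program with random objective
      (∃ c : ℝ, 0 < c ∧
        ∀ (n m : ℕ) (A : Fin n → Matrix (Fin m) (Fin m) ℝ), (∀ i, ‖A i‖ ≤ 1) →
          c / n * 2 ^ n ≤
            (({g : Fin n → ℤˣ | ∀ x : Fin n → ℝ, IsSDPOptimum A (C * spencerBound n m) g x →
              c * n ≤ (({i | |x i| = 1} : Set (Fin n)).ncard : ℝ)}.ncard : ℕ) : ℝ)) ∧
      -- a randomized polynomial-time algorithm that finds the signing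
      ∃ P : Program, FindsSigningsInPolyTime P C := by
  obtain ⟨δ, hδ, -, κ, hκ, hrare⟩ := hconj.isStuck_rare
  -- c makes the norm bound of a round large enough to certify stuckness, and 1 / d is a progress
  -- fraction not exceeding δ. The constant C below dominates the requirements of the semidefinite
  -- program and of the algorithm.
  obtain ⟨c, hc⟩ := exists_nat_ge (max 1 (100 * κ ^ 2))
  obtain ⟨d, hd⟩ := exists_nat_ge (max 1 (1 / δ))
  have hc1 : 1 ≤ c := by exact_mod_cast (le_max_left _ _).trans hc
  have hd1 : 1 ≤ d := by exact_mod_cast (le_max_left _ _).trans hd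
  have hδd : 1 ≤ δ * d := by
    have := (le_max_right _ _).trans hd
    rwa [div_le_iff₀ hδ, mul_comm] at this
  set C := max (2 * κ) (4 * d * √(12 * c)) with hC
  have hC0 : 0 < C := lt_max_of_lt_left (by positivity)
  have halg := spencerProgram_findsSignings hrare hc1 ((le_max_right _ _).trans hc) hd1 hδd
    (le_max_right (2 * κ) _ : _ ≤ C)
  exact ⟨C, hC0, halg.exists_signing hC0.le, sdp_partial_coloring hδ (le_max_left _ _) hrare,
    _, halg⟩
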